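/- Let $n\ge 1$ and let $M$ be a compact strictly pseudoconvex CR manifold (of hypersurface type) of real dimension $2n+1$, with CR structure $(H,J)$. Let $0<T\le\infty$ and let $\theta(t)$, $t\in[0,T)$, be a smooth family of contact forms on $M$ with $\ker\theta(t)=H$ and positive definite Levi form $d\theta(t)(\cdot,J\cdot)$ on $H$, and write $R_{\theta(t)}$ for the Webster scalar curvature of $\theta(t)$, i.e. the scalar trace of the curvature of its Tanaka–Webster connection. Suppose that $\theta(t)$ is a CR Yamabe soliton: it solves the unnormalized CR Yamabe flow $$\frac{\partial}{\partial t}\theta(t)=-R_{\theta(t)}\,\theta(t),\qquad t\in[0,T),$$ and there are a smooth function $\sigma:[0,T)\to\mathbb{R}$ with $\sigma(0)=1$ and CR diffeomorphisms $\psi_t$ of $M$, $t\in[0,T)$, with $\psi_0=\mathrm{id}_M$, such that $$\theta(t)=\sigma(t)\,\psi_t^*\theta(0)\qquad\text{for all }t\in[0,T).$$ Then for every $t\in[0,T)$ the Webster scalar curvature $R_{\theta(t)}$ is constant on $M$. -/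

import Mathlib

open Bundle FiberBundle VectorField Set
open scoped Manifold ContDiff Topology

noncomputable section

namespace CRGeometry

section General

variable {E : Type*} [NormedAddCommGroup E] [NormedSpace ℝ E]
  {H : Type*} [TopologicalSpace H] (I : ModelWithCorners ℝ E H)
  {M : Type*} [TopologicalSpace M] [ChartedSpace H M]

/-- A (not necessarily continuous) differential 1-form on `M`. -/
abbrev OneForm : Type _ := ∀ x : M, TangentSpace I x →L[ℝ] ℝ

/-- A vector field on `M` is smooth. -/
def IsSmoothField [IsManifold I 1 M] (X : ∀ x : M, TangentSpace I x) : Prop :=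
  ContMDiff I I.tangent ∞ (fun x => (⟨x, X x⟩ : TangentBundle I M))

/-- A 1-form, seen as a section of the cotangent bundle. -/
def OneForm.section (θ : ∀ x : M, TangentSpace I x →L[ℝ] ℝ) (x : M) :
    TotalSpace (E →L[ℝ] ℝ) (fun x : M => TangentSpace I x →L[ℝ] Trivial M ℝ x) :=
  ⟨x, θ x⟩

/-- A 1-form is smooth, as a section of the cotangent bundle. -/
def IsSmoothOneForm [IsManifold I 1 M] (θ : ∀ x : M, TangentSpace I x →L[ℝ] ℝ) : Prop :=
  ContMDiff I (I.prod 𝓘(ℝ, E →L[ℝ] ℝ)) ∞ (OneForm.section I θ)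

/-- A family of 1-forms `θ t`, `t ∈ s`, is jointly smooth in `t` and in the point of `M`. -/
def IsSmoothOneFormFamily [IsManifold I 1 M] (s : Set ℝ)
    (θ : ℝ → ∀ x : M, TangentSpace I x →L[ℝ] ℝ) : Prop :=
  ContMDiffOn (𝓘(ℝ, ℝ).prod I) (I.prod 𝓘(ℝ, E →L[ℝ] ℝ)) ∞
    (fun p : ℝ × M => OneForm.section I (θ p.1) p.2) (s ×ˢ univ)

/-- The expression `X(θ(Y)) - Y(θ(X)) - θ([X, Y])` for vector fields `X`, `Y`. -/
def exteriorDOnFields (θ : ∀ x : M, TangentSpace I x →L[ℝ] ℝ)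
    (X Y : ∀ x : M, TangentSpace I x) (x : M) : ℝ :=
  mvfderiv I (fun y => θ y (Y y)) x (X x) - mvfderiv I (fun y => θ y (X y)) x (Y x)
    - θ x (mlieBracket I X Y x)

/-- The exterior derivative `dθ` of a 1-form `θ`, with the convention
`dθ(X, Y) = X(θ(Y)) - Y(θ(X)) - θ([X, Y])`; the two tangent vectors are extended to vector fields
that are smooth near the point, and `exteriorD_apply_fields` shows that the choice of the extension
is irrelevant. -/
def exteriorD [IsManifold I 1 M] (θ : ∀ x : M, TangentSpace I x →L[ℝ] ℝ) (x : M)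
    (v w : TangentSpace I x) : ℝ :=
  exteriorDOnFields I θ (extend E v) (extend E w) x

variable {I}

theorem mdifferentiableAt_oneForm_apply [IsManifold I 1 M]
    {θ : ∀ x : M, TangentSpace I x →L[ℝ] ℝ} (hθ : IsSmoothOneForm I θ)
    {X : ∀ x : M, TangentSpace I x} {x : M}
    (hX : MDifferentiableAt I I.tangent (fun y => (⟨y, X y⟩ : TangentBundle I M)) x) :
    MDifferentiableAt I 𝓘(ℝ, ℝ) (fun y => θ y (X y)) x := by
  have h1 : MDifferentiableAt I (I.prod 𝓘(ℝ, E →L[ℝ] ℝ)) (OneForm.section I θ) x :=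
    (hθ x).mdifferentiableAt (by simp)
  have h2 := MDifferentiableAt.clm_bundle_apply (F₁ := E) (F₂ := ℝ)
    (E₁ := (TangentSpace I : M → Type _)) (E₂ := Trivial M ℝ) (b := fun y : M => y)
    (ϕ := fun y => (θ y : TangentSpace I y →L[ℝ] Trivial M ℝ y)) h1 hX
  rw [mdifferentiableAt_totalSpace] at h2
  exact h2.2

theorem exteriorDOnFields_tensorial_right [IsManifold I 2 M] [CompleteSpace E]
    {θ : ∀ x : M, TangentSpace I x →L[ℝ] ℝ} (hθ : IsSmoothOneForm I θ)
    (X : ∀ x : M, TangentSpace I x) (x : M)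
    (_hX : MDifferentiableAt I I.tangent (fun y => (⟨y, X y⟩ : TangentBundle I M)) x) :
    TensorialAt I E (fun Y => exteriorDOnFields I θ X Y x) x where
  smul {f Y} hf hY := by
    have hY' := mdifferentiableAt_oneForm_apply hθ hY
    have e : (fun y => θ y ((f • Y) y)) = fun y => f y * θ y (Y y) := by
      ext y; simp
    simp only [exteriorDOnFields, e, mvfderiv_fun_mul hf hY', mlieBracket_smul_right hf hY]
    simp
    ring
  add {Y Y'} hY hY' := by
    have h1 := mdifferentiableAt_oneForm_apply hθ hY
    have h2 := mdifferentiableAt_oneForm_apply hθ hY'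
    have e : (fun y => θ y ((Y + Y') y)) = fun y => θ y (Y y) + θ y (Y' y) := by
      ext y; simp
    simp only [exteriorDOnFields, e, mvfderiv_fun_add h1 h2, mlieBracket_add_right hY hY']
    simp
    ring

theorem exteriorDOnFields_swap [IsManifold I 1 M]
    (θ : ∀ x : M, TangentSpace I x →L[ℝ] ℝ) (X Y : ∀ x : M, TangentSpace I x) (x : M) :
    exteriorDOnFields I θ X Y x = - exteriorDOnFields I θ Y X x := by
  simp only [exteriorDOnFields]
  rw [mlieBracket_swap_apply, map_neg]
  ring

theorem exteriorDOnFields_tensorial_left [IsManifold I 2 M] [CompleteSpace E]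
    {θ : ∀ x : M, TangentSpace I x →L[ℝ] ℝ} (hθ : IsSmoothOneForm I θ)
    (Y : ∀ x : M, TangentSpace I x) (x : M)
    (hY : MDifferentiableAt I I.tangent (fun y => (⟨y, Y y⟩ : TangentBundle I M)) x) :
    TensorialAt I E (fun X => exteriorDOnFields I θ X Y x) x where
  smul hf hX := by
    simp only [exteriorDOnFields_swap θ _ Y]
    rw [(exteriorDOnFields_tensorial_right hθ Y x hY).smul hf hX, smul_neg]
  add hX hX' := by
    simp only [exteriorDOnFields_swap θ _ Y]
    rw [(exteriorDOnFields_tensorial_right hθ Y x hY).add hX hX', neg_add]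

/-- `dθ(X, Y) = X(θ(Y)) - Y(θ(X)) - θ([X, Y])` for all differentiable vector fields. -/
theorem exteriorD_apply_fields [IsManifold I 2 M] [FiniteDimensional ℝ E]
    {θ : ∀ x : M, TangentSpace I x →L[ℝ] ℝ} (hθ : IsSmoothOneForm I θ)
    {X Y : ∀ x : M, TangentSpace I x} {x : M}
    (hX : MDifferentiableAt I I.tangent (fun y => (⟨y, X y⟩ : TangentBundle I M)) x)
    (hY : MDifferentiableAt I I.tangent (fun y => (⟨y, Y y⟩ : TangentBundle I M)) x) :
    exteriorD I θ x (X x) (Y x) = exteriorDOnFields I θ X Y x :=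
  have : CompleteSpace E := FiniteDimensional.complete ℝ E
  TensorialAt.pointwise₂ (Φ := fun X Y => exteriorDOnFields I θ X Y x)
    (fun Y hY => exteriorDOnFields_tensorial_left hθ Y x hY)
    (fun X hX => exteriorDOnFields_tensorial_right hθ X x hX)
    (mdifferentiableAt_extend ..) hX (mdifferentiableAt_extend ..) hY (by simp) (by simp)

/-- The curvature `∇_X ∇_Y Z - ∇_Y ∇_X Z - ∇_{[X, Y]} Z` of a connection on the tangent bundle. -/
def curvature [IsManifold I 1 M] (D : CovariantDerivative I E (TangentSpace I : M → Type _))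
    (X Y Z : ∀ x : M, TangentSpace I x) (x : M) : TangentSpace I x :=
  D (fun y => D Z y (Y y)) x (X x) - D (fun y => D Z y (X y)) x (Y x)
    - D Z x (mlieBracket I X Y x)

end General

section CR

variable (n : ℕ) (M : Type*) [TopologicalSpace M]
  [ChartedSpace (EuclideanSpace ℝ (Fin (2 * n + 1))) M] [IsManifold (𝓡 (2 * n + 1)) ∞ M]

/-- An almost CR structure of hypersurface type on a manifold of dimension `2n+1`: a smooth
subbundle `H` of rank `2n` of the tangent bundle, with a smooth complex structure `J` on `H`. -/
structure AlmostCRStructure where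
  /-- the fibres of the subbundle -/
  H : ∀ x : M, Submodule ℝ (TangentSpace (𝓡 (2 * n + 1)) x)
  /-- the complex structure -/
  J : ∀ x : M, H x →ₗ[ℝ] H x
  finrank_H : ∀ x, Module.finrank ℝ (H x) = 2 * n
  exists_smooth_section : ∀ (x : M) (v : H x), ∃ X : ∀ y, H y,
    IsSmoothField (𝓡 (2 * n + 1)) (fun y => (X y : TangentSpace (𝓡 (2 * n + 1)) y)) ∧ X x = v
  J_J : ∀ (x : M) (v : H x), J x (J x v) = -v
  smooth_J : ∀ X : ∀ y, H y,
    IsSmoothField (𝓡 (2 * n + 1)) (fun y => (X y : TangentSpace (𝓡 (2 * n + 1)) y)) →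
    IsSmoothField (𝓡 (2 * n + 1)) (fun y => (J y (X y) : TangentSpace (𝓡 (2 * n + 1)) y))

variable {n M}

/-- Smooth sections of `H`. -/
structure AlmostCRStructure.HorizontalField (S : AlmostCRStructure n M) where
  /-- the section -/
  val : ∀ x, S.H x
  smooth : IsSmoothField (𝓡 (2 * n + 1)) (fun x => (val x : TangentSpace (𝓡 (2 * n + 1)) x))

namespace AlmostCRStructure.HorizontalField

variable {S : AlmostCRStructure n M}

/-- A section of `H` as a vector field on `M`. -/
def field (X : S.HorizontalField) (x : M) : TangentSpace (𝓡 (2 * n + 1)) x := X.val x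

/-- The section `JX` of `H`. -/
def J (X : S.HorizontalField) : S.HorizontalField where
  val x := S.J x (X.val x)
  smooth := S.smooth_J _ X.smooth

end AlmostCRStructure.HorizontalField

variable (n M) in
/-- A CR structure of hypersurface type: an almost CR structure `(H, J)` that is formally
integrable, i.e. such that `[T¹⁰, T¹⁰] ⊆ T¹⁰` for `T¹⁰ = {X - iJX | X ∈ H}`. In real terms:
`[X, Y] - [JX, JY]` is a section of `H`, and `J` sends it to `[JX, Y] + [X, JY]`. -/
structure CRStructure extends AlmostCRStructure n M where
  integrable : ∀ (X Y : toAlmostCRStructure.HorizontalField) (x : M),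
    ∃ h : mlieBracket (𝓡 (2 * n + 1)) X.field Y.field x
        - mlieBracket (𝓡 (2 * n + 1)) X.J.field Y.J.field x ∈ H x,
      (J x ⟨_, h⟩ : TangentSpace (𝓡 (2 * n + 1)) x) =
        mlieBracket (𝓡 (2 * n + 1)) X.J.field Y.field x
          + mlieBracket (𝓡 (2 * n + 1)) X.field Y.J.field x

/-- `T` is the Reeb field of the contact form `θ`. -/
structure IsReebField (θ : OneForm (𝓡 (2 * n + 1)) (M := M))
    (T : ∀ x : M, TangentSpace (𝓡 (2 * n + 1)) x) : Prop where
  smooth : IsSmoothField (𝓡 (2 * n + 1)) T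
  apply_eq_one : ∀ x, θ x (T x) = 1
  exteriorD_eq_zero : ∀ x v, exteriorD (𝓡 (2 * n + 1)) θ x (T x) v = 0

namespace CRStructure

variable (S : CRStructure n M)

/-- The (real) Levi form `(v, w) ↦ dθ(v, Jw)` on `H`. -/
def leviForm (θ : OneForm (𝓡 (2 * n + 1)) (M := M)) (x : M) (v w : S.H x) : ℝ :=
  exteriorD (𝓡 (2 * n + 1)) θ x v (S.J x w)

/-- `θ` is a smooth contact form with kernel `H` whose Levi form is positive definite. A CR
structure that has such a `θ` is strictly pseudoconvex. -/
structure IsPseudohermitian (θ : OneForm (𝓡 (2 * n + 1)) (M := M)) : Prop where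
  smooth : IsSmoothOneForm (𝓡 (2 * n + 1)) θ
  ker_eq : ∀ (x : M) (v : TangentSpace (𝓡 (2 * n + 1)) x), θ x v = 0 ↔ v ∈ S.H x
  levi_pos : ∀ (x : M) (v : S.H x), v ≠ 0 → 0 < S.leviForm θ x v v

/-- `D` is the Tanaka-Webster connection of the contact form `θ` with Reeb field `T`: the linear
connection for which `H`, `J`, `T` and the Levi form are parallel and whose torsion satisfies
`Tor(v, w) = dθ(v, w) T` and `Tor(T, Jv) = -J Tor(T, v)` for `v`, `w` in `H`. -/
structure IsTanakaWebster (θ : OneForm (𝓡 (2 * n + 1)) (M := M))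
    (T : ∀ x : M, TangentSpace (𝓡 (2 * n + 1)) x)
    (D : CovariantDerivative (𝓡 (2 * n + 1)) (EuclideanSpace ℝ (Fin (2 * n + 1)))
      (TangentSpace (𝓡 (2 * n + 1)) : M → Type _)) : Prop where
  smooth : ContMDiffCovariantDerivativeOn (EuclideanSpace ℝ (Fin (2 * n + 1))) ∞ D.toFun univ
  horizontal : ∀ (Y : S.HorizontalField) (x : M) (v : TangentSpace (𝓡 (2 * n + 1)) x),
    D Y.field x v ∈ S.H x
  parallel_J : ∀ (Y : S.HorizontalField) (x : M) (v : TangentSpace (𝓡 (2 * n + 1)) x),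
    D Y.J.field x v = S.J x ⟨D Y.field x v, horizontal Y x v⟩
  parallel_reeb : ∀ (x : M) (v : TangentSpace (𝓡 (2 * n + 1)) x), D T x v = 0
  parallel_levi : ∀ (Y Z : S.HorizontalField) (x : M) (v : TangentSpace (𝓡 (2 * n + 1)) x),
    mvfderiv (𝓡 (2 * n + 1)) (fun y => S.leviForm θ y (Y.val y) (Z.val y)) x v =
      S.leviForm θ x ⟨D Y.field x v, horizontal Y x v⟩ (Z.val x)
        + S.leviForm θ x (Y.val x) ⟨D Z.field x v, horizontal Z x v⟩
  torsion_horizontal : ∀ (x : M) (v w : S.H x),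
    D.torsion x v w = exteriorD (𝓡 (2 * n + 1)) θ x v w • T x
  torsion_reeb : ∀ (x : M) (v : S.H x), ∃ h : D.torsion x (T x) v ∈ S.H x,
    D.torsion x (T x) (S.J x v) = -(S.J x ⟨D.torsion x (T x) v, h⟩ : S.H x)

/-- At the point `x`, the vectors `e₁, Je₁, …, eₙ, Jeₙ` are orthonormal for the Levi form. -/
def IsUnitaryAt (θ : OneForm (𝓡 (2 * n + 1)) (M := M)) (x : M)
    (e : Fin n → S.HorizontalField) : Prop :=
  ∀ a b, S.leviForm θ x ((e a).val x) ((e b).val x) = (if a = b then 1 else 0) ∧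
    S.leviForm θ x ((e a).val x) ((e b).J.val x) = 0

/-- `r` is the Webster scalar curvature of `θ` at `x`: with the curvature `Rm` of the
Tanaka-Webster connection and the Levi form `⟨·, ·⟩`, one has
`r = ∑ a b, ⟨Rm(eₐ, Jeₐ) Je_b, e_b⟩` for all sections `e₁, …, eₙ` of `H` that are unitary at `x`.
In terms of the complex frame `Z_α = (e_α - iJe_α)/√2`, for which `h_{αβ̄} = -i dθ(Z_α, Z̄_β)` is
the identity matrix at `x` (that is, `dθ = i h_{αβ̄} θ^α ∧ θ^β̄`), the sum is the full trace
`h^{αβ̄} R_γ^γ_{αβ̄}` of the pseudohermitian curvature tensor. In this normalization the form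
`i(∂̄ - ∂)|z|²` on the unit sphere of `ℂⁿ⁺¹` has Webster scalar curvature `n(n+1)/2`. -/
def IsWebsterScalarAt (θ : OneForm (𝓡 (2 * n + 1)) (M := M)) (x : M) (r : ℝ) : Prop :=
  ∃ T D, IsReebField θ T ∧ S.IsTanakaWebster θ T D ∧
    ∀ e : Fin n → S.HorizontalField, S.IsUnitaryAt θ x e →
      r = ∑ a, ∑ b, exteriorD (𝓡 (2 * n + 1)) θ x
        (curvature D (e a).field (e a).J.field (e b).J.field x) ((e b).J.field x)

open Classical in
/-- The Webster scalar curvature of the contact form `θ` (the number `r` above exists and is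
unique when `θ` is a contact form with positive definite Levi form). -/
def websterScalar (θ : OneForm (𝓡 (2 * n + 1)) (M := M)) (x : M) : ℝ :=
  if h : ∃ r, S.IsWebsterScalarAt θ x r then h.choose else 0

/-- A CR diffeomorphism: a diffeomorphism whose differential maps `H` to `H` and commutes
with `J`. -/
def IsCRDiffeomorphism (ψ : Diffeomorph (𝓡 (2 * n + 1)) (𝓡 (2 * n + 1)) M M ∞) : Prop :=
  ∀ (x : M) (v : S.H x),
    ∃ h : (mfderiv (𝓡 (2 * n + 1)) (𝓡 (2 * n + 1)) ψ x v : TangentSpace (𝓡 (2 * n + 1)) (ψ x))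
        ∈ S.H (ψ x),
      (S.J (ψ x) ⟨_, h⟩ : TangentSpace (𝓡 (2 * n + 1)) (ψ x)) =
        mfderiv (𝓡 (2 * n + 1)) (𝓡 (2 * n + 1)) ψ x (S.J x v)

end CRStructure

/-- The pullback `ψ^*θ`. -/
def pullback (ψ : M → M) (θ : OneForm (𝓡 (2 * n + 1)) (M := M)) :
    OneForm (𝓡 (2 * n + 1)) (M := M) :=
  fun x => (θ (ψ x)).comp (mfderiv (𝓡 (2 * n + 1)) (𝓡 (2 * n + 1)) ψ x)

/-- The time interval `[0, T)`, where `T = ∞` is allowed. -/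
def timeInterval (T : EReal) : Set ℝ := {t | 0 ≤ t ∧ (t : EReal) < T}

namespace CRStructure

variable (S : CRStructure n M)

/-- `θ(t)`, `t ∈ [0, T)`, is a smooth solution of the unnormalized CR Yamabe flow
`∂θ/∂t = -R θ`, where `R` is the Webster scalar curvature of `θ(t)`. -/
structure IsCRYamabeFlow (T : EReal) (θ : ℝ → OneForm (𝓡 (2 * n + 1)) (M := M)) : Prop where
  pseudohermitian : ∀ t ∈ timeInterval T, S.IsPseudohermitian (θ t)
  smooth : IsSmoothOneFormFamily (𝓡 (2 * n + 1)) (timeInterval T) θ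
  evolution : ∀ t ∈ timeInterval T, ∀ (x : M) (v : TangentSpace (𝓡 (2 * n + 1)) x),
    HasDerivWithinAt (fun s => θ s x v) (-(S.websterScalar (θ t) x * θ t x v)) (timeInterval T) t

/-- `θ(t)`, `t ∈ [0, T)`, is a CR Yamabe soliton: a solution of the CR Yamabe flow of the form
`θ(t) = σ(t) ψ_t^*(θ(0))` with a smooth function `σ` and CR diffeomorphisms `ψ_t`, where
`σ(0) = 1` and `ψ_0 = id`. -/
structure IsCRYamabeSoliton (T : EReal) (θ : ℝ → OneForm (𝓡 (2 * n + 1)) (M := M)) : Prop where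
  flow : S.IsCRYamabeFlow T θ
  selfSimilar : ∃ (σ : ℝ → ℝ) (ψ : ℝ → Diffeomorph (𝓡 (2 * n + 1)) (𝓡 (2 * n + 1)) M M ∞),
    ContDiffOn ℝ ∞ σ (timeInterval T) ∧ σ 0 = 1 ∧
    (∀ t ∈ timeInterval T, S.IsCRDiffeomorphism (ψ t)) ∧
    ψ 0 = Diffeomorph.refl (𝓡 (2 * n + 1)) M ∞ ∧
    ∀ t ∈ timeInterval T, ∀ x, θ t x = σ t • pullback (ψ t) (θ 0) x

end CRStructure

end CR

end CRGeometry

end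

noncomputable section

namespace CRGeometry

section Calculus

variable {E : Type*} [NormedAddCommGroup E] [NormedSpace ℝ E]
  {H : Type*} [TopologicalSpace H] {I : ModelWithCorners ℝ E H}
  {M : Type*} [TopologicalSpace M] [ChartedSpace H M] [IsManifold I ∞ M]

theorem IsSmoothField.mdifferentiableAt {X : ∀ x : M, TangentSpace I x} (hX : IsSmoothField I X)
    (x : M) : MDifferentiableAt I I.tangent (fun y => (⟨y, X y⟩ : TangentBundle I M)) x :=
  (hX x).mdifferentiableAt (by simp)

theorem IsSmoothField.add {X Y : ∀ x : M, TangentSpace I x} (hX : IsSmoothField I X)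
    (hY : IsSmoothField I Y) : IsSmoothField I (X + Y) :=
  ContMDiff.add_section hX hY

theorem IsSmoothField.sub {X Y : ∀ x : M, TangentSpace I x} (hX : IsSmoothField I X)
    (hY : IsSmoothField I Y) : IsSmoothField I (X - Y) :=
  ContMDiff.sub_section hX hY

theorem IsSmoothField.smul {f : M → ℝ} {X : ∀ x : M, TangentSpace I x}
    (hf : ContMDiff I 𝓘(ℝ, ℝ) ∞ f) (hX : IsSmoothField I X) : IsSmoothField I (f • X) :=
  ContMDiff.smul_section hf hX

theorem IsSmoothField.const_smul {X : ∀ x : M, TangentSpace I x} (c : ℝ)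
    (hX : IsSmoothField I X) : IsSmoothField I (c • X) :=
  ContMDiff.const_smul_section hX

theorem minSmoothness_two_le : minSmoothness ℝ 2 ≤ (∞ : ℕ∞ω) := by
  rw [minSmoothness_of_isRCLikeNormedField]
  exact WithTop.coe_le_coe.2 (le_top : (2 : ℕ∞) ≤ ⊤)

theorem minSmoothness_three_le : minSmoothness ℝ 3 ≤ (∞ : ℕ∞ω) := by
  rw [minSmoothness_of_isRCLikeNormedField]
  exact WithTop.coe_le_coe.2 (le_top : (3 : ℕ∞) ≤ ⊤)

theorem IsSmoothField.mlieBracket [CompleteSpace E] {X Y : ∀ x : M, TangentSpace I x}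
    (hX : IsSmoothField I X) (hY : IsSmoothField I Y) : IsSmoothField I (mlieBracket I X Y) := by
  intro x
  have : IsManifold I (((⊤ : ℕ∞) : ℕ∞ω) + 1) M := IsManifold.of_le (n := ∞) (by simp)
  have : IsManifold I (minSmoothness ℝ 2) M := IsManifold.of_le (n := ∞) minSmoothness_two_le
  exact ContMDiffAt.mlieBracket_vectorField (m := ⊤) (n := ⊤) (hX x) (hY x) (by simp)

theorem IsSmoothOneForm.contMDiff_apply {θ : ∀ x : M, TangentSpace I x →L[ℝ] ℝ}
    (hθ : IsSmoothOneForm I θ) {X : ∀ x : M, TangentSpace I x} (hX : IsSmoothField I X) :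
    ContMDiff I 𝓘(ℝ, ℝ) ∞ (fun x => θ x (X x)) := by
  intro x
  have h2 := ContMDiffAt.clm_bundle_apply (F₁ := E) (F₂ := ℝ) (n := ∞)
    (E₁ := (TangentSpace I : M → Type _)) (E₂ := Trivial M ℝ) (b := fun y : M => y)
    (ϕ := fun y => (θ y : TangentSpace I y →L[ℝ] Trivial M ℝ y)) (hθ x) (hX x)
  rw [contMDiffAt_totalSpace] at h2
  exact h2.2

theorem contMDiff_mvfderiv_apply {f : M → ℝ} (hf : ContMDiff I 𝓘(ℝ, ℝ) ∞ f)
    {X : ∀ x : M, TangentSpace I x} (hX : IsSmoothField I X) :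
    ContMDiff I 𝓘(ℝ, ℝ) ∞ (fun x => mvfderiv I f x (X x)) := by
  have h1 : ContMDiff I.tangent 𝓘(ℝ, ℝ).tangent ∞ (tangentMap I 𝓘(ℝ, ℝ) f) :=
    hf.contMDiff_tangentMap (by simp)
  have h2 := h1.comp hX
  intro x
  have h3 := h2 x
  rw [contMDiffAt_totalSpace] at h3
  refine h3.2.congr_of_eventuallyEq (Filter.Eventually.of_forall fun y => ?_)
  simp [tangentMap, mvfderiv]
  rfl

/-- `[X, Y] f = X (Y f) - Y (X f)`. -/
theorem mvfderiv_mlieBracket [CompleteSpace E] {f : M → ℝ} (hf : ContMDiff I 𝓘(ℝ, ℝ) ∞ f)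
    {X Y W : ∀ x : M, TangentSpace I x} (hX : IsSmoothField I X) (hY : IsSmoothField I Y)
    (hW : IsSmoothField I W) {x : M} (hx : W x ≠ 0) :
    mvfderiv I f x (mlieBracket I X Y x) =
      mvfderiv I (fun y => mvfderiv I f y (Y y)) x (X x)
        - mvfderiv I (fun y => mvfderiv I f y (X y)) x (Y x) := by
  have : IsManifold I (minSmoothness ℝ 3) M := IsManifold.of_le (n := ∞) minSmoothness_three_le
  have hf' : MDifferentiable I 𝓘(ℝ, ℝ) f := hf.mdifferentiable (by simp)
  have key : ∀ {A B : ∀ x : M, TangentSpace I x}, IsSmoothField I A → IsSmoothField I B →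
      VectorField.mlieBracket I A (VectorField.mlieBracket I B (f • W)) x =
        f x • VectorField.mlieBracket I A (VectorField.mlieBracket I B W) x
        + mvfderiv I f x (A x) • VectorField.mlieBracket I B W x
        + mvfderiv I f x (B x) • VectorField.mlieBracket I A W x
        + mvfderiv I (fun y => mvfderiv I f y (B y)) x (A x) • W x := by
    intro A B hA hB
    have e : VectorField.mlieBracket I B (f • W) =
        (fun y => mvfderiv I f y (B y)) • W + f • VectorField.mlieBracket I B W := by
      ext1 y
      simp [mlieBracket_smul_right (hf' y) (hW.mdifferentiableAt y)]
    have hBf := contMDiff_mvfderiv_apply hf hB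
    rw [e, mlieBracket_add_right ((hW.smul hBf).mdifferentiableAt x)
      (((hB.mlieBracket hW).smul hf).mdifferentiableAt x),
      mlieBracket_smul_right (hBf.mdifferentiable (by simp) x) (hW.mdifferentiableAt x),
      mlieBracket_smul_right (hf' x) ((hB.mlieBracket hW).mdifferentiableAt x)]
    module
  have hms := minSmoothness_two_le
  have J1 := leibniz_identity_mlieBracket_apply (I := I) (x := x) ((hX x).of_le hms)
    ((hY x).of_le hms) (((hW.smul hf) x).of_le hms)
  have J2 := leibniz_identity_mlieBracket_apply (I := I) (x := x) ((hX x).of_le hms)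
    ((hY x).of_le hms) ((hW x).of_le hms)
  rw [key hX hY, key hY hX, mlieBracket_smul_right (hf' x) (hW.mdifferentiableAt x)] at J1
  rw [J2] at J1
  have : (mvfderiv I f x (VectorField.mlieBracket I X Y x)
      - (mvfderiv I (fun y => mvfderiv I f y (Y y)) x (X x)
        - mvfderiv I (fun y => mvfderiv I f y (X y)) x (Y x))) • W x = 0 := by
    rw [← sub_eq_zero] at J1
    rw [← neg_eq_zero, ← J1]
    module
  rcases smul_eq_zero.1 this with h | h
  · linarith
  · exact absurd h hx

section FiniteDimensional

variable [FiniteDimensional ℝ E] [T2Space M]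

/-- A vector field that is smooth near a point agrees near the point with a globally smooth one. -/
theorem exists_isSmoothField_eventuallyEq {X : ∀ x : M, TangentSpace I x} {x : M} {u : Set M}
    (hu : u ∈ 𝓝 x)
    (hX : ContMDiffOn I I.tangent ∞ (fun y => (⟨y, X y⟩ : TangentBundle I M)) u) :
    ∃ Y : ∀ x : M, TangentSpace I x, IsSmoothField I Y ∧ Y =ᶠ[𝓝 x] X := by
  obtain ⟨χ, -, hχ⟩ := (SmoothBumpFunction.nhds_basis_tsupport (I := I) x).mem_iff.1
    (interior_mem_nhds.2 hu)
  refine ⟨(χ : M → ℝ) • X, ?_, ?_⟩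
  · exact ContMDiffOn.smul_section_of_tsupport (u := interior u) χ.contMDiff.contMDiffOn
      isOpen_interior hχ (hX.mono interior_subset)
  · filter_upwards [χ.eventuallyEq_one] with y hy
    rw [Pi.smul_apply', hy]
    exact one_smul ℝ (X y)

theorem exists_isSmoothField_apply_eq {x : M} (v : TangentSpace I x) :
    ∃ X : ∀ x : M, TangentSpace I x, IsSmoothField I X ∧ X x = v := by
  obtain ⟨u, hu, hX⟩ : ∃ u ∈ 𝓝 x, ContMDiffOn I I.tangent ∞
      (fun y => (⟨y, extend E v y⟩ : TangentBundle I M)) u :=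
    exists_contMDiffOn_extend I E v
  obtain ⟨Y, hY, h⟩ := exists_isSmoothField_eventuallyEq hu hX
  exact ⟨Y, hY, h.self_of_nhds.trans (extend_apply_self ..)⟩

/-- A smooth function near a point agrees near the point with a globally smooth one. -/
theorem exists_contMDiff_eventuallyEq {f : M → ℝ} {x : M} {u : Set M} (hu : u ∈ 𝓝 x)
    (hf : ContMDiffOn I 𝓘(ℝ, ℝ) ∞ f u) :
    ∃ g : M → ℝ, ContMDiff I 𝓘(ℝ, ℝ) ∞ g ∧ g =ᶠ[𝓝 x] f := by
  obtain ⟨χ, -, hχ⟩ := (SmoothBumpFunction.nhds_basis_tsupport (I := I) x).mem_iff.1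
    (interior_mem_nhds.2 hu)
  refine ⟨fun y => χ y * f y, ?_, ?_⟩
  · refine contMDiff_of_tsupport fun y hy => ?_
    have hy' : y ∈ interior u := hχ (tsupport_mul_subset_left hy)
    exact χ.contMDiffAt.mul (hf.contMDiffAt (mem_interior_iff_mem_nhds.1 hy'))
  · filter_upwards [χ.eventuallyEq_one] with y hy
    simp [hy]

end FiniteDimensional

end Calculus

end CRGeometry

end


noncomputable section

namespace CRGeometry

section ExteriorDerivative

variable {E : Type*} [NormedAddCommGroup E] [NormedSpace ℝ E] [FiniteDimensional ℝ E]
  {H : Type*} [TopologicalSpace H] {I : ModelWithCorners ℝ E H}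
  {M : Type*} [TopologicalSpace M] [ChartedSpace H M] [IsManifold I ∞ M]

/-- The exterior derivative of a smooth 1-form as a continuous bilinear map. -/
def exteriorDHom {θ : ∀ x : M, TangentSpace I x →L[ℝ] ℝ} (hθ : IsSmoothOneForm I θ) (x : M) :
    TangentSpace I x →L[ℝ] TangentSpace I x →L[ℝ] ℝ :=
  have : CompleteSpace E := FiniteDimensional.complete ℝ E
  TensorialAt.mkHom₂ (fun X Y => exteriorDOnFields I θ X Y x) x
    (fun Y hY => exteriorDOnFields_tensorial_left hθ Y x hY)
    (fun X hX => exteriorDOnFields_tensorial_right hθ X x hX)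

theorem exteriorDHom_apply {θ : ∀ x : M, TangentSpace I x →L[ℝ] ℝ} (hθ : IsSmoothOneForm I θ)
    (x : M) (v w : TangentSpace I x) : exteriorDHom hθ x v w = exteriorD I θ x v w := rfl

omit [FiniteDimensional ℝ E] in
theorem exteriorD_swap (θ : ∀ x : M, TangentSpace I x →L[ℝ] ℝ)
    (x : M) (v w : TangentSpace I x) : exteriorD I θ x v w = - exteriorD I θ x w v :=
  exteriorDOnFields_swap θ _ _ x

theorem IsSmoothOneForm.contMDiff_exteriorD {θ : ∀ x : M, TangentSpace I x →L[ℝ] ℝ}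
    (hθ : IsSmoothOneForm I θ) {X Y : ∀ x : M, TangentSpace I x} (hX : IsSmoothField I X)
    (hY : IsSmoothField I Y) :
    ContMDiff I 𝓘(ℝ, ℝ) ∞ (fun x => exteriorD I θ x (X x) (Y x)) := by
  have : CompleteSpace E := FiniteDimensional.complete ℝ E
  have e : (fun x => exteriorD I θ x (X x) (Y x)) = fun x => exteriorDOnFields I θ X Y x := by
    ext x
    exact exteriorD_apply_fields hθ (hX.mdifferentiableAt x) (hY.mdifferentiableAt x)
  rw [e]
  exact ((contMDiff_mvfderiv_apply (hθ.contMDiff_apply hY) hX).sub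
    (contMDiff_mvfderiv_apply (hθ.contMDiff_apply hX) hY)).sub
    (hθ.contMDiff_apply (hX.mlieBracket hY))

end ExteriorDerivative

section CR

variable {n : ℕ} {M : Type*} [TopologicalSpace M]
  [ChartedSpace (EuclideanSpace ℝ (Fin (2 * n + 1))) M] [IsManifold (𝓡 (2 * n + 1)) ∞ M]

namespace AlmostCRStructure.HorizontalField

variable {S : AlmostCRStructure n M}

theorem field_apply (X : S.HorizontalField) (x : M) : X.field x = X.val x := rfl

theorem field_mem (X : S.HorizontalField) (x : M) : X.field x ∈ S.H x := (X.val x).2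

theorem smooth_field (X : S.HorizontalField) : IsSmoothField (𝓡 (2 * n + 1)) X.field := X.smooth

theorem J_val (X : S.HorizontalField) (x : M) : X.J.val x = S.J x (X.val x) := rfl

@[ext] theorem ext {X Y : S.HorizontalField} (h : ∀ x, X.val x = Y.val x) : X = Y := by
  cases X; cases Y; congr; exact funext h

/-- A smooth vector field with values in `H` as a horizontal field. -/
def ofField (X : ∀ x : M, TangentSpace (𝓡 (2 * n + 1)) x) (hX : IsSmoothField (𝓡 (2 * n + 1)) X)
    (h : ∀ x, X x ∈ S.H x) : S.HorizontalField :=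
  ⟨fun x => ⟨X x, h x⟩, hX⟩

instance : Add S.HorizontalField := ⟨fun X Y => ⟨fun x => X.val x + Y.val x, X.smooth.add Y.smooth⟩⟩

instance : Sub S.HorizontalField := ⟨fun X Y => ⟨fun x => X.val x - Y.val x, X.smooth.sub Y.smooth⟩⟩

theorem add_val (X Y : S.HorizontalField) (x : M) : (X + Y).val x = X.val x + Y.val x := rfl

theorem sub_val (X Y : S.HorizontalField) (x : M) : (X - Y).val x = X.val x - Y.val x := rfl

/-- The product of a smooth function and a horizontal field. -/
def smul (f : M → ℝ) (hf : ContMDiff (𝓡 (2 * n + 1)) 𝓘(ℝ, ℝ) ∞ f) (X : S.HorizontalField) :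
    S.HorizontalField :=
  ⟨fun x => f x • X.val x, X.smooth.smul hf⟩

theorem smul_val (f : M → ℝ) (hf : ContMDiff (𝓡 (2 * n + 1)) 𝓘(ℝ, ℝ) ∞ f)
    (X : S.HorizontalField) (x : M) : (X.smul f hf).val x = f x • X.val x := rfl

theorem exists_val_eq (x : M) (v : S.H x) : ∃ X : S.HorizontalField, X.val x = v := by
  obtain ⟨X, hX, h⟩ := S.exists_smooth_section x v
  exact ⟨⟨X, hX⟩, h⟩

theorem J_J (X : S.HorizontalField) (x : M) : X.J.J.val x = -X.val x := S.J_J x _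

end AlmostCRStructure.HorizontalField

namespace CRStructure

open AlmostCRStructure

variable {S : CRStructure n M} {θ : OneForm (𝓡 (2 * n + 1)) (M := M)}

namespace IsPseudohermitian

variable (hθ : S.IsPseudohermitian θ)
include hθ

theorem apply_field (X : S.HorizontalField) (x : M) : θ x (X.field x) = 0 :=
  (hθ.ker_eq x _).2 (X.field_mem x)

theorem exteriorD_field (X Y : S.HorizontalField) (x : M) :
    exteriorD (𝓡 (2 * n + 1)) θ x (X.val x) (Y.val x) =
      -θ x (mlieBracket (𝓡 (2 * n + 1)) X.field Y.field x) := by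
  rw [← X.field_apply, ← Y.field_apply, exteriorD_apply_fields hθ.smooth
    (X.smooth_field.mdifferentiableAt x) (Y.smooth_field.mdifferentiableAt x), exteriorDOnFields]
  have h1 : (fun y => θ y (Y.field y)) = fun _ => 0 := funext (hθ.apply_field Y)
  have h2 : (fun y => θ y (X.field y)) = fun _ => 0 := funext (hθ.apply_field X)
  simp [h1, h2, mvfderiv_const]

theorem exteriorD_J_J (x : M) (v w : S.H x) :
    exteriorD (𝓡 (2 * n + 1)) θ x (S.J x v) (S.J x w) = exteriorD (𝓡 (2 * n + 1)) θ x v w := by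
  obtain ⟨X, rfl⟩ := HorizontalField.exists_val_eq x v
  obtain ⟨Y, rfl⟩ := HorizontalField.exists_val_eq x w
  obtain ⟨h, -⟩ := S.integrable X Y x
  rw [← X.J_val, ← Y.J_val, hθ.exteriorD_field, hθ.exteriorD_field]
  have := (hθ.ker_eq x _).2 h
  rw [map_sub] at this
  linarith

/-- The Levi form as a bilinear form. -/
def levi (x : M) : LinearMap.BilinForm ℝ (S.H x) :=
  LinearMap.mk₂ ℝ (S.leviForm θ x)
    (fun v v' w => by
      simp only [leviForm, ← exteriorDHom_apply hθ.smooth, Submodule.coe_add, map_add]; rfl)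
    (fun c v w => by
      simp only [leviForm, ← exteriorDHom_apply hθ.smooth, Submodule.coe_smul, map_smul]; rfl)
    (fun v w w' => by
      simp only [leviForm, ← exteriorDHom_apply hθ.smooth, Submodule.coe_add, map_add])
    (fun c v w => by
      simp only [leviForm, ← exteriorDHom_apply hθ.smooth, Submodule.coe_smul, map_smul])

theorem levi_apply (x : M) (v w : S.H x) : hθ.levi x v w = S.leviForm θ x v w := rfl

theorem levi_comm (x : M) (v w : S.H x) : hθ.levi x v w = hθ.levi x w v := by
  have h : ((S.J x (S.J x w) : S.H x) : TangentSpace (𝓡 (2 * n + 1)) x) = -w := by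
    rw [S.J_J]; rfl
  rw [levi_apply, levi_apply, leviForm, leviForm, ← hθ.exteriorD_J_J, h,
    exteriorD_swap θ x w, ← exteriorDHom_apply hθ.smooth, ← exteriorDHom_apply hθ.smooth, map_neg]

theorem levi_J_J (x : M) (v w : S.H x) : hθ.levi x (S.J x v) (S.J x w) = hθ.levi x v w :=
  hθ.exteriorD_J_J x v (S.J x w)

theorem exteriorD_eq_levi (x : M) (v w : S.H x) :
    exteriorD (𝓡 (2 * n + 1)) θ x v w = hθ.levi x (S.J x v) w :=
  (hθ.exteriorD_J_J x v w).symm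

theorem levi_self_pos (x : M) {v : S.H x} (hv : v ≠ 0) : 0 < hθ.levi x v v := hθ.levi_pos x v hv

theorem levi_eq_zero {x : M} {v : S.H x} (h : ∀ w, hθ.levi x v w = 0) : v = 0 := by
  by_contra hv
  exact (hθ.levi_self_pos x hv).ne' (h v)

theorem contMDiff_levi (X Y : S.HorizontalField) :
    ContMDiff (𝓡 (2 * n + 1)) 𝓘(ℝ, ℝ) ∞ (fun x => hθ.levi x (X.val x) (Y.val x)) :=
  hθ.smooth.contMDiff_exteriorD X.smooth_field Y.J.smooth_field

end IsPseudohermitian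

end CRStructure

end CR

end CRGeometry

end


noncomputable section

namespace CRGeometry

section UnitaryFrames

variable {V : Type*} [AddCommGroup V] [Module ℝ V]

/-- `B` is an inner product for which the complex structure `J` is orthogonal. -/
structure IsHermitianForm (B : LinearMap.BilinForm ℝ V) (J : V →ₗ[ℝ] V) : Prop where
  comm : ∀ v w, B v w = B w v
  pos : ∀ v, v ≠ 0 → 0 < B v v
  J_J : ∀ v, J (J v) = -v
  apply_J_J : ∀ v w, B (J v) (J w) = B v w

/-- `e₁, Je₁, …, eₖ, Jeₖ` are orthonormal. -/
def IsUnitaryFamily (B : LinearMap.BilinForm ℝ V) (J : V →ₗ[ℝ] V) {k : ℕ} (e : Fin k → V) : Prop :=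
  ∀ a b, B (e a) (e b) = (if a = b then 1 else 0) ∧ B (e a) (J (e b)) = 0

namespace IsHermitianForm

variable {B : LinearMap.BilinForm ℝ V} {J : V →ₗ[ℝ] V} (h : IsHermitianForm B J)
include h

theorem apply_J_left (v w : V) : B (J v) w = -B v (J w) := by
  rw [← h.apply_J_J v, h.J_J, map_neg, neg_neg]

theorem apply_J_self (v : V) : B v (J v) = 0 := by
  have h1 := h.apply_J_left v v
  rw [h.comm] at h1
  linarith

theorem exists_orthogonal [FiniteDimensional ℝ V] {k : ℕ} (e : Fin k → V)
    (hk : 2 * k < Module.finrank ℝ V) :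
    ∃ v, v ≠ 0 ∧ ∀ a, B (e a) v = 0 ∧ B (J (e a)) v = 0 := by
  let L : V →ₗ[ℝ] (Fin k ⊕ Fin k → ℝ) :=
    LinearMap.pi (Sum.elim (fun a => B (e a)) (fun a => B (J (e a))))
  have hL : LinearMap.ker L ≠ ⊥ := by
    apply LinearMap.ker_ne_bot_of_finrank_lt
    simpa [two_mul] using hk
  obtain ⟨v, hv, hv0⟩ := Submodule.exists_mem_ne_zero_of_ne_bot hL
  refine ⟨v, hv0, fun a => ⟨?_, ?_⟩⟩
  · exact congrFun (LinearMap.mem_ker.1 hv) (Sum.inl a)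
  · exact congrFun (LinearMap.mem_ker.1 hv) (Sum.inr a)

theorem exists_isUnitaryFamily [FiniteDimensional ℝ V] (k : ℕ)
    (hk : 2 * k ≤ Module.finrank ℝ V) : ∃ e : Fin k → V, IsUnitaryFamily B J e := by
  induction k with
  | zero => exact ⟨Fin.elim0, fun a => a.elim0⟩
  | succ k ih =>
    obtain ⟨e, he⟩ := ih (by omega)
    obtain ⟨v, hv, hve⟩ := h.exists_orthogonal e (by omega)
    have hpos := h.pos v hv
    have hsq : Real.sqrt (B v v) * Real.sqrt (B v v) = B v v := Real.mul_self_sqrt hpos.le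
    have hs : Real.sqrt (B v v) ≠ 0 := (Real.sqrt_pos.2 hpos).ne'
    refine ⟨Fin.snoc e ((Real.sqrt (B v v))⁻¹ • v), fun a b => ?_⟩
    refine Fin.lastCases ?_ (fun a => ?_) a <;> refine Fin.lastCases ?_ (fun b => ?_) b
    · simp only [Fin.snoc_last, map_smul, LinearMap.smul_apply, smul_eq_mul, h.apply_J_self,
        if_true, mul_zero, and_true]
      rw [inv_mul_eq_div, inv_mul_eq_div, div_div, hsq, div_self hpos.ne']
    · have h1 := (hve b).1
      have h2 := (hve b).2
      rw [h.comm] at h1 h2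
      simp [Fin.snoc_last, h1, h2, (Fin.castSucc_lt_last b).ne']
    · have h1 := (hve a).1
      have h2 := (hve a).2
      rw [h.apply_J_left, neg_eq_zero] at h2
      simp [Fin.snoc_last, h1, h2, (Fin.castSucc_lt_last a).ne]
    · simpa [Fin.snoc_castSucc] using he a b

section Frame

variable [FiniteDimensional ℝ V] {n : ℕ} (hn : Module.finrank ℝ V = 2 * n) {e : Fin n → V} (he : IsUnitaryFamily B J e)

omit [FiniteDimensional ℝ V] in
include he in
theorem sum_elim_orthonormal (i j : Fin n ⊕ Fin n) :
    B (Sum.elim e (fun a => J (e a)) i) (Sum.elim e (fun a => J (e a)) j) =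
      if i = j then 1 else 0 := by
  rcases i with i | i <;> rcases j with j | j
  · simp [(he i j).1]
  · simp [(he i j).2]
  · simp [h.apply_J_left, (he i j).2]
  · simp [h.apply_J_J, (he i j).1]

include he in
theorem linearIndependent_sum_elim : LinearIndependent ℝ (Sum.elim e (fun a => J (e a))) := by
  rw [Fintype.linearIndependent_iff]
  intro g hg i
  have := congrArg (B (Sum.elim e (fun a => J (e a)) i)) hg
  rw [map_sum, map_zero] at this
  simpa [-Fintype.sum_sum_type, h.sum_elim_orthonormal he] using this

/-- The basis `e₁, …, eₙ, Je₁, …, Jeₙ`. -/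
def unitaryBasis :
    Module.Basis (Fin n ⊕ Fin n) ℝ V :=
  Module.Basis.mk (h.linearIndependent_sum_elim he)
    (LinearIndependent.span_eq_top_of_card_eq_finrank' (h.linearIndependent_sum_elim he)
      (by simp [hn, two_mul])).ge

theorem unitaryBasis_apply (i : Fin n ⊕ Fin n) :
    h.unitaryBasis hn he i = Sum.elim e (fun a => J (e a)) i := by
  simp [unitaryBasis]

theorem unitaryBasis_repr (v : V) (i : Fin n ⊕ Fin n) :
    (h.unitaryBasis hn he).repr v i = B v (Sum.elim e (fun a => J (e a)) i) := by
  conv_rhs => rw [← (h.unitaryBasis hn he).sum_repr v]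
  rw [map_sum, LinearMap.sum_apply]
  simp [-Fintype.sum_sum_type, unitaryBasis_apply, h.sum_elim_orthonormal he]

include hn he in
theorem sum_apply_smul (v : V) :
    ∑ a, (B v (e a) • e a + B v (J (e a)) • J (e a)) = v := by
  conv_rhs => rw [← (h.unitaryBasis hn he).sum_repr v]
  simp [unitaryBasis_apply, unitaryBasis_repr, Finset.sum_add_distrib]

include hn he in
theorem sum_apply_mul_apply (v w : V) :
    ∑ a, (B v (e a) * B w (e a) + B v (J (e a)) * B w (J (e a))) = B v w := by
  conv_rhs => rw [← h.sum_apply_smul hn he v]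
  simp [h.comm w]

include hn he in
theorem trace_eq_sum (L : V →ₗ[ℝ] V) :
    LinearMap.trace ℝ V L = ∑ a, (B (L (e a)) (e a) + B (L (J (e a))) (J (e a))) := by
  rw [LinearMap.trace_eq_matrix_trace ℝ (h.unitaryBasis hn he), Matrix.trace]
  simp [LinearMap.toMatrix_apply, unitaryBasis_apply, unitaryBasis_repr, Finset.sum_add_distrib]

include hn he in
theorem sum_apply_J_eq_trace (L : V →ₗ[ℝ] V) (hL : ∀ v, L (J v) = J (L v)) :
    ∑ a, B (L (J (e a))) (e a) = 2⁻¹ * LinearMap.trace ℝ V (L ∘ₗ J) := by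
  rw [h.trace_eq_sum hn he, Finset.mul_sum]
  refine Finset.sum_congr rfl fun a _ => ?_
  simp only [LinearMap.comp_apply, h.J_J, map_neg, LinearMap.neg_apply]
  rw [← h.apply_J_J (L (J (e a))) (e a), ← hL, h.J_J, map_neg, map_neg, LinearMap.neg_apply]
  ring

include hn he in
/-- The trace of a bilinear form does not depend on the unitary frame. -/
theorem sum_bilin_eq {e' : Fin n → V} (he' : IsUnitaryFamily B J e') (β : LinearMap.BilinForm ℝ V) :
    ∑ a, (β (e a) (e a) + β (J (e a)) (J (e a))) =
      ∑ a, (β (e' a) (e' a) + β (J (e' a)) (J (e' a))) := by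
  let A : V →ₗ[ℝ] V := ∑ c, ((β.flip (e c)).smulRight (e c) + (β.flip (J (e c))).smulRight (J (e c)))
  have hA : ∀ v w, B (A v) w = β v w := by
    intro v w
    conv_rhs => rw [← h.sum_apply_smul hn he w]
    simp [A, h.comm w, mul_comm]
  have h1 := h.trace_eq_sum hn he A
  have h2 := h.trace_eq_sum hn he' A
  simp only [hA] at h1 h2
  rw [← h1, h2]

end Frame

end IsHermitianForm

end UnitaryFrames

end CRGeometry

end


noncomputable section

namespace CRGeometry

section Calculus

variable {E : Type*} [NormedAddCommGroup E] [NormedSpace ℝ E]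
  {H : Type*} [TopologicalSpace H] {I : ModelWithCorners ℝ E H}
  {M : Type*} [TopologicalSpace M] [ChartedSpace H M] [IsManifold I ∞ M]

omit [IsManifold I ∞ M] in
theorem mvfderiv_congr {f g : M → ℝ} {x : M} (h : f =ᶠ[𝓝 x] g) : mvfderiv I f x = mvfderiv I g x := by
  ext v
  simp only [mvfderiv, h.mfderiv_eq]
  rfl

/-- There is a smooth function with prescribed differential at a point. -/
theorem exists_contMDiff_mvfderiv_eq [FiniteDimensional ℝ E] [T2Space M] {x : M}
    (l : TangentSpace I x →L[ℝ] ℝ) :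
    ∃ f : M → ℝ, ContMDiff I 𝓘(ℝ, ℝ) ∞ f ∧ f x = 0 ∧ mvfderiv I f x = l := by
  have : CompleteSpace E := FiniteDimensional.complete ℝ E
  have hinv := isInvertible_mfderiv_extChartAt (I := I) (mem_extChartAt_source (I := I) x)
  let l' : E →L[ℝ] ℝ := l.comp (mfderiv I 𝓘(ℝ, E) (extChartAt I x) x).inverse
  let f : M → ℝ := fun y => l' (extChartAt I x y - extChartAt I x x)
  have hf : ContMDiffOn I 𝓘(ℝ, ℝ) ∞ f (chartAt H x).source := by
    have h1 : ContMDiffOn I 𝓘(ℝ, E) ∞ (extChartAt I x) (chartAt H x).source :=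
      contMDiffOn_extChartAt
    have h2 : ContDiff ℝ ∞ (fun y => l' (y - extChartAt I x x)) := by fun_prop
    exact h2.contMDiff.comp_contMDiffOn h1
  obtain ⟨g, hg, hgf⟩ := exists_contMDiff_eventuallyEq (chart_source_mem_nhds H x) hf
  refine ⟨g, hg, ?_, ?_⟩
  · rw [hgf.self_of_nhds]
    simp [f]
  · rw [mvfderiv_congr hgf]
    have h2 : HasFDerivAt (fun y => l' (y - extChartAt I x x)) l' (extChartAt I x x) :=
      l'.hasFDerivAt.comp _ ((hasFDerivAt_id _).sub_const _)
    have h3 : HasMFDerivAt I 𝓘(ℝ, ℝ) f x (l'.comp (mfderiv I 𝓘(ℝ, E) (extChartAt I x) x)) :=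
      h2.hasMFDerivAt.comp x ((contMDiffAt_extChartAt (n := 1)).mdifferentiableAt
        (by simp)).hasMFDerivAt
    ext v
    rw [mvfderiv, h3.mfderiv]
    have h4 : (mfderiv I 𝓘(ℝ, E) (extChartAt I x) x).inverse
        (mfderiv I 𝓘(ℝ, E) (extChartAt I x) x v) = v :=
      congrArg (fun L => L v) hinv.inverse_comp_self
    exact congrArg l h4

end Calculus

section CR

variable {n : ℕ} {M : Type*} [TopologicalSpace M]
  [ChartedSpace (EuclideanSpace ℝ (Fin (2 * n + 1))) M] [IsManifold (𝓡 (2 * n + 1)) ∞ M]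

namespace CRStructure

open AlmostCRStructure

variable {S : CRStructure n M} {θ : OneForm (𝓡 (2 * n + 1)) (M := M)}

instance finiteDimensional_tangentSpace (x : M) :
    FiniteDimensional ℝ (TangentSpace (𝓡 (2 * n + 1)) x) :=
  inferInstanceAs (FiniteDimensional ℝ (EuclideanSpace ℝ (Fin (2 * n + 1))))

instance t2Space_tangentSpace (x : M) : T2Space (TangentSpace (𝓡 (2 * n + 1)) x) :=
  inferInstanceAs (T2Space (EuclideanSpace ℝ (Fin (2 * n + 1))))

theorem IsPseudohermitian.isHermitianForm (hθ : S.IsPseudohermitian θ) (x : M) :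
    IsHermitianForm (hθ.levi x) (S.J x) where
  comm := hθ.levi_comm x
  pos _ := hθ.levi_self_pos x
  J_J := S.J_J x
  apply_J_J := hθ.levi_J_J x

theorem IsPseudohermitian.isUnitaryAt_iff (hθ : S.IsPseudohermitian θ) (x : M)
    (e : Fin n → S.HorizontalField) :
    S.IsUnitaryAt θ x e ↔ IsUnitaryFamily (hθ.levi x) (S.J x) (fun a => (e a).val x) := Iff.rfl

namespace IsTanakaWebster

variable {T : ∀ x : M, TangentSpace (𝓡 (2 * n + 1)) x}
  {D : CovariantDerivative (𝓡 (2 * n + 1)) (EuclideanSpace ℝ (Fin (2 * n + 1)))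
      (TangentSpace (𝓡 (2 * n + 1)) : M → Type _)}
  (hD : S.IsTanakaWebster θ T D)

section Connection

include hD

theorem isSmoothField {X Y : ∀ x : M, TangentSpace (𝓡 (2 * n + 1)) x}
    (hX : IsSmoothField (𝓡 (2 * n + 1)) X) (hY : IsSmoothField (𝓡 (2 * n + 1)) Y) :
    IsSmoothField (𝓡 (2 * n + 1)) (fun y => D X y (Y y)) := by
  have h1 := hD.smooth.contMDiff (σ := X) (by simpa using hX.contMDiffOn)
  exact (contMDiffOn_univ.1 h1).clm_bundle_apply hY

theorem mdifferentiableAt {X Y : ∀ x : M, TangentSpace (𝓡 (2 * n + 1)) x} {x : M}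
    (hX : IsSmoothField (𝓡 (2 * n + 1)) X) (hY : MDifferentiableAt (𝓡 (2 * n + 1))
      (𝓡 (2 * n + 1)).tangent (fun y => (⟨y, Y y⟩ : TangentBundle (𝓡 (2 * n + 1)) M)) x) :
    MDifferentiableAt (𝓡 (2 * n + 1)) (𝓡 (2 * n + 1)).tangent
      (fun y => (⟨y, D X y (Y y)⟩ : TangentBundle (𝓡 (2 * n + 1)) M)) x := by
  have h1 := hD.smooth.contMDiff (σ := X) (by simpa using hX.contMDiffOn)
  exact ((contMDiffOn_univ.1 h1 x).mdifferentiableAt (by simp)).clm_bundle_apply hY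

end Connection

/-- The covariant derivative of a horizontal field as a linear map into `H`. -/
def nabla (Z : S.HorizontalField) (x : M) : TangentSpace (𝓡 (2 * n + 1)) x →ₗ[ℝ] S.H x :=
  (D Z.field x).toLinearMap.codRestrict (S.H x) (hD.horizontal Z x)

/-- The covariant derivative of a horizontal field in the direction of a vector field. -/
def covDeriv (Y : ∀ x : M, TangentSpace (𝓡 (2 * n + 1)) x)
    (hY : IsSmoothField (𝓡 (2 * n + 1)) Y) (Z : S.HorizontalField) : S.HorizontalField :=
  ⟨fun x => hD.nabla Z x (Y x), hD.isSmoothField Z.smooth_field hY⟩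

theorem coe_nabla (Z : S.HorizontalField) (x : M) (v : TangentSpace (𝓡 (2 * n + 1)) x) :
    (hD.nabla Z x v : TangentSpace (𝓡 (2 * n + 1)) x) = D Z.field x v := rfl

theorem covDeriv_val (Y : ∀ x : M, TangentSpace (𝓡 (2 * n + 1)) x)
    (hY : IsSmoothField (𝓡 (2 * n + 1)) Y) (Z : S.HorizontalField) (x : M) :
    (hD.covDeriv Y hY Z).val x = hD.nabla Z x (Y x) := rfl

theorem nabla_add (Z Z' : S.HorizontalField) (x : M) :
    hD.nabla (Z + Z') x = hD.nabla Z x + hD.nabla Z' x := by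
  ext v
  have := D.isCovariantDerivativeOn.add (Z.smooth_field.mdifferentiableAt x)
    (Z'.smooth_field.mdifferentiableAt x) (mem_univ x)
  exact congrArg (fun L => L v) this

theorem nabla_smul (f : M → ℝ) (hf : ContMDiff (𝓡 (2 * n + 1)) 𝓘(ℝ, ℝ) ∞ f)
    (Z : S.HorizontalField) (x : M) (v : TangentSpace (𝓡 (2 * n + 1)) x) :
    hD.nabla (Z.smul f hf) x v =
      f x • hD.nabla Z x v + mvfderiv (𝓡 (2 * n + 1)) f x v • Z.val x := by
  apply Subtype.ext
  have := D.isCovariantDerivativeOn.leibniz (Z.smooth_field.mdifferentiableAt x)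
    (hf.mdifferentiable (by simp) x) (mem_univ x)
  exact congrArg (fun L => L v) this

theorem nabla_J (Z : S.HorizontalField) (x : M) (v : TangentSpace (𝓡 (2 * n + 1)) x) :
    hD.nabla Z.J x v = S.J x (hD.nabla Z x v) :=
  Subtype.ext (hD.parallel_J Z x v)

theorem nabla_sub (Z Z' : S.HorizontalField) (x : M) :
    hD.nabla (Z - Z') x = hD.nabla Z x - hD.nabla Z' x := by
  rw [eq_sub_iff_add_eq, ← nabla_add]
  congr 1
  ext y
  simp [HorizontalField.sub_val, HorizontalField.add_val]

theorem mvfderiv_levi (hθ : S.IsPseudohermitian θ) (Y Z : S.HorizontalField) (x : M)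
    (v : TangentSpace (𝓡 (2 * n + 1)) x) :
    mvfderiv (𝓡 (2 * n + 1)) (fun y => hθ.levi y (Y.val y) (Z.val y)) x v =
      hθ.levi x (hD.nabla Y x v) (Z.val x) + hθ.levi x (Y.val x) (hD.nabla Z x v) :=
  hD.parallel_levi Y Z x v

theorem nabla_sub_nabla (Y Z : S.HorizontalField) (x : M) :
    (hD.nabla Z x (Y.field x) - hD.nabla Y x (Z.field x) : TangentSpace (𝓡 (2 * n + 1)) x) =
      mlieBracket (𝓡 (2 * n + 1)) Y.field Z.field x
        + exteriorD (𝓡 (2 * n + 1)) θ x (Y.val x) (Z.val x) • T x := by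
  have h := hD.torsion_horizontal x (Y.val x) (Z.val x)
  rw [← Y.field_apply, ← Z.field_apply, D.torsion_apply (Y.smooth_field.mdifferentiableAt x)
    (Z.smooth_field.mdifferentiableAt x)] at h
  rw [coe_nabla, coe_nabla, ← Y.field_apply, ← Z.field_apply, ← h]
  abel

/-- Every horizontal vector extends to a horizontal field that is parallel at the point. -/
theorem exists_nabla_eq_zero [T2Space M] (x : M) (v : S.H x) :
    ∃ X : S.HorizontalField, X.val x = v ∧ hD.nabla X x = 0 := by
  obtain ⟨X, hX⟩ := HorizontalField.exists_val_eq x v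
  let b := Module.finBasis ℝ (S.H x)
  choose h hh using fun i => HorizontalField.exists_val_eq x (b i)
  have hl : ∀ i, ∃ f : M → ℝ, ContMDiff (𝓡 (2 * n + 1)) 𝓘(ℝ, ℝ) ∞ f ∧ f x = 0 ∧
      mvfderiv (𝓡 (2 * n + 1)) f x =
        LinearMap.toContinuousLinearMap ((b.coord i) ∘ₗ hD.nabla X x) := fun i =>
    exists_contMDiff_mvfderiv_eq _
  choose f hf hf0 hf1 using hl
  have key : ∀ s : Finset (Fin (Module.finrank ℝ (S.H x))), ∃ Y : S.HorizontalField,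
      Y.val x = v ∧ ∀ w, hD.nabla Y x w = hD.nabla X x w - ∑ i ∈ s, b.repr (hD.nabla X x w) i • b i := by
    classical
    intro s
    induction s using Finset.induction_on with
    | empty => exact ⟨X, hX, by simp⟩
    | insert i s hi ih =>
      obtain ⟨Y, hY, hY'⟩ := ih
      refine ⟨Y - (h i).smul (f i) (hf i), ?_, fun w => ?_⟩
      · simp [HorizontalField.sub_val, HorizontalField.smul_val, hf0, hY]
      · rw [nabla_sub, LinearMap.sub_apply, nabla_smul, hY', hf0, hf1, hh,
          Finset.sum_insert hi]
        simp
        abel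
  obtain ⟨Y, hY, hY'⟩ := key Finset.univ
  refine ⟨Y, hY, ?_⟩
  ext w
  rw [hY', b.sum_repr]
  simp

end IsTanakaWebster

end CRStructure

end CR

end CRGeometry

end


noncomputable section

namespace CRGeometry

section CR

variable {n : ℕ} {M : Type*} [TopologicalSpace M]
  [ChartedSpace (EuclideanSpace ℝ (Fin (2 * n + 1))) M] [IsManifold (𝓡 (2 * n + 1)) ∞ M]

namespace CRStructure

open AlmostCRStructure

variable {S : CRStructure n M} {θ : OneForm (𝓡 (2 * n + 1)) (M := M)}

namespace IsTanakaWebster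

variable {T : ∀ x : M, TangentSpace (𝓡 (2 * n + 1)) x}
  {D : CovariantDerivative (𝓡 (2 * n + 1)) (EuclideanSpace ℝ (Fin (2 * n + 1)))
      (TangentSpace (𝓡 (2 * n + 1)) : M → Type _)}

theorem curvature_swap (X Y Z : ∀ x : M, TangentSpace (𝓡 (2 * n + 1)) x) (x : M) :
    curvature D X Y Z x = -curvature D Y X Z x := by
  simp only [curvature]
  rw [mlieBracket_swap_apply, map_neg]
  abel

variable (hD : S.IsTanakaWebster θ T D)

include hD in
theorem curvature_tensorial_left {Z : ∀ x : M, TangentSpace (𝓡 (2 * n + 1)) x}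
    (hZ : IsSmoothField (𝓡 (2 * n + 1)) Z) (x : M)
    (Y : ∀ x : M, TangentSpace (𝓡 (2 * n + 1)) x) (_hY : MDifferentiableAt (𝓡 (2 * n + 1))
      (𝓡 (2 * n + 1)).tangent (fun y => (⟨y, Y y⟩ : TangentBundle (𝓡 (2 * n + 1)) M)) x) :
    TensorialAt (𝓡 (2 * n + 1)) (EuclideanSpace ℝ (Fin (2 * n + 1)))
      (fun X => curvature D X Y Z x) x where
  smul {f X} hf hX := by
    have e : (fun y => D Z y ((f • X) y)) = f • (fun y => D Z y (X y)) := by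
      ext1 y
      simp
    simp only [curvature]
    rw [e, mlieBracket_smul_left hf hX,
      D.isCovariantDerivativeOn.leibniz (hD.mdifferentiableAt hZ hX) hf (mem_univ x)]
    simp
    module
  add {X X'} hX hX' := by
    have e : (fun y => D Z y ((X + X') y)) = (fun y => D Z y (X y)) + (fun y => D Z y (X' y)) := by
      ext1 y
      simp
    simp only [curvature]
    rw [e, mlieBracket_add_left hX hX', D.isCovariantDerivativeOn.add (hD.mdifferentiableAt hZ hX)
      (hD.mdifferentiableAt hZ hX') (mem_univ x)]
    simp
    module

include hD in
theorem curvature_tensorial_right {Z : ∀ x : M, TangentSpace (𝓡 (2 * n + 1)) x}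
    (hZ : IsSmoothField (𝓡 (2 * n + 1)) Z) (x : M)
    (X : ∀ x : M, TangentSpace (𝓡 (2 * n + 1)) x) (hX : MDifferentiableAt (𝓡 (2 * n + 1))
      (𝓡 (2 * n + 1)).tangent (fun y => (⟨y, X y⟩ : TangentBundle (𝓡 (2 * n + 1)) M)) x) :
    TensorialAt (𝓡 (2 * n + 1)) (EuclideanSpace ℝ (Fin (2 * n + 1)))
      (fun Y => curvature D X Y Z x) x where
  smul hf hY := by
    simp only [curvature_swap X]
    rw [(hD.curvature_tensorial_left hZ x X hX).smul hf hY, smul_neg]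
  add hY hY' := by
    simp only [curvature_swap X]
    rw [(hD.curvature_tensorial_left hZ x X hX).add hY hY', neg_add]

/-- The curvature `R(u, v)Z` at `x` as a bilinear map in `u`, `v`. -/
def curvatureHom (Z : S.HorizontalField) (x : M) :
    TangentSpace (𝓡 (2 * n + 1)) x →L[ℝ] TangentSpace (𝓡 (2 * n + 1)) x →L[ℝ]
      TangentSpace (𝓡 (2 * n + 1)) x :=
  TensorialAt.mkHom₂ (fun X Y => curvature D X Y Z.field x) x
    (hD.curvature_tensorial_left Z.smooth_field x) (hD.curvature_tensorial_right Z.smooth_field x)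

theorem curvatureHom_apply (Z : S.HorizontalField) (x : M)
    {X Y : ∀ x : M, TangentSpace (𝓡 (2 * n + 1)) x}
    (hX : IsSmoothField (𝓡 (2 * n + 1)) X) (hY : IsSmoothField (𝓡 (2 * n + 1)) Y) :
    hD.curvatureHom Z x (X x) (Y x) = curvature D X Y Z.field x :=
  TensorialAt.mkHom₂_apply _ _ (hX.mdifferentiableAt x) (hY.mdifferentiableAt x)

/-- The horizontal vector `R(X, Y)Z` at `x`. -/
def horizontalCurvature {X Y : ∀ x : M, TangentSpace (𝓡 (2 * n + 1)) x}
    (hX : IsSmoothField (𝓡 (2 * n + 1)) X) (hY : IsSmoothField (𝓡 (2 * n + 1)) Y)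
    (Z : S.HorizontalField) (x : M) : S.H x :=
  hD.nabla (hD.covDeriv Y hY Z) x (X x) - hD.nabla (hD.covDeriv X hX Z) x (Y x)
    - hD.nabla Z x (mlieBracket (𝓡 (2 * n + 1)) X Y x)

section Fields

variable {X Y : ∀ x : M, TangentSpace (𝓡 (2 * n + 1)) x}
    (hX : IsSmoothField (𝓡 (2 * n + 1)) X) (hY : IsSmoothField (𝓡 (2 * n + 1)) Y)

theorem coe_horizontalCurvature (Z : S.HorizontalField) (x : M) :
    (hD.horizontalCurvature hX hY Z x : TangentSpace (𝓡 (2 * n + 1)) x) =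
      curvature D X Y Z.field x := rfl

theorem covDeriv_add (Z Z' : S.HorizontalField) :
    hD.covDeriv X hX (Z + Z') = hD.covDeriv X hX Z + hD.covDeriv X hX Z' := by
  ext1 x
  rw [HorizontalField.add_val, covDeriv_val, covDeriv_val, covDeriv_val, nabla_add]
  rfl

theorem covDeriv_J (Z : S.HorizontalField) : hD.covDeriv X hX Z.J = (hD.covDeriv X hX Z).J := by
  ext1 x
  rw [HorizontalField.J_val, covDeriv_val, covDeriv_val, nabla_J]

theorem horizontalCurvature_add (Z Z' : S.HorizontalField) (x : M) :
    hD.horizontalCurvature hX hY (Z + Z') x =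
      hD.horizontalCurvature hX hY Z x + hD.horizontalCurvature hX hY Z' x := by
  simp only [horizontalCurvature, covDeriv_add, nabla_add, LinearMap.add_apply]
  abel

theorem horizontalCurvature_J (Z : S.HorizontalField) (x : M) :
    hD.horizontalCurvature hX hY Z.J x = S.J x (hD.horizontalCurvature hX hY Z x) := by
  simp only [horizontalCurvature, covDeriv_J, nabla_J, map_sub]

theorem horizontalCurvature_const_smul (c : ℝ) (Z : S.HorizontalField) (x : M) :
    hD.horizontalCurvature hX hY (Z.smul (fun _ => c) contMDiff_const) x =
      c • hD.horizontalCurvature hX hY Z x := by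
  have e : ∀ {W : ∀ x : M, TangentSpace (𝓡 (2 * n + 1)) x} (hW : IsSmoothField (𝓡 (2 * n + 1)) W),
      hD.covDeriv W hW (Z.smul (fun _ => c) contMDiff_const) =
        (hD.covDeriv W hW Z).smul (fun _ => c) contMDiff_const := by
    intro W hW
    ext1 y
    rw [covDeriv_val, nabla_smul, HorizontalField.smul_val, covDeriv_val]
    simp [mvfderiv_const]
  simp only [horizontalCurvature, e, nabla_smul]
  simp [mvfderiv_const, smul_sub]

theorem levi_horizontalCurvature [T2Space M] (hθ : S.IsPseudohermitian θ)
    (Z V : S.HorizontalField) (x : M) :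
    hθ.levi x (hD.horizontalCurvature hX hY Z x) (V.val x) =
      -hθ.levi x (Z.val x) (hD.horizontalCurvature hX hY V x) := by
  let f : M → ℝ := fun y => hθ.levi y (Z.val y) (V.val y)
  have hf : ContMDiff (𝓡 (2 * n + 1)) 𝓘(ℝ, ℝ) ∞ f := hθ.contMDiff_levi Z V
  have first : ∀ {A : ∀ x : M, TangentSpace (𝓡 (2 * n + 1)) x}
      (hA : IsSmoothField (𝓡 (2 * n + 1)) A), (fun y => mvfderiv (𝓡 (2 * n + 1)) f y (A y)) =
        (fun y => hθ.levi y ((hD.covDeriv A hA Z).val y) (V.val y)) +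
          fun y => hθ.levi y (Z.val y) ((hD.covDeriv A hA V).val y) := by
    intro A hA
    ext1 y
    exact hD.mvfderiv_levi hθ Z V y (A y)
  have second : ∀ {A B : ∀ x : M, TangentSpace (𝓡 (2 * n + 1)) x}
      (hA : IsSmoothField (𝓡 (2 * n + 1)) A) (hB : IsSmoothField (𝓡 (2 * n + 1)) B),
      mvfderiv (𝓡 (2 * n + 1)) (fun y => mvfderiv (𝓡 (2 * n + 1)) f y (A y)) x (B x) =
        hθ.levi x (hD.nabla (hD.covDeriv A hA Z) x (B x)) (V.val x)
        + hθ.levi x (hD.nabla Z x (A x)) (hD.nabla V x (B x))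
        + (hθ.levi x (hD.nabla Z x (B x)) (hD.nabla V x (A x))
        + hθ.levi x (Z.val x) (hD.nabla (hD.covDeriv A hA V) x (B x))) := by
    intro A B hA hB
    rw [first hA, mvfderiv_add ((hθ.contMDiff_levi _ _).mdifferentiable (by simp) x)
      ((hθ.contMDiff_levi _ _).mdifferentiable (by simp) x), add_apply,
      mvfderiv_levi, mvfderiv_levi]
    rfl
  have hne : ∃ W : ∀ x : M, TangentSpace (𝓡 (2 * n + 1)) x,
      IsSmoothField (𝓡 (2 * n + 1)) W ∧ W x ≠ 0 := by
    obtain ⟨w, hw⟩ := exists_ne (0 : EuclideanSpace ℝ (Fin (2 * n + 1)))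
    obtain ⟨W, hW, hWx⟩ := exists_isSmoothField_apply_eq (I := 𝓡 (2 * n + 1)) (x := x) w
    exact ⟨W, hW, by rw [hWx]; exact hw⟩
  obtain ⟨W, hW, hWx⟩ := hne
  have h1 := mvfderiv_mlieBracket hf hX hY hW hWx
  rw [second hY hX, second hX hY, hD.mvfderiv_levi hθ Z V] at h1
  simp only [horizontalCurvature, map_sub, LinearMap.sub_apply]
  linarith

theorem horizontalCurvature_eq_zero [T2Space M] (hθ : S.IsPseudohermitian θ)
    {Z : S.HorizontalField} {x : M} (hZ : Z.val x = 0) :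
    hD.horizontalCurvature hX hY Z x = 0 := by
  refine hθ.levi_eq_zero fun w => ?_
  obtain ⟨V, rfl⟩ := HorizontalField.exists_val_eq x w
  rw [levi_horizontalCurvature, hZ]
  simp

theorem horizontalCurvature_congr [T2Space M] (hθ : S.IsPseudohermitian θ)
    {Z Z' : S.HorizontalField} {x : M} (hZ : Z.val x = Z'.val x) :
    hD.horizontalCurvature hX hY Z x = hD.horizontalCurvature hX hY Z' x := by
  have h1 : Z = Z' + (Z - Z') := by
    ext1 y
    simp [HorizontalField.sub_val, HorizontalField.add_val]
  rw [h1, horizontalCurvature_add, hD.horizontalCurvature_eq_zero hX hY hθ (Z := Z - Z')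
    (by rw [HorizontalField.sub_val, hZ, sub_self]), add_zero]

/-- The curvature `R(X, Y)` at `x` as an endomorphism of `H`. -/
def curvatureEnd [T2Space M] (hθ : S.IsPseudohermitian θ) (x : M) : S.H x →ₗ[ℝ] S.H x where
  toFun w := hD.horizontalCurvature hX hY (HorizontalField.exists_val_eq x w).choose x
  map_add' v w := by
    rw [← horizontalCurvature_add]
    refine hD.horizontalCurvature_congr hX hY hθ ?_
    rw [HorizontalField.add_val, (HorizontalField.exists_val_eq x v).choose_spec,
      (HorizontalField.exists_val_eq x w).choose_spec,
      (HorizontalField.exists_val_eq x (v + w)).choose_spec]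
  map_smul' c w := by
    rw [RingHom.id_apply, ← horizontalCurvature_const_smul]
    refine hD.horizontalCurvature_congr hX hY hθ ?_
    rw [HorizontalField.smul_val, (HorizontalField.exists_val_eq x w).choose_spec,
      (HorizontalField.exists_val_eq x (c • w)).choose_spec]

theorem curvatureEnd_val [T2Space M] (hθ : S.IsPseudohermitian θ) (Z : S.HorizontalField) (x : M) :
    hD.curvatureEnd hX hY hθ x (Z.val x) = hD.horizontalCurvature hX hY Z x :=
  hD.horizontalCurvature_congr hX hY hθ (HorizontalField.exists_val_eq x (Z.val x)).choose_spec

theorem curvatureEnd_J [T2Space M] (hθ : S.IsPseudohermitian θ) (x : M) (w : S.H x) :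
    hD.curvatureEnd hX hY hθ x (S.J x w) = S.J x (hD.curvatureEnd hX hY hθ x w) := by
  obtain ⟨Z, rfl⟩ := HorizontalField.exists_val_eq x w
  rw [← Z.J_val, curvatureEnd_val, curvatureEnd_val, horizontalCurvature_J]

end Fields

/-- The Ricci form `(u, v) ↦ tr(R(u, v) ∘ J) / 2` of the connection on `H`, computed in a unitary
frame. -/
def ricciForm (e : Fin n → S.HorizontalField) (x : M) (hθ : S.IsPseudohermitian θ) :
    LinearMap.BilinForm ℝ (S.H x) :=
  LinearMap.mk₂ ℝ (M := S.H x) (Nₗ := S.H x) (Pₗ := ℝ) (fun u v : S.H x => ∑ b : Fin n, exteriorDHom hθ.smooth x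
      (hD.curvatureHom (e b).J x u (S.J x v)) ((e b).J.field x))
    (fun u u' v => by simp [Finset.sum_add_distrib])
    (fun c u v => by simp [Finset.mul_sum])
    (fun u v v' => by simp [Finset.sum_add_distrib])
    (fun c u v => by simp [Finset.mul_sum])

theorem ricciForm_apply (e : Fin n → S.HorizontalField) (x : M) (hθ : S.IsPseudohermitian θ)
    (X Y : S.HorizontalField) :
    hD.ricciForm e x hθ (X.val x) (Y.val x) = ∑ b, exteriorD (𝓡 (2 * n + 1)) θ x
      (curvature D X.field Y.J.field (e b).J.field x) ((e b).J.field x) := by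
  change (∑ b : Fin n, exteriorDHom hθ.smooth x
    (hD.curvatureHom (e b).J x (X.val x) (S.J x (Y.val x))) ((e b).J.field x)) = _
  refine Finset.sum_congr rfl fun b _ => ?_
  rw [← hD.curvatureHom_apply (e b).J x X.smooth_field Y.J.smooth_field]
  rfl

theorem ricciForm_eq_trace [T2Space M] {e : Fin n → S.HorizontalField} {x : M}
    (hθ : S.IsPseudohermitian θ) (he : S.IsUnitaryAt θ x e) (X Y : S.HorizontalField) :
    hD.ricciForm e x hθ (X.val x) (Y.val x) = 2⁻¹ * LinearMap.trace ℝ (S.H x)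
      (hD.curvatureEnd X.smooth_field Y.J.smooth_field hθ x ∘ₗ S.J x) := by
  rw [ricciForm_apply, ← (hθ.isHermitianForm x).sum_apply_J_eq_trace (S.finrank_H x) he _
    (hD.curvatureEnd_J _ _ hθ x)]
  refine Finset.sum_congr rfl fun b _ => ?_
  rw [← HorizontalField.J_val, curvatureEnd_val]
  rfl

theorem ricciForm_J_J {e : Fin n → S.HorizontalField} {x : M} (hθ : S.IsPseudohermitian θ)
    (u : S.H x) : hD.ricciForm e x hθ (S.J x u) (S.J x u) = hD.ricciForm e x hθ u u := by
  obtain ⟨X, rfl⟩ := HorizontalField.exists_val_eq x u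
  rw [← X.J_val, ricciForm_apply, ricciForm_apply]
  refine Finset.sum_congr rfl fun b _ => ?_
  have h1 : X.J.J.field x = -X.field x := congrArg Subtype.val (X.J_J x)
  rw [← hD.curvatureHom_apply (e b).J x X.J.smooth_field X.J.J.smooth_field, h1, map_neg,
    hD.curvatureHom_apply (e b).J x X.J.smooth_field X.smooth_field, ← curvature_swap]

theorem ricciForm_congr [T2Space M] {e e' : Fin n → S.HorizontalField} {x : M}
    (hθ : S.IsPseudohermitian θ) (he : S.IsUnitaryAt θ x e) (he' : S.IsUnitaryAt θ x e') :
    hD.ricciForm e x hθ = hD.ricciForm e' x hθ := by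
  ext u v
  obtain ⟨X, rfl⟩ := HorizontalField.exists_val_eq x u
  obtain ⟨Y, rfl⟩ := HorizontalField.exists_val_eq x v
  rw [ricciForm_eq_trace hD hθ he, ricciForm_eq_trace hD hθ he']

include hD in
theorem sum_curvature_eq [T2Space M] {e e' : Fin n → S.HorizontalField} {x : M}
    (hθ : S.IsPseudohermitian θ) (he : S.IsUnitaryAt θ x e) (he' : S.IsUnitaryAt θ x e') :
    ∑ a, ∑ b, exteriorD (𝓡 (2 * n + 1)) θ x
        (curvature D (e a).field (e a).J.field (e b).J.field x) ((e b).J.field x) =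
      ∑ a, ∑ b, exteriorD (𝓡 (2 * n + 1)) θ x
        (curvature D (e' a).field (e' a).J.field (e' b).J.field x) ((e' b).J.field x) := by
  have h := (hθ.isHermitianForm x).sum_bilin_eq (S.finrank_H x) he he' (hD.ricciForm e x hθ)
  simp only [ricciForm_J_J, ← two_mul, ← Finset.mul_sum] at h
  have h2 := mul_left_cancel₀ two_ne_zero h
  have h3 : ∀ e : Fin n → S.HorizontalField, _ := fun e =>
    Finset.sum_congr rfl fun a (_ : a ∈ Finset.univ) => hD.ricciForm_apply e x hθ (e a) (e a)
  rw [← h3, ← h3, h2, hD.ricciForm_congr hθ he he']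

theorem exists_isUnitaryAt (hθ : S.IsPseudohermitian θ) (x : M) :
    ∃ e : Fin n → S.HorizontalField, S.IsUnitaryAt θ x e := by
  obtain ⟨e, he⟩ := (hθ.isHermitianForm x).exists_isUnitaryFamily n (S.finrank_H x).ge
  choose X hX using fun a => HorizontalField.exists_val_eq x (e a)
  refine ⟨X, (hθ.isUnitaryAt_iff x X).2 ?_⟩
  simpa only [hX] using he

include hD in
/-- The Webster scalar curvature is computed by any unitary frame. -/
theorem isWebsterScalarAt [T2Space M] (hT : IsReebField θ T) {e : Fin n → S.HorizontalField} {x : M}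
    (hθ : S.IsPseudohermitian θ) (he : S.IsUnitaryAt θ x e) :
    S.IsWebsterScalarAt θ x (∑ a, ∑ b, exteriorD (𝓡 (2 * n + 1)) θ x
        (curvature D (e a).field (e a).J.field (e b).J.field x) ((e b).J.field x)) :=
  ⟨T, D, hT, hD, fun _ he' => hD.sum_curvature_eq hθ he he'⟩

end IsTanakaWebster

end CRStructure

end CR

end CRGeometry

end


noncomputable section

namespace CRGeometry

section ConformalTensor

variable {V : Type*} [AddCommGroup V] [Module ℝ V]

/-- The change of the horizontal part of the Tanaka-Webster connection under a conformal change
`e^f θ` of the contact form, where `N` is the horizontal gradient of `f`. -/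
def conformalTensor (B : LinearMap.BilinForm ℝ V) (J : V →ₗ[ℝ] V) (N y : V) : V →ₗ[ℝ] V :=
  (2⁻¹ : ℝ) • (B N y • LinearMap.id - B N (J y) • J + (B N).smulRight y
    - (B N ∘ₗ J).smulRight (J y) - (B y).smulRight N - (B (J y)).smulRight (J N))

variable {B : LinearMap.BilinForm ℝ V} {J : V →ₗ[ℝ] V}

theorem conformalTensor_apply (N y z : V) : conformalTensor B J N y z =
    (2⁻¹ : ℝ) • (B N y • z - B N (J y) • J z + B N z • y - B N (J z) • J y - B y z • N
      - B (J y) z • J N) := by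
  simp [conformalTensor]

namespace IsHermitianForm

variable (h : IsHermitianForm B J)
include h

theorem conformalTensor_J (N y z : V) :
    conformalTensor B J N y (J z) = J (conformalTensor B J N y z) := by
  simp only [conformalTensor_apply, map_smul, map_sub, map_add, h.J_J, h.apply_J_J,
    map_neg, h.apply_J_left]
  module

theorem conformalTensor_skew (N y z v : V) :
    B (conformalTensor B J N y z) v + B z (conformalTensor B J N y v) = B N y * B z v := by
  simp only [conformalTensor_apply, map_smul, map_sub, map_add, LinearMap.smul_apply,
    LinearMap.sub_apply, LinearMap.add_apply, smul_eq_mul, h.apply_J_left]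
  have e1 : B z (J N) = -B N (J z) := by rw [h.comm, h.apply_J_left]
  have e2 : B z (J y) = -B y (J z) := by rw [h.comm, h.apply_J_left]
  rw [e1, e2, h.comm z N, h.comm z y]
  ring

theorem conformalTensor_sub_swap (N y z : V) :
    conformalTensor B J N y z - conformalTensor B J N z y = -(B (J y) z • J N) := by
  simp only [conformalTensor_apply]
  rw [h.comm z y, h.apply_J_left z, h.comm z (J y)]
  module

section Frame

variable [FiniteDimensional ℝ V] {n : ℕ} (hn : Module.finrank ℝ V = 2 * n) {e : Fin n → V}
  (he : IsUnitaryFamily B J e)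
include hn he

theorem sum_conformalTensor (N y : V) :
    ∑ b, B (conformalTensor B J N y (J (e b))) (e b) = (n + 2) / 2 * B N (J y) := by
  rw [h.sum_apply_J_eq_trace hn he _ (h.conformalTensor_J N y), h.trace_eq_sum hn he]
  have h1 := h.sum_apply_mul_apply hn he N (J y)
  have h2 := h.sum_apply_mul_apply hn he y (J N)
  have h3 : ∀ a, B (e a) (e a) = 1 := fun a => by simp [(he a a).1]
  have key : ∀ a, B (conformalTensor B J N y (J (e a))) (e a)
      + B (conformalTensor B J N y (J (J (e a)))) (J (e a)) = B N (J y)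
      + (B N (e a) * B (J y) (e a) + B N (J (e a)) * B (J y) (J (e a)))
      - (B y (e a) * B (J N) (e a) + B y (J (e a)) * B (J N) (J (e a))) := by
    intro a
    simp only [conformalTensor_apply, map_smul, map_sub, map_add, map_neg, LinearMap.smul_apply,
      LinearMap.sub_apply, LinearMap.add_apply, LinearMap.neg_apply, smul_eq_mul, h.J_J,
      h.apply_J_J, h.apply_J_left, h.apply_J_self, h3]
    ring
  simp only [LinearMap.comp_apply, key, Finset.sum_add_distrib, Finset.sum_sub_distrib] at h1 h2 ⊢
  rw [h1, h2, ← h.apply_J_J y, h.J_J, map_neg, h.comm (J y) N]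
  simp
  ring

theorem sum_conformalTensor_commutator (N y z : V) :
    ∑ b, B (conformalTensor B J N y (conformalTensor B J N z (J (e b)))
      - conformalTensor B J N z (conformalTensor B J N y (J (e b)))) (e b) = 0 := by
  have h1 := h.sum_apply_J_eq_trace hn he (conformalTensor B J N y ∘ₗ conformalTensor B J N z
    - conformalTensor B J N z ∘ₗ conformalTensor B J N y) (fun v => by
      simp [h.conformalTensor_J])
  simp only [LinearMap.sub_apply, LinearMap.comp_apply] at h1
  rw [h1, LinearMap.sub_comp, map_sub, LinearMap.comp_assoc, LinearMap.comp_assoc]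
  have h2 : conformalTensor B J N y ∘ₗ J = J ∘ₗ conformalTensor B J N y :=
    LinearMap.ext (h.conformalTensor_J N y)
  have h3 := LinearMap.trace_mul_comm ℝ (conformalTensor B J N y) (conformalTensor B J N z ∘ₗ J)
  rw [h2, ← LinearMap.comp_assoc _ _ (conformalTensor B J N z)]
  simp only [Module.End.mul_eq_comp] at h3
  rw [h3, sub_self, mul_zero]

/-- The trace that gives the change of the Webster scalar curvature. -/
theorem sum_conformal_curvature (N : V) (k : V →ₗ[ℝ] V) (C P : V → V)
    (hC : ∀ z, C (J z) = J (C z)) (hP : ∀ z, P (J z) = -J (P z))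
    (hCP : ∀ z, C z = -conformalTensor B J N (-J N) z + J (k z) - B N z • J N + P z) :
    ∑ a, ∑ b, B (conformalTensor B J (k (e a)) (J (e a)) (J (e b))
        - conformalTensor B J (k (J (e a))) (e a) (J (e b))
        + (conformalTensor B J N (e a) (conformalTensor B J N (J (e a)) (J (e b)))
          - conformalTensor B J N (J (e a)) (conformalTensor B J N (e a) (J (e b))))
        + C (J (e b))) (e b) =
      -(n + 1) * LinearMap.trace ℝ V k - n * (n + 1) / 2 * B N N := by
  have hCsum : ∑ b, B (C (J (e b))) (e b) =
      -(2⁻¹ * LinearMap.trace ℝ V k) - (n + 1) / 2 * B N N := by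
    have h1 := h.sum_conformalTensor hn he N (-J N)
    have h2 := h.sum_apply_mul_apply hn he N N
    have key : ∀ b, B (C (J (e b))) (e b) = -B (conformalTensor B J N (-J N) (J (e b))) (e b)
        - 2⁻¹ * (B (k (e b)) (e b) + B (k (J (e b))) (J (e b)))
        + 2⁻¹ * (B N (e b) * B N (e b) + B N (J (e b)) * B N (J (e b))) := by
      intro b
      have e1 : B (C (J (e b))) (e b) = -B (C (e b)) (J (e b)) := by rw [hC, h.apply_J_left]
      have e2 : B (C (J (e b))) (e b) =
          2⁻¹ * (B (C (J (e b))) (e b) - B (C (e b)) (J (e b))) := by rw [e1]; ring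
      rw [e2, hCP, hCP, hP, h.conformalTensor_J]
      simp only [map_sub, map_add, map_neg, map_smul, LinearMap.sub_apply, LinearMap.add_apply,
        LinearMap.neg_apply, LinearMap.smul_apply, smul_eq_mul, h.apply_J_left, h.J_J]
      ring
    simp only [key, Finset.sum_add_distrib, Finset.sum_sub_distrib, Finset.sum_neg_distrib,
      ← Finset.mul_sum] at h1 h2 ⊢
    rw [h1, h.trace_eq_sum hn he, h2, ← Finset.sum_add_distrib, map_neg, h.J_J, neg_neg]
    ring
  have hin : ∀ a, ∑ b, B (conformalTensor B J (k (e a)) (J (e a)) (J (e b))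
        - conformalTensor B J (k (J (e a))) (e a) (J (e b))
        + (conformalTensor B J N (e a) (conformalTensor B J N (J (e a)) (J (e b)))
          - conformalTensor B J N (J (e a)) (conformalTensor B J N (e a) (J (e b))))
        + C (J (e b))) (e b) = -((n + 2) / 2 * (B (k (e a)) (e a) + B (k (J (e a))) (J (e a))))
        + (-(2⁻¹ * LinearMap.trace ℝ V k) - (n + 1) / 2 * B N N) := by
    intro a
    have h1 := h.sum_conformalTensor hn he (k (e a)) (J (e a))
    have h2 := h.sum_conformalTensor hn he (k (J (e a))) (e a)
    have h3 := h.sum_conformalTensor_commutator hn he N (e a) (J (e a))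
    simp only [LinearMap.map_add₂, LinearMap.map_sub₂ B (conformalTensor B J (k (e a)) (J (e a)) _),
      Finset.sum_add_distrib, Finset.sum_sub_distrib] at h1 h2 ⊢
    rw [h1, h2, h3, hCsum, h.J_J, map_neg]
    ring
  simp only [hin]
  rw [Finset.sum_add_distrib, Finset.sum_neg_distrib, ← Finset.mul_sum, ← h.trace_eq_sum hn he]
  simp
  ring

end Frame

end IsHermitianForm

end ConformalTensor

end CRGeometry

end


noncomputable section

namespace CRGeometry

section CR

variable {n : ℕ} {M : Type*} [TopologicalSpace M]
  [ChartedSpace (EuclideanSpace ℝ (Fin (2 * n + 1))) M] [IsManifold (𝓡 (2 * n + 1)) ∞ M]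

namespace CRStructure

open AlmostCRStructure

/-- Two pseudohermitian structures `θ` and `u θ` with their Tanaka-Webster connections. -/
structure ConformalPair (S : CRStructure n M) (θ θ' : OneForm (𝓡 (2 * n + 1)) (M := M))
    (T T' : ∀ x : M, TangentSpace (𝓡 (2 * n + 1)) x)
    (D D' : CovariantDerivative (𝓡 (2 * n + 1)) (EuclideanSpace ℝ (Fin (2 * n + 1)))
      (TangentSpace (𝓡 (2 * n + 1)) : M → Type _)) (u : M → ℝ) : Prop where
  pseudohermitian : S.IsPseudohermitian θ
  pseudohermitian' : S.IsPseudohermitian θ'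
  reeb : IsReebField θ T
  reeb' : IsReebField θ' T'
  webster : S.IsTanakaWebster θ T D
  webster' : S.IsTanakaWebster θ' T' D'
  pos : ∀ x, 0 < u x
  eq_smul : ∀ x, θ' x = u x • θ x

variable {S : CRStructure n M} {θ : OneForm (𝓡 (2 * n + 1)) (M := M)}

theorem _root_.CRGeometry.IsReebField.apply_mlieBracket {T : ∀ x : M, TangentSpace (𝓡 (2 * n + 1)) x}
    (hT : IsReebField θ T) (hθ : S.IsPseudohermitian θ) (Z : S.HorizontalField) (x : M) :
    θ x (mlieBracket (𝓡 (2 * n + 1)) T Z.field x) = 0 := by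
  have h := hT.exteriorD_eq_zero x (Z.field x)
  rw [exteriorD_apply_fields hθ.smooth (hT.smooth.mdifferentiableAt x)
    (Z.smooth_field.mdifferentiableAt x), exteriorDOnFields] at h
  have h1 : (fun y => θ y (Z.field y)) = fun _ => 0 := funext (hθ.apply_field Z)
  have h2 : (fun y => θ y (T y)) = fun _ => 1 := funext hT.apply_eq_one
  simpa [h1, h2, mvfderiv_const] using h

theorem IsTanakaWebster.nabla_reeb {T : ∀ x : M, TangentSpace (𝓡 (2 * n + 1)) x}
    {D : CovariantDerivative (𝓡 (2 * n + 1)) (EuclideanSpace ℝ (Fin (2 * n + 1)))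
      (TangentSpace (𝓡 (2 * n + 1)) : M → Type _)}
    (hD : S.IsTanakaWebster θ T D) (hT : IsReebField θ T) (Z : S.HorizontalField) (x : M) :
    (hD.nabla Z x (T x) : TangentSpace (𝓡 (2 * n + 1)) x) =
      mlieBracket (𝓡 (2 * n + 1)) T Z.field x + D.torsion x (T x) (Z.val x) := by
  rw [← Z.field_apply, D.torsion_apply (hT.smooth.mdifferentiableAt x)
    (Z.smooth_field.mdifferentiableAt x), hD.parallel_reeb, hD.coe_nabla]
  abel

/-- The pseudohermitian torsion `v ↦ Tor(T, v)`. -/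
def IsTanakaWebster.reebTorsion {T : ∀ x : M, TangentSpace (𝓡 (2 * n + 1)) x}
    {D : CovariantDerivative (𝓡 (2 * n + 1)) (EuclideanSpace ℝ (Fin (2 * n + 1)))
      (TangentSpace (𝓡 (2 * n + 1)) : M → Type _)}
    (hD : S.IsTanakaWebster θ T D) (x : M) (v : S.H x) : S.H x :=
  ⟨D.torsion x (T x) v, (hD.torsion_reeb x v).choose⟩

theorem IsTanakaWebster.reebTorsion_J {T : ∀ x : M, TangentSpace (𝓡 (2 * n + 1)) x}
    {D : CovariantDerivative (𝓡 (2 * n + 1)) (EuclideanSpace ℝ (Fin (2 * n + 1)))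
      (TangentSpace (𝓡 (2 * n + 1)) : M → Type _)}
    (hD : S.IsTanakaWebster θ T D) (x : M) (v : S.H x) :
    hD.reebTorsion x (S.J x v) = -S.J x (hD.reebTorsion x v) :=
  Subtype.ext (hD.torsion_reeb x v).choose_spec

namespace ConformalPair

variable {θ' : OneForm (𝓡 (2 * n + 1)) (M := M)}
  {T T' : ∀ x : M, TangentSpace (𝓡 (2 * n + 1)) x}
  {D D' : CovariantDerivative (𝓡 (2 * n + 1)) (EuclideanSpace ℝ (Fin (2 * n + 1)))
    (TangentSpace (𝓡 (2 * n + 1)) : M → Type _)} {u : M → ℝ}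
  (h : S.ConformalPair θ θ' T T' D D' u)

section

include h

theorem apply_eq (x : M) (v : TangentSpace (𝓡 (2 * n + 1)) x) : θ' x v = u x * θ x v := by
  rw [h.eq_smul]
  rfl

theorem contMDiff : ContMDiff (𝓡 (2 * n + 1)) 𝓘(ℝ, ℝ) ∞ u := by
  have h1 := h.pseudohermitian'.smooth.contMDiff_apply h.reeb.smooth
  have h2 : (fun x => θ' x (T x)) = u := by
    ext x
    rw [h.apply_eq, h.reeb.apply_eq_one, mul_one]
  rwa [h2] at h1

theorem exteriorD_eq (x : M) (v w : S.H x) : exteriorD (𝓡 (2 * n + 1)) θ' x v w =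
    u x * exteriorD (𝓡 (2 * n + 1)) θ x v w := by
  obtain ⟨X, rfl⟩ := HorizontalField.exists_val_eq x v
  obtain ⟨Y, rfl⟩ := HorizontalField.exists_val_eq x w
  rw [h.pseudohermitian'.exteriorD_field, h.pseudohermitian.exteriorD_field, h.apply_eq]
  ring

theorem levi_eq (x : M) (v w : S.H x) :
    h.pseudohermitian'.levi x v w = u x * h.pseudohermitian.levi x v w :=
  h.exteriorD_eq x v (S.J x w)

end

/-- The horizontal field `u T' - T`. -/
def reebDiff : S.HorizontalField :=
  HorizontalField.ofField (u • T' - T) ((h.reeb'.smooth.smul h.contMDiff).sub h.reeb.smooth)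
    (fun x => (h.pseudohermitian.ker_eq x _).1 (by
      rw [Pi.sub_apply, map_sub, h.reeb.apply_eq_one, Pi.smul_apply', map_smul, smul_eq_mul,
        ← h.apply_eq, h.reeb'.apply_eq_one, sub_self]))

theorem smul_reeb' (x : M) :
    u x • T' x = T x + (h.reebDiff.val x : TangentSpace (𝓡 (2 * n + 1)) x) := by
  change _ = T x + (u x • T' x - T x)
  abel

/-- The horizontal gradient of `log u`. -/
def grad : S.HorizontalField := h.reebDiff.J

theorem reebDiff_val (x : M) : h.reebDiff.val x = -S.J x (h.grad.val x) := by
  rw [grad, HorizontalField.J_val, S.J_J, neg_neg]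

theorem smul_mlieBracket_reeb' (Z : S.HorizontalField) (x : M) :
    u x • mlieBracket (𝓡 (2 * n + 1)) T' Z.field x =
      mlieBracket (𝓡 (2 * n + 1)) T Z.field x
        + mlieBracket (𝓡 (2 * n + 1)) h.reebDiff.field Z.field x
        + mvfderiv (𝓡 (2 * n + 1)) u x (Z.field x) • T' x := by
  have h1 := mlieBracket_smul_left (h.contMDiff.mdifferentiable (by simp) x)
    (h.reeb'.smooth.mdifferentiableAt x) (W := Z.field)
  have h2 : u • T' = T + h.reebDiff.field := funext h.smul_reeb'
  rw [h2, mlieBracket_add_left (h.reeb.smooth.mdifferentiableAt x)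
    (h.reebDiff.smooth_field.mdifferentiableAt x)] at h1
  rw [h1]
  module

theorem levi_grad (x : M) (v : S.H x) : h.pseudohermitian.levi x (h.grad.val x) v =
    (u x)⁻¹ * mvfderiv (𝓡 (2 * n + 1)) u x v := by
  obtain ⟨Z, rfl⟩ := HorizontalField.exists_val_eq x v
  have h1 := congrArg (θ x) (h.smul_mlieBracket_reeb' Z x)
  rw [map_smul, map_add, map_add, map_smul, h.reeb.apply_mlieBracket h.pseudohermitian,
    smul_eq_mul, ← h.apply_eq, h.reeb'.apply_mlieBracket h.pseudohermitian'] at h1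
  have h2 : θ x (T' x) = (u x)⁻¹ := by
    have := h.reeb'.apply_eq_one x
    rw [h.apply_eq] at this
    exact eq_inv_of_mul_eq_one_right this
  have h3 := h.pseudohermitian.exteriorD_field h.reebDiff Z x
  rw [h.pseudohermitian.exteriorD_eq_levi] at h3
  rw [h2, smul_eq_mul] at h1
  rw [grad, HorizontalField.J_val, h3]
  rw [Z.field_apply] at h1
  linear_combination h1

theorem mvfderiv_eq (x : M) (v : S.H x) : mvfderiv (𝓡 (2 * n + 1)) u x v =
    u x * h.pseudohermitian.levi x (h.grad.val x) v := by
  rw [levi_grad, mul_inv_cancel_left₀ (h.pos x).ne']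

theorem smul_exteriorD_reeb' (x : M) (v w : S.H x) :
    exteriorD (𝓡 (2 * n + 1)) θ' x v w • T' x = exteriorD (𝓡 (2 * n + 1)) θ x v w • T x
      - ((h.pseudohermitian.levi x (S.J x v) w • S.J x (h.grad.val x) : S.H x) :
          TangentSpace (𝓡 (2 * n + 1)) x) := by
  rw [h.exteriorD_eq, mul_comm (u x), mul_smul, h.smul_reeb', h.reebDiff_val, smul_add,
    h.pseudohermitian.exteriorD_eq_levi]
  simp [sub_eq_add_neg]

theorem nabla_eq (Z : S.HorizontalField) (x : M) (v : S.H x) :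
    h.webster'.nabla Z x v = h.webster.nabla Z x v
      + conformalTensor (h.pseudohermitian.levi x) (S.J x) (h.grad.val x) v (Z.val x) := by
  have hB := h.pseudohermitian.isHermitianForm x
  let K : S.HorizontalField → S.HorizontalField → S.H x := fun Y Z =>
    h.webster'.nabla Z x (Y.field x) - h.webster.nabla Z x (Y.field x)
      - conformalTensor (h.pseudohermitian.levi x) (S.J x) (h.grad.val x) (Y.val x) (Z.val x)
  have hsymm : ∀ Y Z, K Y Z = K Z Y := by
    intro Y Z
    have h1 := h.webster'.nabla_sub_nabla Y Z x
    rw [h.smul_exteriorD_reeb', ← add_sub_assoc, ← h.webster.nabla_sub_nabla Y Z x] at h1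
    have h2 : h.webster'.nabla Z x (Y.field x) - h.webster'.nabla Y x (Z.field x) =
        h.webster.nabla Z x (Y.field x) - h.webster.nabla Y x (Z.field x)
          - h.pseudohermitian.levi x (S.J x (Y.val x)) (Z.val x) • S.J x (h.grad.val x) :=
      Subtype.ext h1
    have h3 := hB.conformalTensor_sub_swap (h.grad.val x) (Y.val x) (Z.val x)
    rw [← sub_eq_zero]
    rw [sub_eq_iff_eq_add] at h2 h3
    simp only [K]
    rw [h2, h3]
    module
  have hskew : ∀ Y Z V, h.pseudohermitian.levi x (K Y Z) (V.val x) =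
      -h.pseudohermitian.levi x (K Y V) (Z.val x) := by
    intro Y Z V
    have h1 := h.webster'.mvfderiv_levi h.pseudohermitian' Z V x (Y.field x)
    have h2 : (fun y => h.pseudohermitian'.levi y (Z.val y) (V.val y)) =
        u * fun y => h.pseudohermitian.levi y (Z.val y) (V.val y) :=
      funext fun y => h.levi_eq y _ _
    rw [h2, mvfderiv_mul (h.contMDiff.mdifferentiable (by simp) x)
      ((h.pseudohermitian.contMDiff_levi Z V).mdifferentiable (by simp) x)] at h1
    simp only [add_apply, smul_apply, smul_eq_mul] at h1
    rw [h.webster.mvfderiv_levi h.pseudohermitian, h.levi_eq, h.levi_eq, Y.field_apply,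
      h.mvfderiv_eq] at h1
    have h3 := hB.conformalTensor_skew (h.grad.val x) (Y.val x) (Z.val x) (V.val x)
    have h4 : h.pseudohermitian.levi x (h.webster'.nabla Z x (Y.val x)) (V.val x)
        + h.pseudohermitian.levi x (Z.val x) (h.webster'.nabla V x (Y.val x)) =
        h.pseudohermitian.levi x (h.webster.nabla Z x (Y.val x)) (V.val x)
        + h.pseudohermitian.levi x (Z.val x) (h.webster.nabla V x (Y.val x))
        + h.pseudohermitian.levi x (h.grad.val x) (Y.val x)
          * h.pseudohermitian.levi x (Z.val x) (V.val x) := by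
      refine mul_left_cancel₀ (h.pos x).ne' ?_
      linear_combination -h1
    simp only [K, Y.field_apply, LinearMap.map_sub₂]
    rw [h.pseudohermitian.levi_comm x (h.webster'.nabla V x (Y.val x)),
      h.pseudohermitian.levi_comm x (h.webster.nabla V x (Y.val x)),
      h.pseudohermitian.levi_comm x (conformalTensor _ _ _ _ (V.val x))]
    linear_combination h4 - h3
  obtain ⟨Y, rfl⟩ := HorizontalField.exists_val_eq x v
  have hK : K Y Z = 0 := by
    refine h.pseudohermitian.levi_eq_zero fun w => ?_
    obtain ⟨V, rfl⟩ := HorizontalField.exists_val_eq x w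
    have e1 := hskew Y Z V
    have e2 := hskew V Y Z
    have e3 := hskew Z V Y
    rw [hsymm V Y] at e2
    rw [hsymm Z V] at e3
    rw [hsymm Z Y] at e3
    linarith
  have h5 : h.webster'.nabla Z x (Y.field x) - h.webster.nabla Z x (Y.field x)
      - conformalTensor (h.pseudohermitian.levi x) (S.J x) (h.grad.val x) (Y.val x) (Z.val x)
      = 0 := hK
  rw [sub_sub, sub_eq_zero] at h5
  exact h5

theorem nabla_reeb_sub (Z : S.HorizontalField) (x : M) :
    h.webster'.nabla Z x (T x) - h.webster.nabla Z x (T x) =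
      -conformalTensor (h.pseudohermitian.levi x) (S.J x) (h.grad.val x)
          (-S.J x (h.grad.val x)) (Z.val x)
        + S.J x (h.webster.nabla h.grad x (Z.val x))
        - h.pseudohermitian.levi x (h.grad.val x) (Z.val x) • S.J x (h.grad.val x)
        + (u x • h.webster'.reebTorsion x (Z.val x) - h.webster.reebTorsion x (Z.val x)) := by
  have h1 := h.webster'.nabla_reeb h.reeb' Z x
  have h2 := h.webster.nabla_reeb h.reeb Z x
  have h3 := h.smul_mlieBracket_reeb' Z x
  have h4 := h.webster.nabla_sub_nabla h.reebDiff Z x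
  have h5 := h.nabla_eq Z x (h.reebDiff.val x)
  have h6 : h.webster.nabla h.reebDiff x (Z.field x) =
      -S.J x (h.webster.nabla h.grad x (Z.field x)) := by
    rw [grad, h.webster.nabla_J, S.J_J, neg_neg]
  rw [h6] at h4
  rw [h.pseudohermitian.exteriorD_eq_levi, ← HorizontalField.J_val] at h4
  have h7 : u x • (h.webster'.nabla Z x (T' x)) =
      h.webster'.nabla Z x (T x) + h.webster'.nabla Z x (h.reebDiff.val x) := by
    rw [← map_smul, h.smul_reeb', map_add]
  have h8 : mvfderiv (𝓡 (2 * n + 1)) u x (Z.field x) • T' x =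
      h.pseudohermitian.levi x (h.grad.val x) (Z.val x) •
        (T x + (h.reebDiff.val x : TangentSpace (𝓡 (2 * n + 1)) x)) := by
    rw [← h.smul_reeb', smul_smul, mul_comm (h.pseudohermitian.levi x _ _) (u x), ← h.mvfderiv_eq]
    rfl
  have h9 := congrArg (Subtype.val) h7
  have h10 := congrArg (Subtype.val) h5
  rw [← h.reebDiff_val]
  have h11 : -h.pseudohermitian.levi x (h.grad.val x) (Z.val x) • S.J x (h.grad.val x) =
      h.pseudohermitian.levi x (h.grad.val x) (Z.val x) • h.reebDiff.val x := by
    rw [h.reebDiff_val]; module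
  rw [sub_eq_add_neg _ (h.pseudohermitian.levi x (h.grad.val x) (Z.val x) • S.J x (h.grad.val x)),
    ← neg_smul, h11]
  apply Subtype.ext
  simp only [Submodule.coe_add, Submodule.coe_sub, Submodule.coe_neg, Submodule.coe_smul,
    HorizontalField.field_apply, sub_neg_eq_add] at h4 h9 h10 h3 h8 ⊢
  change _ = _ + (u x • D'.torsion x (T' x) (Z.val x) - D.torsion x (T x) (Z.val x))
  change _ = _ + h.pseudohermitian.levi x (h.grad.val x) (Z.val x) • T x at h4
  linear_combination (norm := module) u x • h1 - h2 + h3 - h4 - h9 - h10 + h8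

end ConformalPair

end CRStructure

end CR

end CRGeometry

end


noncomputable section

namespace CRGeometry

section CR

variable {n : ℕ} {M : Type*} [TopologicalSpace M]
  [ChartedSpace (EuclideanSpace ℝ (Fin (2 * n + 1))) M] [IsManifold (𝓡 (2 * n + 1)) ∞ M]

namespace CRStructure

open AlmostCRStructure

variable {S : CRStructure n M} {θ : OneForm (𝓡 (2 * n + 1)) (M := M)}

section ConformalField

variable {T : ∀ x : M, TangentSpace (𝓡 (2 * n + 1)) x}
  {D : CovariantDerivative (𝓡 (2 * n + 1)) (EuclideanSpace ℝ (Fin (2 * n + 1)))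
    (TangentSpace (𝓡 (2 * n + 1)) : M → Type _)}
  (hθ : S.IsPseudohermitian θ) (hD : S.IsTanakaWebster θ T D)

/-- The horizontal field `⟨X, Y⟩ Z`. -/
def IsPseudohermitian.leviSmul (X Y Z : S.HorizontalField) : S.HorizontalField :=
  Z.smul (fun y => hθ.levi y (X.val y) (Y.val y)) (hθ.contMDiff_levi X Y)

theorem IsTanakaWebster.nabla_leviSmul (X Y Z : S.HorizontalField) (x : M)
    (v : TangentSpace (𝓡 (2 * n + 1)) x) :
    hD.nabla (hθ.leviSmul X Y Z) x v = hθ.levi x (X.val x) (Y.val x) • hD.nabla Z x v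
      + (hθ.levi x (hD.nabla X x v) (Y.val x) + hθ.levi x (X.val x) (hD.nabla Y x v)) •
        Z.val x := by
  rw [IsPseudohermitian.leviSmul, hD.nabla_smul, hD.mvfderiv_levi]

/-- The field `x ↦ A(Y, Z)` for the conformal tensor `A` with gradient field `N`. -/
def IsPseudohermitian.conformalField (N Y Z : S.HorizontalField) : S.HorizontalField :=
  (hθ.leviSmul N Y Z - hθ.leviSmul N Y.J Z.J + hθ.leviSmul N Z Y - hθ.leviSmul N Z.J Y.J
    - hθ.leviSmul Y Z N - hθ.leviSmul Y.J Z N.J).smul (fun _ => 2⁻¹) contMDiff_const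

theorem IsPseudohermitian.conformalField_val (N Y Z : S.HorizontalField) (x : M) :
    (hθ.conformalField N Y Z).val x =
      conformalTensor (hθ.levi x) (S.J x) (N.val x) (Y.val x) (Z.val x) := by
  rw [conformalTensor_apply]
  rfl

theorem IsTanakaWebster.nabla_conformalField (N : S.HorizontalField) {Y Z : S.HorizontalField}
    {x : M} (hY : hD.nabla Y x = 0) (hZ : hD.nabla Z x = 0)
    (v : TangentSpace (𝓡 (2 * n + 1)) x) :
    hD.nabla (hθ.conformalField N Y Z) x v =
      conformalTensor (hθ.levi x) (S.J x) (hD.nabla N x v) (Y.val x) (Z.val x) := by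
  rw [conformalTensor_apply, IsPseudohermitian.conformalField, nabla_smul]
  simp only [nabla_sub, nabla_add, LinearMap.sub_apply, LinearMap.add_apply,
    nabla_leviSmul hθ hD, nabla_J, hY, hZ, LinearMap.zero_apply,
    map_zero, HorizontalField.J_val, mvfderiv_const, zero_apply, zero_smul, add_zero, smul_zero,
    zero_add]

end ConformalField

namespace IsTanakaWebster

variable {T : ∀ x : M, TangentSpace (𝓡 (2 * n + 1)) x}
  {D : CovariantDerivative (𝓡 (2 * n + 1)) (EuclideanSpace ℝ (Fin (2 * n + 1)))
    (TangentSpace (𝓡 (2 * n + 1)) : M → Type _)}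

/-- The scalar curvature of a Tanaka-Webster connection. -/
def scalar (_ : S.IsTanakaWebster θ T D) (hθ : S.IsPseudohermitian θ) (x : M) : ℝ :=
  ∑ a, ∑ b, exteriorD (𝓡 (2 * n + 1)) θ x
    (curvature D ((exists_isUnitaryAt hθ x).choose a).field
      ((exists_isUnitaryAt hθ x).choose a).J.field ((exists_isUnitaryAt hθ x).choose b).J.field x)
    (((exists_isUnitaryAt hθ x).choose b).J.field x)

variable (hD : S.IsTanakaWebster θ T D) (hθ : S.IsPseudohermitian θ)

theorem scalar_eq [T2Space M] {x : M} {e : Fin n → S.HorizontalField} (he : S.IsUnitaryAt θ x e) :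
    hD.scalar hθ x = ∑ a, ∑ b, exteriorD (𝓡 (2 * n + 1)) θ x
        (curvature D (e a).field (e a).J.field (e b).J.field x) ((e b).J.field x) :=
  hD.sum_curvature_eq hθ (exists_isUnitaryAt hθ x).choose_spec he

theorem scalar_eq_sum [T2Space M] {x : M} {e : Fin n → S.HorizontalField}
    (he : S.IsUnitaryAt θ x e) :
    hD.scalar hθ x = ∑ a, ∑ b, hθ.levi x
      (hD.horizontalCurvature (e a).smooth_field (e a).J.smooth_field (e b).J x) ((e b).val x) := by
  rw [hD.scalar_eq hθ he]
  rfl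

/-- The divergence of a horizontal field: the trace of its covariant derivative along `H`. -/
def horizontalDiv (Z : S.HorizontalField) (x : M) : ℝ :=
  LinearMap.trace ℝ (S.H x) (hD.nabla Z x ∘ₗ (S.H x).subtype)

include hD hθ in
theorem exists_isUnitaryAt_nabla_eq_zero [T2Space M] (x : M) :
    ∃ e : Fin n → S.HorizontalField, S.IsUnitaryAt θ x e ∧ ∀ a, hD.nabla (e a) x = 0 := by
  obtain ⟨e, he⟩ := (hθ.isHermitianForm x).exists_isUnitaryFamily n (S.finrank_H x).ge
  choose X hX hX' using fun a => hD.exists_nabla_eq_zero x (e a)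
  refine ⟨X, (hθ.isUnitaryAt_iff x X).2 ?_, hX'⟩
  simpa only [hX] using he

end IsTanakaWebster

namespace ConformalPair

variable {θ' : OneForm (𝓡 (2 * n + 1)) (M := M)}
  {T T' : ∀ x : M, TangentSpace (𝓡 (2 * n + 1)) x}
  {D D' : CovariantDerivative (𝓡 (2 * n + 1)) (EuclideanSpace ℝ (Fin (2 * n + 1)))
    (TangentSpace (𝓡 (2 * n + 1)) : M → Type _)} {u : M → ℝ}
  (h : S.ConformalPair θ θ' T T' D D' u)

theorem covDeriv_eq (Y Z : S.HorizontalField) :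
    h.webster'.covDeriv Y.field Y.smooth_field Z = h.webster.covDeriv Y.field Y.smooth_field Z
      + h.pseudohermitian.conformalField h.grad Y Z := by
  ext1 x
  rw [HorizontalField.add_val, IsTanakaWebster.covDeriv_val, IsTanakaWebster.covDeriv_val,
    IsPseudohermitian.conformalField_val]
  exact h.nabla_eq Z x (Y.val x)

theorem nabla_covDeriv_eq (Y Z : S.HorizontalField) (x : M) (v : S.H x)
    (hY : h.webster.nabla Y x = 0) (hZ : h.webster.nabla Z x = 0) :
    h.webster'.nabla (h.webster'.covDeriv Y.field Y.smooth_field Z) x v =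
      h.webster.nabla (h.webster.covDeriv Y.field Y.smooth_field Z) x v
      + conformalTensor (h.pseudohermitian.levi x) (S.J x) (h.webster.nabla h.grad x v)
        (Y.val x) (Z.val x)
      + conformalTensor (h.pseudohermitian.levi x) (S.J x) (h.grad.val x) v
        (conformalTensor (h.pseudohermitian.levi x) (S.J x) (h.grad.val x) (Y.val x) (Z.val x)) := by
  rw [h.nabla_eq, h.covDeriv_eq, IsTanakaWebster.nabla_add, HorizontalField.add_val,
    IsPseudohermitian.conformalField_val, IsTanakaWebster.covDeriv_val, hZ, LinearMap.add_apply,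
    IsTanakaWebster.nabla_conformalField _ _ _ hY hZ]
  simp

/-- The difference `∇'_T - ∇_T` on `H`. -/
def reebDiffEnd (x : M) (z : S.H x) : S.H x :=
  -conformalTensor (h.pseudohermitian.levi x) (S.J x) (h.grad.val x)
      (-S.J x (h.grad.val x)) z
    + S.J x (h.webster.nabla h.grad x z)
    - h.pseudohermitian.levi x (h.grad.val x) z • S.J x (h.grad.val x)
    + (u x • h.webster'.reebTorsion x z - h.webster.reebTorsion x z)

theorem reebDiffEnd_val (Z : S.HorizontalField) (x : M) : h.reebDiffEnd x (Z.val x) =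
    h.webster'.nabla Z x (T x) - h.webster.nabla Z x (T x) :=
  (h.nabla_reeb_sub Z x).symm

theorem reebDiffEnd_J (x : M) (z : S.H x) :
    h.reebDiffEnd x (S.J x z) = S.J x (h.reebDiffEnd x z) := by
  obtain ⟨Z, rfl⟩ := HorizontalField.exists_val_eq x z
  rw [← Z.J_val, reebDiffEnd_val, reebDiffEnd_val, IsTanakaWebster.nabla_J,
    IsTanakaWebster.nabla_J, map_sub]

theorem horizontalCurvature_eq (E Z : S.HorizontalField) (x : M)
    (hE : h.webster.nabla E x = 0) (hZ : h.webster.nabla Z x = 0)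
    (hEn : h.pseudohermitian.levi x (E.val x) (E.val x) = 1) :
    h.webster'.horizontalCurvature E.smooth_field E.J.smooth_field Z x =
      h.webster.horizontalCurvature E.smooth_field E.J.smooth_field Z x
      + (conformalTensor (h.pseudohermitian.levi x) (S.J x) (h.webster.nabla h.grad x (E.val x))
          (S.J x (E.val x)) (Z.val x)
        - conformalTensor (h.pseudohermitian.levi x) (S.J x)
          (h.webster.nabla h.grad x (S.J x (E.val x))) (E.val x) (Z.val x)
        + (conformalTensor (h.pseudohermitian.levi x) (S.J x) (h.grad.val x) (E.val x)
            (conformalTensor (h.pseudohermitian.levi x) (S.J x) (h.grad.val x) (S.J x (E.val x))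
              (Z.val x))
          - conformalTensor (h.pseudohermitian.levi x) (S.J x) (h.grad.val x) (S.J x (E.val x))
            (conformalTensor (h.pseudohermitian.levi x) (S.J x) (h.grad.val x) (E.val x)
              (Z.val x)))
        + h.reebDiffEnd x (Z.val x)) := by
  have hJE : h.webster.nabla E.J x = 0 := LinearMap.ext fun v => by
    rw [IsTanakaWebster.nabla_J, hE]; simp
  have hb : mlieBracket (𝓡 (2 * n + 1)) E.field E.J.field x = -T x := by
    have h1 := h.webster.nabla_sub_nabla E E.J x
    have h2 : exteriorD (𝓡 (2 * n + 1)) θ x (E.val x) (E.J.val x) = 1 := hEn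
    rw [hE, hJE, h2, one_smul] at h1
    simp only [LinearMap.zero_apply, ZeroMemClass.coe_zero, sub_zero] at h1
    exact eq_neg_of_add_eq_zero_left h1.symm
  have h1 := h.nabla_covDeriv_eq E.J Z x (E.val x) hJE hZ
  have h2 := h.nabla_covDeriv_eq E Z x (E.J.val x) hE hZ
  have h3 := h.reebDiffEnd_val Z x
  rw [E.J_val] at h1 h2
  simp only [IsTanakaWebster.horizontalCurvature, hb, map_neg, E.field_apply, E.J.field_apply,
    E.J_val, h1, h2, h3]
  abel

include h in
theorem isUnitaryAt_smul {x : M} {e : Fin n → S.HorizontalField} (he : S.IsUnitaryAt θ x e) :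
    S.IsUnitaryAt θ' x (fun a => (e a).smul (fun _ => (√(u x))⁻¹) contMDiff_const) := by
  have key : ∀ v w : S.H x, S.leviForm θ' x ((√(u x))⁻¹ • v) ((√(u x))⁻¹ • w) =
      S.leviForm θ x v w := by
    intro v w
    have h2 : u x * ((√(u x))⁻¹ * ((√(u x))⁻¹ * h.pseudohermitian.levi x v w)) =
        h.pseudohermitian.levi x v w := by
      rw [← mul_assoc (√(u x))⁻¹, ← mul_inv, Real.mul_self_sqrt (h.pos x).le,
        mul_inv_cancel_left₀ (h.pos x).ne']
    exact (h.levi_eq x _ _).trans (Eq.trans (by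
      simp only [map_smul, LinearMap.smul_apply, smul_eq_mul]) h2)
  intro a b
  obtain ⟨h1, h2⟩ := he a b
  refine ⟨(key _ _).trans h1, ?_⟩
  rw [HorizontalField.J_val, HorizontalField.smul_val, HorizontalField.smul_val, map_smul]
  exact (key _ _).trans h2

/-- Conformal change of the Webster scalar curvature. -/
theorem mul_scalar_eq [T2Space M] (x : M) :
    u x * h.webster'.scalar h.pseudohermitian' x = h.webster.scalar h.pseudohermitian x
      - (n + 1) * h.webster.horizontalDiv h.grad x
      - n * (n + 1) / 2 * h.pseudohermitian.levi x (h.grad.val x) (h.grad.val x) := by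
  obtain ⟨e, he, hnab⟩ := h.webster.exists_isUnitaryAt_nabla_eq_zero h.pseudohermitian x
  have he' := h.isUnitaryAt_smul he
  have hsum := (h.pseudohermitian.isHermitianForm x).sum_conformal_curvature (S.finrank_H x)
    ((h.pseudohermitian.isUnitaryAt_iff x e).1 he) (h.grad.val x)
    (h.webster.nabla h.grad x ∘ₗ (S.H x).subtype) (h.reebDiffEnd x)
    (fun z => u x • h.webster'.reebTorsion x z - h.webster.reebTorsion x z)
    (h.reebDiffEnd_J x) (fun z => by
      rw [IsTanakaWebster.reebTorsion_J, IsTanakaWebster.reebTorsion_J, map_sub, map_smul]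
      module) (fun z => rfl)
  rw [h.webster'.scalar_eq_sum h.pseudohermitian' he', h.webster.scalar_eq_sum h.pseudohermitian he,
    IsTanakaWebster.horizontalDiv, sub_sub, add_comm ((n + 1 : ℝ) * _), ← sub_sub]
  have hterm : ∀ a b, u x * h.pseudohermitian'.levi x
      (h.webster'.horizontalCurvature
        ((e a).smul (fun _ => (√(u x))⁻¹) contMDiff_const).smooth_field
        ((e a).smul (fun _ => (√(u x))⁻¹) contMDiff_const).J.smooth_field
        ((e b).smul (fun _ => (√(u x))⁻¹) contMDiff_const).J x)
      (((e b).smul (fun _ => (√(u x))⁻¹) contMDiff_const).val x) =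
      h.pseudohermitian.levi x (h.webster'.horizontalCurvature (e a).smooth_field
        (e a).J.smooth_field (e b).J x) ((e b).val x) := by
    intro a b
    have e1 : ((e b).smul (fun _ => (√(u x))⁻¹) contMDiff_const).J =
        (e b).J.smul (fun _ => (√(u x))⁻¹) contMDiff_const := by
      ext1 y
      simp [HorizontalField.J_val, HorizontalField.smul_val]
    have e2 : h.webster'.horizontalCurvature
        ((e a).smul (fun _ => (√(u x))⁻¹) contMDiff_const).smooth_field
        ((e a).smul (fun _ => (√(u x))⁻¹) contMDiff_const).J.smooth_field (e b).J x =
        (u x)⁻¹ • h.webster'.horizontalCurvature (e a).smooth_field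
        (e a).J.smooth_field (e b).J x := by
      apply Subtype.ext
      rw [Submodule.coe_smul, IsTanakaWebster.coe_horizontalCurvature,
        IsTanakaWebster.coe_horizontalCurvature,
        ← h.webster'.curvatureHom_apply (e b).J x (HorizontalField.smooth_field _)
          (HorizontalField.smooth_field _),
        ← h.webster'.curvatureHom_apply (e b).J x (e a).smooth_field (e a).J.smooth_field]
      have e3 : ((e a).smul (fun _ => (√(u x))⁻¹) contMDiff_const).field x =
        (√(u x))⁻¹ • (e a).field x := rfl
      have e4 : ((e a).smul (fun _ => (√(u x))⁻¹) contMDiff_const).J.field x =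
        (√(u x))⁻¹ • (e a).J.field x := congrArg Subtype.val ((S.J x).map_smul _ _)
      rw [e3, e4, map_smul, map_smul, smul_apply, smul_smul, ← mul_inv,
        Real.mul_self_sqrt (h.pos x).le]
    rw [e1, IsTanakaWebster.horizontalCurvature_const_smul, e2, h.levi_eq,
      HorizontalField.smul_val]
    simp only [map_smul, LinearMap.smul_apply, smul_eq_mul]
    have h0 := (h.pos x).ne'
    have h1 : (√(u x))⁻¹ * (√(u x))⁻¹ = (u x)⁻¹ := by
      rw [← mul_inv, Real.mul_self_sqrt (h.pos x).le]
    generalize h.pseudohermitian.levi x _ _ = L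
    trans (u x * u x) * ((√(u x))⁻¹ * (√(u x))⁻¹) * (u x)⁻¹ * L
    · ring
    · rw [h1]
      field_simp
  simp only [Finset.mul_sum, hterm]
  have hcurv : ∀ a b, h.pseudohermitian.levi x (h.webster'.horizontalCurvature (e a).smooth_field
        (e a).J.smooth_field (e b).J x) ((e b).val x) = _ := fun a b => by
    have hJ : h.webster.nabla (e b).J x = 0 := LinearMap.ext fun v => by
      rw [IsTanakaWebster.nabla_J, hnab]; simp
    have h1 : h.pseudohermitian.levi x ((e a).val x) ((e a).val x) = 1 := by
      have := (he a a).1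
      rw [if_pos rfl] at this
      exact this
    rw [h.horizontalCurvature_eq (e a) (e b).J x (hnab a) hJ h1, LinearMap.map_add₂]
  simp only [hcurv, Finset.sum_add_distrib]
  simp only [HorizontalField.J_val]
  simp only [LinearMap.comp_apply, Submodule.subtype_apply] at hsum
  rw [hsum]
  ring

/-- Scaling of the Webster scalar curvature by a constant factor. -/
theorem mul_scalar_eq_of_const [T2Space M] {c : ℝ}
    (p : S.ConformalPair θ θ' T T' D D' (fun _ => c)) (x : M) :
    c * p.webster'.scalar p.pseudohermitian' x = p.webster.scalar p.pseudohermitian x := by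
  have hg : ∀ y, p.grad.val y = 0 := fun y => p.pseudohermitian.levi_eq_zero fun w => by
    rw [p.levi_grad, mvfderiv_const]
    simp
  have hg' : p.grad = p.grad - p.grad := by
    ext1 y
    rw [HorizontalField.sub_val, hg, sub_zero]
  have hn : p.webster.nabla p.grad x = 0 := by
    rw [hg', IsTanakaWebster.nabla_sub, sub_self]
  have := p.mul_scalar_eq x
  rw [hg, IsTanakaWebster.horizontalDiv, hn] at this
  simpa using this

end ConformalPair

/-- The Webster scalar curvature computed from any Tanaka-Webster connection. -/
theorem IsTanakaWebster.websterScalar_eq [T2Space M]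
    {T : ∀ x : M, TangentSpace (𝓡 (2 * n + 1)) x}
    {D : CovariantDerivative (𝓡 (2 * n + 1)) (EuclideanSpace ℝ (Fin (2 * n + 1)))
      (TangentSpace (𝓡 (2 * n + 1)) : M → Type _)}
    (hD : S.IsTanakaWebster θ T D) (hθ : S.IsPseudohermitian θ) (hT : IsReebField θ T) (x : M) :
    S.websterScalar θ x = hD.scalar hθ x := by
  have hex : ∃ r, S.IsWebsterScalarAt θ x r :=
    ⟨_, hD.isWebsterScalarAt hT hθ (exists_isUnitaryAt hθ x).choose_spec⟩
  rw [websterScalar, dif_pos hex]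
  obtain ⟨T', D', hT', hD', h⟩ := hex.choose_spec
  rw [h _ (exists_isUnitaryAt hθ x).choose_spec]
  have p : S.ConformalPair θ θ T T' D D' (fun _ => 1) :=
    ⟨hθ, hθ, hT, hT', hD, hD', fun _ => one_pos, fun x => (one_smul ℝ _).symm⟩
  change hD'.scalar hθ x = _
  simpa using p.mul_scalar_eq_of_const x

end CRStructure

end CR

end CRGeometry

end


noncomputable section

namespace CRGeometry

section Pullback

variable {E : Type*} [NormedAddCommGroup E] [NormedSpace ℝ E]
  {H : Type*} [TopologicalSpace H] {I : ModelWithCorners ℝ E H}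
  {M : Type*} [TopologicalSpace M] [ChartedSpace H M] [IsManifold I ∞ M]
  (ψ : Diffeomorph I I M M ∞)

omit [IsManifold I ∞ M] in
theorem isInvertible_mfderiv (x : M) : (mfderiv I I ψ x).IsInvertible :=
  ⟨ψ.mfderivToContinuousLinearEquiv (by simp) x, rfl⟩

omit [IsManifold I ∞ M] in
theorem mfderiv_mpullback (Y : ∀ x : M, TangentSpace I x) (x : M) :
    mfderiv I I ψ x (mpullback I I ψ Y x) = Y (ψ x) := by
  rw [mpullback_apply, (isInvertible_mfderiv ψ x).self_apply_inverse]

omit [IsManifold I ∞ M] in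
theorem mpullback_eq_of_mfderiv_eq {Y : ∀ x : M, TangentSpace I x} {x : M} {v : TangentSpace I x}
    (h : mfderiv I I ψ x v = Y (ψ x)) : mpullback I I ψ Y x = v := by
  rw [mpullback_apply, ← h, (isInvertible_mfderiv ψ x).inverse_apply_self]

omit [IsManifold I ∞ M] in
theorem mpullback_mpullback_symm (X : ∀ x : M, TangentSpace I x) :
    mpullback I I ψ (mpullback I I ψ.symm X) = X := by
  ext x
  have h := mpullbackWithin_comp_of_left (I := I) (I' := I) (I'' := I) (g := ψ.symm) (f := ψ)
    (V := X) (s := univ) (t := univ) (x₀ := x)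
    (ψ.mdifferentiable (by simp) _).mdifferentiableWithinAt (mapsTo_univ _ _)
    (uniqueMDiffWithinAt_univ I) (by
      rw [mfderivWithin_univ]
      exact isInvertible_mfderiv ψ.symm _)
  simp only [mpullbackWithin_univ] at h
  have e : (ψ.symm ∘ ψ : M → M) = id := funext ψ.symm_apply_apply
  rw [← h, e]
  simp

omit [IsManifold I ∞ M] in
theorem mpullback_symm_mpullback (X : ∀ x : M, TangentSpace I x) :
    mpullback I I ψ.symm (mpullback I I ψ X) = X :=
  mpullback_mpullback_symm ψ.symm X

theorem IsSmoothField.mpullback [CompleteSpace E] {X : ∀ x : M, TangentSpace I x}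
    (hX : IsSmoothField I X) :
    IsSmoothField I (mpullback I I ψ X) :=
  ContMDiff.mpullback_vectorField (n := ∞) (m := ∞) hX ψ.contMDiff (isInvertible_mfderiv ψ)
    (by simp)

omit [IsManifold I ∞ M] in
theorem mvfderiv_comp_mpullback {f : M → ℝ} {x : M} (hf : MDifferentiableAt I 𝓘(ℝ, ℝ) f (ψ x))
    (X : ∀ x : M, TangentSpace I x) :
    mvfderiv I (fun y => f (ψ y)) x (mpullback I I ψ X x) = mvfderiv I f (ψ x) (X (ψ x)) := by
  rw [← mfderiv_mpullback ψ X x]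
  exact mvfderiv_comp_apply x hf (ψ.mdifferentiable (by simp) x) _

/-- The pullback of a connection on the tangent bundle by a diffeomorphism. -/
def pullbackConnection [CompleteSpace E]
    (D : CovariantDerivative I E (TangentSpace I : M → Type _)) :
    CovariantDerivative I E (TangentSpace I : M → Type _) where
  toFun X x := (mfderiv I I ψ x).inverse ∘L D (mpullback I I ψ.symm X) (ψ x) ∘L mfderiv I I ψ x
  isCovariantDerivativeOnUniv :=
    have key : ∀ {X : ∀ x : M, TangentSpace I x} {x : M},
        MDifferentiableAt I I.tangent (fun y => (⟨y, X y⟩ : TangentBundle I M)) x →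
        MDifferentiableAt I I.tangent
          (fun y => (⟨y, mpullback I I ψ.symm X y⟩ : TangentBundle I M)) (ψ x) := by
      intro X x hX
      refine MDifferentiableAt.mpullback_vectorField (n := ∞) ?_ ψ.symm.contMDiff.contMDiffAt
        (isInvertible_mfderiv ψ.symm _) (by exact WithTop.coe_le_coe.2 le_top)
      rwa [ψ.symm_apply_apply]
    { add := by
        intro X X' x hX hX' _
        rw [mpullback_add, D.isCovariantDerivativeOn.add (key hX) (key hX') (mem_univ _)]
        ext v
        simp
      leibniz := by
        intro X g x hX hg _
        have hg' : MDifferentiableAt I 𝓘(ℝ, ℝ) (g ∘ ψ.symm) (ψ x) :=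
          MDifferentiableAt.comp (ψ x) (by rwa [ψ.symm_apply_apply])
            (ψ.symm.mdifferentiable (by simp) _)
        have e2 : mpullback I I ψ (mpullback I I ψ.symm X) x = X x := by
          rw [mpullback_mpullback_symm]
        rw [mpullback_apply] at e2
        ext v
        have e3 : mvfderiv I (g ∘ ψ.symm) (ψ x) (mfderiv I I ψ x v) = mvfderiv I g x v := by
          rw [← mvfderiv_comp_apply x hg' (ψ.mdifferentiable (by simp) x)]
          congr 2
          ext y
          simp
        rw [mpullback_smul, D.isCovariantDerivativeOn.leibniz (key hX) hg' (mem_univ _)]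
        simp [e2, e3] }

theorem pullbackConnection_apply [CompleteSpace E]
    (D : CovariantDerivative I E (TangentSpace I : M → Type _)) (X : ∀ x : M, TangentSpace I x)
    (x : M) (v : TangentSpace I x) : pullbackConnection ψ D (mpullback I I ψ X) x v =
      (mfderiv I I ψ x).inverse (D X (ψ x) (mfderiv I I ψ x v)) := by
  change (mfderiv I I ψ x).inverse (D (mpullback I I ψ.symm (mpullback I I ψ X)) (ψ x)
    (mfderiv I I ψ x v)) = _
  rw [mpullback_symm_mpullback]

theorem pullbackConnection_mpullback [CompleteSpace E]
    (D : CovariantDerivative I E (TangentSpace I : M → Type _)) (X Y : ∀ x : M, TangentSpace I x) :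
    (fun x => pullbackConnection ψ D (mpullback I I ψ X) x (mpullback I I ψ Y x)) =
      mpullback I I ψ (fun x => D X x (Y x)) := by
  ext x
  rw [pullbackConnection_apply, mfderiv_mpullback, mpullback_apply]

theorem mlieBracket_mpullback [CompleteSpace E] {X Y : ∀ x : M, TangentSpace I x}
    (hX : IsSmoothField I X) (hY : IsSmoothField I Y) :
    mlieBracket I (mpullback I I ψ X) (mpullback I I ψ Y) =
      mpullback I I ψ (mlieBracket I X Y) := by
  have : IsManifold I (minSmoothness ℝ 3) M := IsManifold.of_le (n := ∞) minSmoothness_three_le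
  have : IsManifold I (minSmoothness ℝ 2) M := IsManifold.of_le (n := ∞) minSmoothness_two_le
  ext x
  exact (mpullback_mlieBracket (n := ∞) (hX.mdifferentiableAt _) (hY.mdifferentiableAt _)
    ψ.contMDiff.contMDiffAt minSmoothness_two_le).symm

theorem curvature_pullbackConnection [CompleteSpace E]
    (D : CovariantDerivative I E (TangentSpace I : M → Type _)) {X Y : ∀ x : M, TangentSpace I x}
    (hX : IsSmoothField I X) (hY : IsSmoothField I Y) (Z : ∀ x : M, TangentSpace I x) :
    curvature (pullbackConnection ψ D) (mpullback I I ψ X) (mpullback I I ψ Y)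
      (mpullback I I ψ Z) = mpullback I I ψ (curvature D X Y Z) := by
  ext x
  simp only [curvature, pullbackConnection_mpullback, mlieBracket_mpullback ψ hX hY]
  simp only [pullbackConnection_apply, mfderiv_mpullback]
  simp only [mpullback_apply, curvature, map_sub]

theorem torsion_pullbackConnection [FiniteDimensional ℝ E] [T2Space M]
    (D : CovariantDerivative I E (TangentSpace I : M → Type _)) (x : M) (v w : TangentSpace I x) :
    (pullbackConnection ψ D).torsion x v w = (mfderiv I I ψ x).inverse
      (D.torsion (ψ x) (mfderiv I I ψ x v) (mfderiv I I ψ x w)) := by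
  obtain ⟨X, hX, hXv⟩ := exists_isSmoothField_apply_eq (mfderiv I I ψ x v)
  obtain ⟨Y, hY, hYw⟩ := exists_isSmoothField_apply_eq (mfderiv I I ψ x w)
  rw [← hXv, ← hYw, ← mpullback_eq_of_mfderiv_eq ψ hXv.symm, ← mpullback_eq_of_mfderiv_eq ψ hYw.symm,
    D.torsion_apply (hX.mdifferentiableAt _) (hY.mdifferentiableAt _),
    CovariantDerivative.torsion_apply _ ((hX.mpullback ψ).mdifferentiableAt x)
      ((hY.mpullback ψ).mdifferentiableAt x), pullbackConnection_apply, pullbackConnection_apply,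
    mfderiv_mpullback, mfderiv_mpullback, mlieBracket_mpullback ψ hX hY, map_sub, map_sub,
    mpullback_apply]

omit [IsManifold I ∞ M] in
theorem contMDiffAt_clm_of_apply {F : Type*} [NormedAddCommGroup F] [NormedSpace ℝ F]
    [FiniteDimensional ℝ F] {F' : Type*} [NormedAddCommGroup F'] [NormedSpace ℝ F']
    {f : M → F →L[ℝ] F'} {x : M} (h : ∀ v, ContMDiffAt I 𝓘(ℝ, F') ∞ (fun y => f y v) x) :
    ContMDiffAt I 𝓘(ℝ, F →L[ℝ] F') ∞ f x := by
  let d := Module.finrank ℝ F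
  have hd : d = Module.finrank ℝ (Fin d → ℝ) := (Module.finrank_fin_fun ℝ).symm
  let e₁ := ContinuousLinearEquiv.ofFinrankEq hd
  let e₂ := (e₁.arrowCongr (1 : F' ≃L[ℝ] F')).trans (ContinuousLinearEquiv.piRing (Fin d))
  have h1 : ContMDiffAt I 𝓘(ℝ, Fin d → F') ∞ (e₂ ∘ f) x := contMDiffAt_pi_space.2 fun i => h _
  have h2 := e₂.symm.contDiff.contMDiff.contMDiffAt.comp x h1
  rwa [← Function.comp_assoc, e₂.symm_comp_self] at h2

/-- A section of `End(TM)` is smooth if it maps smooth fields to smooth fields. -/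
theorem contMDiff_endomorphism [FiniteDimensional ℝ E] [T2Space M]
    {L : ∀ x : M, TangentSpace I x →L[ℝ] TangentSpace I x}
    (hL : ∀ X : ∀ x : M, TangentSpace I x, IsSmoothField I X → IsSmoothField I (fun x => L x (X x))) :
    ContMDiff I (I.prod 𝓘(ℝ, E →L[ℝ] E)) ∞ (fun x => (⟨x, L x⟩ : TotalSpace (E →L[ℝ] E)
      (fun x : M => TangentSpace I x →L[ℝ] TangentSpace I x))) := by
  intro x
  rw [contMDiffAt_hom_bundle]
  refine ⟨contMDiffAt_id, ?_⟩
  refine contMDiffAt_clm_of_apply fun e => ?_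
  let t := trivializationAt E (TangentSpace I : M → Type _) x
  obtain ⟨u, hu, hX⟩ : ∃ u ∈ 𝓝 x, ContMDiffOn I I.tangent ∞
      (fun y => (⟨y, extend E (t.symm x e) y⟩ : TangentBundle I M)) u :=
    exists_contMDiffOn_extend I E (t.symm x e)
  obtain ⟨Y, hY, h⟩ := exists_isSmoothField_eventuallyEq hu hX
  have hx := mem_baseSet_trivializationAt E (TangentSpace I : M → Type _) x
  have h1 := (contMDiffAt_section x).1 (hL Y hY x)
  refine h1.congr_of_eventuallyEq ?_
  filter_upwards [h, t.open_baseSet.mem_nhds hx] with y hy hyt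
  have h2 : Y y = t.symm y e := by
    rw [hy, extend]
    congr 1
    exact congrArg Prod.snd (t.apply_mk_symm hx e)
  rw [ContinuousLinearMap.inCoordinates_eq hyt hyt, h2]
  rfl

theorem ContMDiffCovariantDerivativeOn.pullbackConnection [FiniteDimensional ℝ E] [T2Space M]
    {D : CovariantDerivative I E (TangentSpace I : M → Type _)}
    (hD : ContMDiffCovariantDerivativeOn E ∞ D.toFun univ) :
    ContMDiffCovariantDerivativeOn E ∞ (pullbackConnection ψ D).toFun univ where
  contMDiff {X} hX := by
    have hX' : IsSmoothField I X := contMDiffOn_univ.1 (by simpa using hX)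
    refine contMDiffOn_univ.2 (contMDiff_endomorphism fun Y hY => ?_)
    rw [← mpullback_mpullback_symm ψ X, ← mpullback_mpullback_symm ψ Y]
    rw [pullbackConnection_mpullback]
    refine IsSmoothField.mpullback ψ ?_
    have h1 := hD.contMDiff (σ := mpullback I I ψ.symm X)
      (by simpa using (hX'.mpullback ψ.symm).contMDiffOn)
    exact (contMDiffOn_univ.1 h1).clm_bundle_apply (hY.mpullback ψ.symm)

theorem exteriorD_pullback [FiniteDimensional ℝ E] [T2Space M]
    {θ θ' : ∀ x : M, TangentSpace I x →L[ℝ] ℝ} (hθ : IsSmoothOneForm I θ)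
    (hθ' : IsSmoothOneForm I θ') (h : ∀ x v, θ' x v = θ (ψ x) (mfderiv I I ψ x v))
    (x : M) (v w : TangentSpace I x) :
    exteriorD I θ' x v w = exteriorD I θ (ψ x) (mfderiv I I ψ x v) (mfderiv I I ψ x w) := by
  obtain ⟨X, hX, hXv⟩ := exists_isSmoothField_apply_eq (mfderiv I I ψ x v)
  obtain ⟨Y, hY, hYw⟩ := exists_isSmoothField_apply_eq (mfderiv I I ψ x w)
  have : IsManifold I 2 M := IsManifold.of_le (n := ∞) (by exact WithTop.coe_le_coe.2 le_top)
  rw [← hXv, ← hYw, ← mpullback_eq_of_mfderiv_eq ψ hXv.symm, ← mpullback_eq_of_mfderiv_eq ψ hYw.symm,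
    exteriorD_apply_fields hθ (hX.mdifferentiableAt _) (hY.mdifferentiableAt _),
    exteriorD_apply_fields hθ' ((hX.mpullback ψ).mdifferentiableAt _)
      ((hY.mpullback ψ).mdifferentiableAt _)]
  simp only [exteriorDOnFields, h, mfderiv_mpullback, mlieBracket_mpullback ψ hX hY]
  rw [mvfderiv_comp_mpullback ψ ((hθ.contMDiff_apply hX).mdifferentiable (by simp) _),
    mvfderiv_comp_mpullback ψ ((hθ.contMDiff_apply hY).mdifferentiable (by simp) _)]

end Pullback

end CRGeometry

end


noncomputable section

namespace CRGeometry

section CR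

variable {n : ℕ} {M : Type*} [TopologicalSpace M]
  [ChartedSpace (EuclideanSpace ℝ (Fin (2 * n + 1))) M] [IsManifold (𝓡 (2 * n + 1)) ∞ M]

namespace CRStructure

open AlmostCRStructure

variable {S : CRStructure n M} {ψ : Diffeomorph (𝓡 (2 * n + 1)) (𝓡 (2 * n + 1)) M M ∞}

namespace IsCRDiffeomorphism

variable (hψ : S.IsCRDiffeomorphism ψ)
include hψ

theorem inverse_mfderiv_mem {x : M} (w : S.H (ψ x)) :
    (mfderiv (𝓡 (2 * n + 1)) (𝓡 (2 * n + 1)) ψ x).inverse w ∈ S.H x := by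
  let A := mfderiv (𝓡 (2 * n + 1)) (𝓡 (2 * n + 1)) ψ x
  let L : S.H x →ₗ[ℝ] S.H (ψ x) :=
    (A.toLinearMap ∘ₗ (S.H x).subtype).codRestrict (S.H (ψ x)) fun v => (hψ x v).choose
  have hinj : Function.Injective L := by
    intro v v' h
    exact Subtype.ext ((isInvertible_mfderiv ψ x).injective (congrArg Subtype.val h))
  have hsurj : Function.Surjective L :=
    (LinearMap.injective_iff_surjective_of_finrank_eq_finrank
      ((S.finrank_H x).trans (S.finrank_H (ψ x)).symm)).1 hinj
  obtain ⟨v, rfl⟩ := hsurj w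
  have : A.inverse (A v) = v := (isInvertible_mfderiv ψ x).inverse_apply_self _
  change A.inverse (A v) ∈ _
  rw [this]
  exact v.2

theorem J_inverse_mfderiv {x : M} (w : S.H (ψ x)) :
    (S.J x ⟨_, hψ.inverse_mfderiv_mem w⟩ : TangentSpace (𝓡 (2 * n + 1)) x) =
      (mfderiv (𝓡 (2 * n + 1)) (𝓡 (2 * n + 1)) ψ x).inverse (S.J (ψ x) w) := by
  obtain ⟨h1, h2⟩ := hψ x ⟨_, hψ.inverse_mfderiv_mem w⟩
  have h3 : (⟨_, h1⟩ : S.H (ψ x)) = w :=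
    Subtype.ext ((isInvertible_mfderiv ψ x).self_apply_inverse _)
  rw [h3] at h2
  rw [h2, (isInvertible_mfderiv ψ x).inverse_apply_self]

/-- The pullback of a horizontal field by a CR diffeomorphism. -/
def pullField (Z : S.HorizontalField) : S.HorizontalField :=
  HorizontalField.ofField (mpullback (𝓡 (2 * n + 1)) (𝓡 (2 * n + 1)) ψ Z.field)
    (Z.smooth_field.mpullback ψ) (fun x => hψ.inverse_mfderiv_mem (Z.val (ψ x)))

theorem pullField_field (Z : S.HorizontalField) : (hψ.pullField Z).field =
    mpullback (𝓡 (2 * n + 1)) (𝓡 (2 * n + 1)) ψ Z.field := rfl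

theorem pullField_J (Z : S.HorizontalField) : hψ.pullField Z.J = (hψ.pullField Z).J := by
  ext1 x
  exact Subtype.ext (hψ.J_inverse_mfderiv (Z.val (ψ x))).symm

theorem symm : S.IsCRDiffeomorphism ψ.symm := by
  have key : ∀ (Z : S.HorizontalField) (x : M),
      mfderiv (𝓡 (2 * n + 1)) (𝓡 (2 * n + 1)) ψ.symm x (Z.field x) =
        (hψ.pullField Z).field (ψ.symm x) := by
    intro Z x
    have h := mfderiv_mpullback ψ.symm (hψ.pullField Z).field x
    rwa [pullField_field, mpullback_symm_mpullback] at h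
  intro x v
  obtain ⟨Z, rfl⟩ := HorizontalField.exists_val_eq x v
  have h1 := key Z x
  have h2 := key Z.J x
  refine ⟨?_, ?_⟩
  · rw [← Z.field_apply, h1]
    exact (hψ.pullField Z).field_mem _
  · rw [pullField_J] at h2
    refine Eq.trans ?_ h2.symm
    exact congrArg (fun w : S.H (ψ.symm x) => (S.J (ψ.symm x) w).1)
      (show (⟨_, _⟩ : S.H (ψ.symm x)) = (hψ.pullField Z).val (ψ.symm x) from Subtype.ext h1)

theorem exists_pullField_eq (Z : S.HorizontalField) : ∃ Y, hψ.pullField Y = Z := by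
  refine ⟨hψ.symm.pullField Z, ?_⟩
  ext1 x
  apply Subtype.ext
  change mpullback (𝓡 (2 * n + 1)) (𝓡 (2 * n + 1)) ψ
    (mpullback (𝓡 (2 * n + 1)) (𝓡 (2 * n + 1)) ψ.symm Z.field) x = Z.field x
  rw [mpullback_mpullback_symm]

variable {θ θ' : OneForm (𝓡 (2 * n + 1)) (M := M)}

variable (hθ : S.IsPseudohermitian θ) (hθ' : S.IsPseudohermitian θ')
  (h : θ' = CRGeometry.pullback ψ θ)

include hθ hθ' h

omit hψ in
theorem exteriorD_eq [T2Space M] (x : M) (v w : TangentSpace (𝓡 (2 * n + 1)) x) :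
    exteriorD (𝓡 (2 * n + 1)) θ' x v w = exteriorD (𝓡 (2 * n + 1)) θ (ψ x)
      (mfderiv (𝓡 (2 * n + 1)) (𝓡 (2 * n + 1)) ψ x v)
      (mfderiv (𝓡 (2 * n + 1)) (𝓡 (2 * n + 1)) ψ x w) :=
  exteriorD_pullback ψ hθ.smooth hθ'.smooth (fun x v => by rw [h]; rfl) x v w

theorem leviForm_eq [T2Space M] (x : M) (v w : S.H (ψ x)) :
    S.leviForm θ' x ⟨_, hψ.inverse_mfderiv_mem v⟩ ⟨_, hψ.inverse_mfderiv_mem w⟩ =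
      S.leviForm θ (ψ x) v w := by
  rw [leviForm, hψ.J_inverse_mfderiv, exteriorD_eq hθ hθ' h,
    (isInvertible_mfderiv ψ x).self_apply_inverse, (isInvertible_mfderiv ψ x).self_apply_inverse]
  rfl

theorem leviForm_pullField [T2Space M] (x : M) (Y Z : S.HorizontalField) :
    S.leviForm θ' x ((hψ.pullField Y).val x) ((hψ.pullField Z).val x) =
      S.leviForm θ (ψ x) (Y.val (ψ x)) (Z.val (ψ x)) :=
  hψ.leviForm_eq hθ hθ' h x _ _

omit hψ in
theorem isReebField [T2Space M] {T : ∀ x : M, TangentSpace (𝓡 (2 * n + 1)) x}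
    (hT : IsReebField θ T) :
    IsReebField θ' (mpullback (𝓡 (2 * n + 1)) (𝓡 (2 * n + 1)) ψ T) where
  smooth := hT.smooth.mpullback ψ
  apply_eq_one x := by
    rw [← hT.apply_eq_one (ψ x), ← mfderiv_mpullback ψ T x, h]
    rfl
  exteriorD_eq_zero x v := by
    rw [exteriorD_eq hθ hθ' h, mfderiv_mpullback, hT.exteriorD_eq_zero]

omit hθ hθ' h in
theorem pullbackConnection_pullField {T : ∀ x : M, TangentSpace (𝓡 (2 * n + 1)) x}
    {D : CovariantDerivative (𝓡 (2 * n + 1)) (EuclideanSpace ℝ (Fin (2 * n + 1)))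
      (TangentSpace (𝓡 (2 * n + 1)) : M → Type _)} (hD : S.IsTanakaWebster θ T D)
    (Y : S.HorizontalField) (x : M) (v : TangentSpace (𝓡 (2 * n + 1)) x) :
    pullbackConnection ψ D (hψ.pullField Y).field x v =
        (mfderiv (𝓡 (2 * n + 1)) (𝓡 (2 * n + 1)) ψ x).inverse (hD.nabla Y (ψ x)
          (mfderiv (𝓡 (2 * n + 1)) (𝓡 (2 * n + 1)) ψ x v)) :=
  pullbackConnection_apply ψ D Y.field x v

omit hθ hθ' h in
theorem pullbackConnection_mem {T : ∀ x : M, TangentSpace (𝓡 (2 * n + 1)) x}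
    {D : CovariantDerivative (𝓡 (2 * n + 1)) (EuclideanSpace ℝ (Fin (2 * n + 1)))
      (TangentSpace (𝓡 (2 * n + 1)) : M → Type _)} (hD : S.IsTanakaWebster θ T D)
    (Y : S.HorizontalField) (x : M) (v : TangentSpace (𝓡 (2 * n + 1)) x) :
    pullbackConnection ψ D Y.field x v ∈ S.H x := by
  obtain ⟨Y, rfl⟩ := hψ.exists_pullField_eq Y
  rw [hψ.pullbackConnection_pullField hD]
  exact hψ.inverse_mfderiv_mem _

omit hθ hθ' h in
theorem pullbackConnection_J {T : ∀ x : M, TangentSpace (𝓡 (2 * n + 1)) x}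
    {D : CovariantDerivative (𝓡 (2 * n + 1)) (EuclideanSpace ℝ (Fin (2 * n + 1)))
      (TangentSpace (𝓡 (2 * n + 1)) : M → Type _)} (hD : S.IsTanakaWebster θ T D)
    (Y : S.HorizontalField) (x : M) (v : TangentSpace (𝓡 (2 * n + 1)) x) :
    pullbackConnection ψ D Y.J.field x v =
      S.J x ⟨_, hψ.pullbackConnection_mem hD Y x v⟩ := by
  obtain ⟨Y, rfl⟩ := hψ.exists_pullField_eq Y
  have h1 : (⟨_, hψ.pullbackConnection_mem hD (hψ.pullField Y) x v⟩ : S.H x) =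
      ⟨_, hψ.inverse_mfderiv_mem (hD.nabla Y (ψ x)
        (mfderiv (𝓡 (2 * n + 1)) (𝓡 (2 * n + 1)) ψ x v))⟩ :=
    Subtype.ext (hψ.pullbackConnection_pullField hD Y x v)
  rw [h1, hψ.J_inverse_mfderiv, ← pullField_J, hψ.pullbackConnection_pullField hD, hD.nabla_J]

theorem mvfderiv_leviForm [T2Space M] {T : ∀ x : M, TangentSpace (𝓡 (2 * n + 1)) x}
    {D : CovariantDerivative (𝓡 (2 * n + 1)) (EuclideanSpace ℝ (Fin (2 * n + 1)))
      (TangentSpace (𝓡 (2 * n + 1)) : M → Type _)} (hD : S.IsTanakaWebster θ T D)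
    (Y Z : S.HorizontalField) (x : M) (v : TangentSpace (𝓡 (2 * n + 1)) x) :
    mvfderiv (𝓡 (2 * n + 1)) (fun y => S.leviForm θ' y (Y.val y) (Z.val y)) x v =
      S.leviForm θ' x ⟨_, hψ.pullbackConnection_mem hD Y x v⟩ (Z.val x)
        + S.leviForm θ' x (Y.val x) ⟨_, hψ.pullbackConnection_mem hD Z x v⟩ := by
  obtain ⟨Y, rfl⟩ := hψ.exists_pullField_eq Y
  obtain ⟨Z, rfl⟩ := hψ.exists_pullField_eq Z
  have h0 : ∀ Y : S.HorizontalField,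
      (⟨_, hψ.pullbackConnection_mem hD (hψ.pullField Y) x v⟩ : S.H x) =
      ⟨_, hψ.inverse_mfderiv_mem (hD.nabla Y (ψ x)
        (mfderiv (𝓡 (2 * n + 1)) (𝓡 (2 * n + 1)) ψ x v))⟩ := fun Y =>
    Subtype.ext (hψ.pullbackConnection_pullField hD Y x v)
  rw [h0, h0]
  have h1 := hD.mvfderiv_levi hθ Y Z (ψ x) (mfderiv (𝓡 (2 * n + 1)) (𝓡 (2 * n + 1)) ψ x v)
  have h2 := mvfderiv_comp_apply x
    ((hθ.contMDiff_levi Y Z).mdifferentiable (by simp) (ψ x))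
    (ψ.mdifferentiable (by simp) x) v
  have h3 : (fun y => S.leviForm θ' y ((hψ.pullField Y).val y) ((hψ.pullField Z).val y)) =
      (fun y => hθ.levi y (Y.val y) (Z.val y)) ∘ ψ :=
    funext fun y => hψ.leviForm_pullField hθ hθ' h y Y Z
  rw [h3]
  refine h2.trans (h1.trans ?_)
  exact congrArg₂ (· + ·) (hψ.leviForm_eq hθ hθ' h x _ (Z.val (ψ x))).symm
    (hψ.leviForm_eq hθ hθ' h x (Y.val (ψ x)) _).symm

omit hθ hθ' h in
theorem torsion_pullback_reeb [T2Space M] {T : ∀ x : M, TangentSpace (𝓡 (2 * n + 1)) x}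
    {D : CovariantDerivative (𝓡 (2 * n + 1)) (EuclideanSpace ℝ (Fin (2 * n + 1)))
      (TangentSpace (𝓡 (2 * n + 1)) : M → Type _)} (hD : S.IsTanakaWebster θ T D)
    (x : M) (v : S.H x) :
    ∃ h : (pullbackConnection ψ D).torsion x
          (mpullback (𝓡 (2 * n + 1)) (𝓡 (2 * n + 1)) ψ T x) v ∈ S.H x,
      (pullbackConnection ψ D).torsion x
          (mpullback (𝓡 (2 * n + 1)) (𝓡 (2 * n + 1)) ψ T x) (S.J x v) =
        -(S.J x ⟨_, h⟩ : S.H x) := by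
  obtain ⟨h1, h2⟩ := hψ x v
  obtain ⟨h3, h4⟩ := hD.torsion_reeb (ψ x) ⟨_, h1⟩
  have h5 : (pullbackConnection ψ D).torsion x
      (mpullback (𝓡 (2 * n + 1)) (𝓡 (2 * n + 1)) ψ T x) v =
      (mfderiv (𝓡 (2 * n + 1)) (𝓡 (2 * n + 1)) ψ x).inverse (D.torsion (ψ x) (T (ψ x))
        (mfderiv (𝓡 (2 * n + 1)) (𝓡 (2 * n + 1)) ψ x v)) := by
    rw [torsion_pullbackConnection, mfderiv_mpullback]
  have h6 := hψ.inverse_mfderiv_mem ⟨_, h3⟩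
  have h7 : (pullbackConnection ψ D).torsion x
      (mpullback (𝓡 (2 * n + 1)) (𝓡 (2 * n + 1)) ψ T x) v ∈ S.H x := by
    rw [h5]
    exact h6
  have h8 : (⟨_, h7⟩ : S.H x) = ⟨_, h6⟩ := Subtype.ext h5
  refine ⟨h7, ?_⟩
  rw [h8, hψ.J_inverse_mfderiv ⟨_, h3⟩, torsion_pullbackConnection, mfderiv_mpullback, ← h2, h4,
    map_neg]

theorem isTanakaWebster [T2Space M] {T : ∀ x : M, TangentSpace (𝓡 (2 * n + 1)) x}
    {D : CovariantDerivative (𝓡 (2 * n + 1)) (EuclideanSpace ℝ (Fin (2 * n + 1)))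
      (TangentSpace (𝓡 (2 * n + 1)) : M → Type _)} (hD : S.IsTanakaWebster θ T D) :
    S.IsTanakaWebster θ' (mpullback (𝓡 (2 * n + 1)) (𝓡 (2 * n + 1)) ψ T)
      (pullbackConnection ψ D) where
  smooth := ContMDiffCovariantDerivativeOn.pullbackConnection ψ hD.smooth
  horizontal := hψ.pullbackConnection_mem hD
  parallel_J := hψ.pullbackConnection_J hD
  parallel_reeb x v := by rw [pullbackConnection_apply, hD.parallel_reeb, map_zero]
  parallel_levi := hψ.mvfderiv_leviForm hθ hθ' h hD
  torsion_horizontal x v w := by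
    rw [torsion_pullbackConnection, exteriorD_eq hθ hθ' h]
    have := hD.torsion_horizontal (ψ x) ⟨_, (hψ x v).choose⟩ ⟨_, (hψ x w).choose⟩
    rw [this, map_smul, mpullback_apply]
  torsion_reeb := hψ.torsion_pullback_reeb hD

theorem scalar_eq [T2Space M] {T : ∀ x : M, TangentSpace (𝓡 (2 * n + 1)) x}
    {D : CovariantDerivative (𝓡 (2 * n + 1)) (EuclideanSpace ℝ (Fin (2 * n + 1)))
      (TangentSpace (𝓡 (2 * n + 1)) : M → Type _)} (hD : S.IsTanakaWebster θ T D) (x : M) :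
    (hψ.isTanakaWebster hθ hθ' h hD).scalar hθ' x = hD.scalar hθ (ψ x) := by
  obtain ⟨e, he⟩ := IsTanakaWebster.exists_isUnitaryAt hθ (ψ x)
  have he' : S.IsUnitaryAt θ' x (fun a => hψ.pullField (e a)) := by
    intro a b
    rw [← pullField_J, hψ.leviForm_pullField hθ hθ' h, hψ.leviForm_pullField hθ hθ' h]
    exact he a b
  rw [hD.scalar_eq hθ he, IsTanakaWebster.scalar_eq _ hθ' he']
  refine Finset.sum_congr rfl fun a _ => Finset.sum_congr rfl fun b _ => ?_
  rw [← pullField_J, ← pullField_J, pullField_field, pullField_field, pullField_field,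
    curvature_pullbackConnection ψ D (e a).smooth_field (e a).J.smooth_field,
    exteriorD_eq hθ hθ' h, mfderiv_mpullback, mfderiv_mpullback]

end IsCRDiffeomorphism

section Scaling

variable {θ θ' : OneForm (𝓡 (2 * n + 1)) (M := M)} {T : ∀ x : M, TangentSpace (𝓡 (2 * n + 1)) x}
  {D : CovariantDerivative (𝓡 (2 * n + 1)) (EuclideanSpace ℝ (Fin (2 * n + 1)))
    (TangentSpace (𝓡 (2 * n + 1)) : M → Type _)}

theorem exteriorD_const_smul {c : ℝ} (hθ : IsSmoothOneForm (𝓡 (2 * n + 1)) θ)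
    (h : ∀ x, θ' x = c • θ x) (x : M)
    (v w : TangentSpace (𝓡 (2 * n + 1)) x) :
    exteriorD (𝓡 (2 * n + 1)) θ' x v w = c * exteriorD (𝓡 (2 * n + 1)) θ x v w := by
  have key : ∀ v w : TangentSpace (𝓡 (2 * n + 1)) x, mvfderiv (𝓡 (2 * n + 1))
      (fun y => θ' y (extend (EuclideanSpace ℝ (Fin (2 * n + 1))) v y)) x w =
      c * mvfderiv (𝓡 (2 * n + 1))
      (fun y => θ y (extend (EuclideanSpace ℝ (Fin (2 * n + 1))) v y)) x w := by
    intro v w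
    have e : (fun y => θ' y (extend (EuclideanSpace ℝ (Fin (2 * n + 1))) v y)) =
        fun y => (fun _ : M => c) y * θ y (extend (EuclideanSpace ℝ (Fin (2 * n + 1))) v y) := by
      ext y
      rw [h]
      rfl
    rw [e, mvfderiv_fun_mul mdifferentiableAt_const
      (mdifferentiableAt_oneForm_apply hθ (mdifferentiableAt_extend ..)), mvfderiv_const]
    simp
  simp only [exteriorD, exteriorDOnFields, key]
  rw [h]
  simp only [smul_apply, smul_eq_mul]
  ring

theorem _root_.CRGeometry.IsReebField.const_smul {c : ℝ} (hc : c ≠ 0) (hT : IsReebField θ T)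
    (hθ : IsSmoothOneForm (𝓡 (2 * n + 1)) θ) (h : ∀ x, θ' x = c • θ x) :
    IsReebField θ' (c⁻¹ • T) where
  smooth := hT.smooth.const_smul _
  apply_eq_one x := by
    rw [h, Pi.smul_apply, smul_apply, map_smul, hT.apply_eq_one]
    simp [hc]
  exteriorD_eq_zero x v := by
    rw [exteriorD_const_smul hθ h, Pi.smul_apply, ← exteriorDHom_apply hθ, map_smul,
      smul_apply, exteriorDHom_apply, hT.exteriorD_eq_zero, smul_zero, mul_zero]

theorem IsPseudohermitian.const_smul {c : ℝ} (hc : 0 < c) (hθ : S.IsPseudohermitian θ)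
    (h : ∀ x, θ' x = c • θ x) : S.IsPseudohermitian θ' where
  smooth := by
    have : θ' = c • θ := funext h
    rw [this]
    exact ContMDiff.const_smul_section hθ.smooth
  ker_eq x v := by
    rw [h, ← hθ.ker_eq x v, smul_apply, smul_eq_mul]
    simp [hc.ne']
  levi_pos x v hv := by
    rw [leviForm, exteriorD_const_smul hθ.smooth h]
    exact mul_pos hc (hθ.levi_pos x v hv)

theorem IsTanakaWebster.const_smul {c : ℝ} (hc : c ≠ 0) (hD : S.IsTanakaWebster θ T D)
    (hT : IsReebField θ T) (hθ : S.IsPseudohermitian θ) (h : ∀ x, θ' x = c • θ x) :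
    S.IsTanakaWebster θ' (c⁻¹ • T) D where
  smooth := hD.smooth
  horizontal := hD.horizontal
  parallel_J := hD.parallel_J
  parallel_reeb x v := by
    have h1 := D.isCovariantDerivativeOn.leibniz (g := fun _ => c⁻¹)
      (hT.smooth.mdifferentiableAt x) mdifferentiableAt_const (mem_univ x)
    have h2 : (fun _ : M => c⁻¹) • T = c⁻¹ • T := rfl
    rw [h2, mvfderiv_const] at h1
    rw [h1]
    simp [hD.parallel_reeb]
  parallel_levi Y Z x v := by
    have h1 : ∀ (y : M) (v w : S.H y), S.leviForm θ' y v w = c * S.leviForm θ y v w :=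
      fun y v w => exteriorD_const_smul hθ.smooth h y _ _
    have h2 : (fun y => S.leviForm θ' y (Y.val y) (Z.val y)) =
        fun y => (fun _ : M => c) y * hθ.levi y (Y.val y) (Z.val y) := funext fun y => h1 y _ _
    rw [h1, h1, ← mul_add, ← hD.parallel_levi, h2, mvfderiv_fun_mul mdifferentiableAt_const
      ((hθ.contMDiff_levi Y Z).mdifferentiable (by simp) x), mvfderiv_const]
    simp [hθ.levi_apply]
  torsion_horizontal x v w := by
    rw [hD.torsion_horizontal, exteriorD_const_smul hθ.smooth h, Pi.smul_apply, smul_smul,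
      mul_right_comm, mul_inv_cancel₀ hc, one_mul]
  torsion_reeb x v := by
    obtain ⟨h1, h2⟩ := hD.torsion_reeb x v
    have h3 : D.torsion x ((c⁻¹ • T) x) v = c⁻¹ • D.torsion x (T x) v := by
      rw [Pi.smul_apply, map_smul, smul_apply]
    have h4 : D.torsion x ((c⁻¹ • T) x) v ∈ S.H x := by
      rw [h3]
      exact (S.H x).smul_mem _ h1
    have h5 : (⟨_, h4⟩ : S.H x) = c⁻¹ • ⟨_, h1⟩ := Subtype.ext h3
    refine ⟨h4, ?_⟩
    rw [h5, Pi.smul_apply, map_smul, smul_apply, h2, map_smul, Submodule.coe_smul, smul_neg]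

end Scaling

/-- The Webster scalar curvature of `c ψ^*θ` for a CR diffeomorphism `ψ`. -/
theorem IsCRDiffeomorphism.exists_isTanakaWebster [T2Space M]
    {θ θ' : OneForm (𝓡 (2 * n + 1)) (M := M)} (hψ : S.IsCRDiffeomorphism ψ)
    (hθ : S.IsPseudohermitian θ) (hθ' : S.IsPseudohermitian θ') {c : ℝ} (hc : 0 < c)
    (h : ∀ x, θ' x = c • CRGeometry.pullback ψ θ x)
    {T : ∀ x : M, TangentSpace (𝓡 (2 * n + 1)) x}
    {D : CovariantDerivative (𝓡 (2 * n + 1)) (EuclideanSpace ℝ (Fin (2 * n + 1)))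
      (TangentSpace (𝓡 (2 * n + 1)) : M → Type _)} (hT : IsReebField θ T)
    (hD : S.IsTanakaWebster θ T D) :
    ∃ T' D', IsReebField θ' T' ∧ S.IsTanakaWebster θ' T' D' ∧
      ∀ x, c * S.websterScalar θ' x = S.websterScalar θ (ψ x) := by
  have h1 : ∀ x, CRGeometry.pullback ψ θ x = c⁻¹ • θ' x := fun x => by
    rw [h, smul_smul, inv_mul_cancel₀ hc.ne', one_smul]
  have h2 : S.IsPseudohermitian (CRGeometry.pullback ψ θ) := hθ'.const_smul (inv_pos.2 hc) h1
  have hT1 := isReebField hθ h2 rfl hT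
  have hD1 := hψ.isTanakaWebster hθ h2 rfl hD
  have hT2 := hT1.const_smul hc.ne' h2.smooth h
  have hD2 := hD1.const_smul hc.ne' hT1 h2 h
  refine ⟨_, _, hT2, hD2, fun x => ?_⟩
  have p : S.ConformalPair _ θ' _ _ _ _ (fun _ => c) :=
    ⟨h2, hθ', hT1, hT2, hD1, hD2, fun _ => hc, h⟩
  rw [hD2.websterScalar_eq hθ' hT2, hD.websterScalar_eq hθ hT, p.mul_scalar_eq_of_const x,
    hψ.scalar_eq hθ h2 rfl hD]

end CRStructure

end CR

end CRGeometry

end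


noncomputable section

namespace CRGeometry

open scoped Matrix

section Determinant

variable {ι : Type*} [Fintype ι] [DecidableEq ι]

theorem sum_det_updateRow {h b : Matrix ι ι ℝ} :
    ∑ i, (h.updateRow i ((b * h) i)).det = b.trace * h.det := by
  rw [Matrix.trace, Finset.sum_mul]
  refine Finset.sum_congr rfl fun i _ => ?_
  have h1 : (b * h) i = ∑ k, b i k • h k := by
    ext j
    simp [Matrix.mul_apply]
  rw [h1, Matrix.det_updateRow_sum]
  rfl

variable {E : Type*} [NormedAddCommGroup E] [NormedSpace ℝ E]
  {H : Type*} [TopologicalSpace H] {I : ModelWithCorners ℝ E H}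
  {M : Type*} [TopologicalSpace M] [ChartedSpace H M]

theorem mvfderiv_comp_eq {F : Type*} [NormedAddCommGroup F] [NormedSpace ℝ F] {f : F → ℝ}
    {f' : F →L[ℝ] ℝ} {h : M → F} {x : M} (hf : HasFDerivAt f f' (h x))
    (hh : MDifferentiableAt I 𝓘(ℝ, F) h x) (v : TangentSpace I x) :
    mvfderiv I (fun y => f (h y)) x v = f' (mvfderiv I h x v) := by
  have h1 := hf.hasMFDerivAt
  have h2 := h1.comp x hh.hasMFDerivAt
  have h3 := h2.mfderiv
  have h4 := congrArg (fun L => L v) h3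
  exact h4

/-- The derivative of a determinant along a vector for which the matrix satisfies
`h' = b h + h bᵀ`. -/
theorem mvfderiv_det {h : M → Matrix ι ι ℝ} {x : M}
    (hd : ∀ i j, ContMDiffAt I 𝓘(ℝ, ℝ) ∞ (fun y => h y i j) x) (v : TangentSpace I x)
    {b : Matrix ι ι ℝ} (hb : ∀ i j, mvfderiv I (fun y => h y i j) x v = (b * h x + h x * bᵀ) i j)
    (hdet : (h x).det ≠ 0) :
    mvfderiv I (fun y => (h y).det) x v = 2 * b.trace * (h x).det := by
  let F : ContinuousMultilinearMap ℝ (fun _ : ι => ι → ℝ) ℝ :=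
    ⟨(Matrix.detRowAlternating (n := ι) (R := ℝ)).toMultilinearMap, continuous_id.matrix_det⟩
  let g : M → ι → ι → ℝ := h
  have hg : MDifferentiableAt I 𝓘(ℝ, ι → ι → ℝ) g x :=
    (contMDiffAt_pi_space.2 fun i => contMDiffAt_pi_space.2 fun j => hd i j).mdifferentiableAt
      (by simp)
  have h1 := mvfderiv_comp_eq (F.hasFDerivAt (g x)) hg v
  have h2 : ∀ i j, mvfderiv I g x v i j = (b * h x + h x * bᵀ) i j := by
    intro i j
    rw [← hb i j]
    let P : (ι → ι → ℝ) →L[ℝ] ℝ := (ContinuousLinearMap.proj (R := ℝ) (φ := fun _ : ι => ℝ) j).comp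
      (ContinuousLinearMap.proj (R := ℝ) (φ := fun _ : ι => ι → ℝ) i)
    exact (mvfderiv_comp_eq (P.hasFDerivAt (x := g x)) hg v).symm
  have h3 : b * h x + h x * bᵀ = (b + h x * bᵀ * (h x)⁻¹) * h x := by
    rw [add_mul, Matrix.mul_assoc (h x * bᵀ), Matrix.nonsing_inv_mul _ (isUnit_iff_ne_zero.2 hdet),
      Matrix.mul_one]
  have h4 : (b + h x * bᵀ * (h x)⁻¹).trace = 2 * b.trace := by
    rw [Matrix.trace_add, Matrix.trace_mul_cycle, Matrix.nonsing_inv_mul _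
      (isUnit_iff_ne_zero.2 hdet), Matrix.one_mul, Matrix.trace_transpose, two_mul]
  rw [← h4, ← sum_det_updateRow, ← h3]
  refine h1.trans ?_
  rw [ContinuousMultilinearMap.linearDeriv_apply]
  refine Finset.sum_congr rfl fun i _ => ?_
  have h5 : mvfderiv I g x v i = (b * h x + h x * bᵀ) i := funext (h2 i)
  rw [h5]
  rfl

theorem mvfderiv_sqrt_abs {d : M → ℝ} {x : M} (hd : MDifferentiableAt I 𝓘(ℝ, ℝ) d x)
    (hdx : d x ≠ 0) (v : TangentSpace I x) {c : ℝ} (hc : mvfderiv I d x v = 2 * c * d x) :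
    mvfderiv I (fun y => √|d y|) x v = c * √|d x| := by
  have h1 := ((hasDerivAt_abs hdx).sqrt (abs_pos.2 hdx).ne').hasFDerivAt
  rw [mvfderiv_comp_eq h1 hd v, hc]
  have h2 : √|d x| ≠ 0 := (Real.sqrt_pos.2 (abs_pos.2 hdx)).ne'
  have h3 : (SignType.sign (d x) : ℝ) * d x = √|d x| * √|d x| := by
    rw [Real.mul_self_sqrt (abs_nonneg _), sign_mul_self]
  simp only [ContinuousLinearMap.toSpanSingleton_apply, smul_eq_mul]
  field_simp
  linear_combination c * h3

end Determinant

section Density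

variable {V V' E : Type*} [AddCommGroup V] [Module ℝ V] [AddCommGroup V'] [Module ℝ V']
  [AddCommGroup E] [Module ℝ E] [FiniteDimensional ℝ E]

/-- The density of a bilinear form on `V` in a linear chart `V ≃ E`. -/
def formDensity (β : LinearMap.BilinForm ℝ V) (A : E →ₗ[ℝ] V) : ℝ :=
  √|(Matrix.of fun i j => β (A (Module.finBasis ℝ E i)) (A (Module.finBasis ℝ E j))).det|

theorem formDensity_eq {β : LinearMap.BilinForm ℝ V} {β' : LinearMap.BilinForm ℝ V'}
    {A : E →ₗ[ℝ] V} {A' : E →ₗ[ℝ] V'} {L : E →ₗ[ℝ] E}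
    (h : ∀ v w, β (A v) (A w) = β' (A' (L v)) (A' (L w))) :
    formDensity β A = |LinearMap.det L| * formDensity β' A' := by
  let b := Module.finBasis ℝ E
  have h1 : (Matrix.of fun i j => β (A (b i)) (A (b j))) =
      LinearMap.BilinForm.toMatrix b ((β'.comp A' A').comp L L) := by
    ext i j
    simp [LinearMap.BilinForm.toMatrix_apply, h]
  have h2 : (Matrix.of fun i j => β' (A' (b i)) (A' (b j))) =
      LinearMap.BilinForm.toMatrix b (β'.comp A' A') := by
    ext i j
    simp [LinearMap.BilinForm.toMatrix_apply]
  rw [formDensity, formDensity, h1, h2, LinearMap.BilinForm.toMatrix_comp b b, Matrix.det_mul,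
    Matrix.det_mul, Matrix.det_transpose, LinearMap.det_toMatrix b, mul_right_comm, abs_mul,
    abs_mul, Real.sqrt_mul (by positivity), Real.sqrt_mul_self (abs_nonneg _)]

theorem det_formMatrix_ne_zero {β : LinearMap.BilinForm ℝ V} {A : E ≃ₗ[ℝ] V}
    (h : ∀ v, (∀ w, β v w = 0) → v = 0) :
    (Matrix.of fun i j => β (A (Module.finBasis ℝ E i)) (A (Module.finBasis ℝ E j))).det ≠ 0 := by
  let b := Module.finBasis ℝ E
  have h1 : (Matrix.of fun i j => β (A (b i)) (A (b j))) =
      LinearMap.toMatrix₂ (b.map A) (b.map A) β := by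
    ext i j
    simp [LinearMap.toMatrix₂_apply]
  rw [h1, ← LinearMap.separatingLeft_iff_det_ne_zero]
  exact h

/-- The trace of an endomorphism in a linear chart. -/
theorem trace_eq_sum_chart (A : E ≃ₗ[ℝ] V) (L : V →ₗ[ℝ] V) : LinearMap.trace ℝ V L =
    ∑ i, (Module.finBasis ℝ E).repr (A.symm (L (A (Module.finBasis ℝ E i)))) i := by
  rw [LinearMap.trace_eq_matrix_trace ℝ ((Module.finBasis ℝ E).map A), Matrix.trace]
  refine Finset.sum_congr rfl fun i _ => ?_
  simp [LinearMap.toMatrix_apply]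

end Density

end CRGeometry

end


noncomputable section

namespace CRGeometry

section Coordinates

variable {E : Type*} [NormedAddCommGroup E] [NormedSpace ℝ E]
  {H : Type*} [TopologicalSpace H] {I : ModelWithCorners ℝ E H}
  {M : Type*} [TopologicalSpace M] [ChartedSpace H M]

variable (I) in
/-- The inverse of the differential of a chart. -/
def chartInv (p x : M) : E →L[ℝ] TangentSpace I x :=
  (mfderiv I 𝓘(ℝ, E) (extChartAt I p) x).inverse

variable (I) in
/-- The coordinate vector field in direction `a` in the chart at `p`. -/
def coordField (p : M) (a : E) (x : M) : TangentSpace I x := chartInv I p x a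

variable (E) in
/-- A constant vector field on a normed space. -/
def constField (a : E) (x : E) : TangentSpace 𝓘(ℝ, E) x := a

theorem contMDiffAt_constField (a x : E) : ContMDiffAt 𝓘(ℝ, E) 𝓘(ℝ, E).tangent ∞
    (fun y => (⟨y, constField E a y⟩ : TangentBundle 𝓘(ℝ, E) E)) x :=
  contMDiffAt_vectorSpace_iff_contDiffAt.2 contDiffAt_const

theorem mlieBracket_constField (a c : E) (x : E) :
    mlieBracket 𝓘(ℝ, E) (constField E a) (constField E c) x = 0 := by
  rw [← mlieBracketWithin_univ, mlieBracketWithin_eq_lieBracketWithin]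
  change fderivWithin ℝ (fun _ => c) univ x a - fderivWithin ℝ (fun _ => a) univ x c = 0
  simp

theorem coordField_eq_mpullback (p : M) (a : E) :
    coordField I p a = mpullback I 𝓘(ℝ, E) (extChartAt I p) (constField E a) := rfl

variable [IsManifold I ∞ M]

theorem exists_chartInv_eq {p x : M} (hx : x ∈ (extChartAt I p).source) :
    ∃ A : E ≃L[ℝ] TangentSpace I x, (chartInv I p x : E →L[ℝ] TangentSpace I x) = A ∧
      mfderiv I 𝓘(ℝ, E) (extChartAt I p) x = (A.symm : TangentSpace I x →L[ℝ] E) := by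
  obtain ⟨A, hA⟩ := isInvertible_mfderiv_extChartAt hx
  refine ⟨A.symm, ?_, hA.symm⟩
  rw [chartInv, ← hA]
  exact ContinuousLinearMap.inverse_equiv A

theorem contMDiffAt_extChart {p x : M} (hx : x ∈ (extChartAt I p).source) :
    ContMDiffAt I 𝓘(ℝ, E) ∞ (extChartAt I p) x :=
  contMDiffAt_extChartAt' (by rwa [extChartAt_source] at hx)

theorem contMDiffAt_coordField [CompleteSpace E] (a : E) {p x : M}
    (hx : x ∈ (extChartAt I p).source) :
    ContMDiffAt I I.tangent ∞ (fun y => (⟨y, coordField I p a y⟩ : TangentBundle I M)) x := by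
  have h := ContMDiffWithinAt.mpullback_vectorField_preimage (n := ∞) (m := ∞) (t := univ)
    (V := constField E a) (contMDiffAt_constField a _) (contMDiffAt_extChart hx)
    (isInvertible_mfderiv_extChartAt hx) (by simp)
  rwa [preimage_univ, contMDiffWithinAt_univ] at h

theorem mlieBracket_coordField [CompleteSpace E] (a c : E) {p x : M}
    (hx : x ∈ (extChartAt I p).source) :
    mlieBracket I (coordField I p a) (coordField I p c) x = 0 := by
  have : IsManifold I (minSmoothness ℝ 3) M := IsManifold.of_le (n := ∞) minSmoothness_three_le
  have : IsManifold I (minSmoothness ℝ 2) M := IsManifold.of_le (n := ∞) minSmoothness_two_le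
  rw [coordField_eq_mpullback, coordField_eq_mpullback,
    ← mpullback_mlieBracket (n := ∞)
      ((contMDiffAt_constField a _).mdifferentiableAt (by simp))
      ((contMDiffAt_constField c _).mdifferentiableAt (by simp)) (contMDiffAt_extChart hx) minSmoothness_two_le]
  rw [mpullback_apply, mlieBracket_constField, map_zero]

theorem exists_isSmoothField_coordField [FiniteDimensional ℝ E] [T2Space M] (a : E) {p x : M}
    (hx : x ∈ (extChartAt I p).source) :
    ∃ Y : ∀ x : M, TangentSpace I x, IsSmoothField I Y ∧ Y =ᶠ[𝓝 x] coordField I p a := by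
  have : CompleteSpace E := FiniteDimensional.complete ℝ E
  exact exists_isSmoothField_eventuallyEq (extChartAt_source_mem_nhds' hx)
    fun y hy => (contMDiffAt_coordField a hy).contMDiffWithinAt

/-- A density on the manifold in the chart at `p`. -/
def density (B : ∀ x : M, LinearMap.BilinForm ℝ (TangentSpace I x)) [FiniteDimensional ℝ E]
    (p x : M) : ℝ :=
  formDensity (B x) (chartInv I p x : E →ₗ[ℝ] TangentSpace I x)

/-- A smooth nondegenerate bilinear form on the tangent bundle. -/
structure IsNondegenerateForm (B : ∀ x : M, LinearMap.BilinForm ℝ (TangentSpace I x)) : Prop where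
  contMDiff : ∀ X Y : ∀ x : M, TangentSpace I x, IsSmoothField I X → IsSmoothField I Y →
    ContMDiff I 𝓘(ℝ, ℝ) ∞ fun x => B x (X x) (Y x)
  eq_zero : ∀ (x : M) (v : TangentSpace I x), (∀ w, B x v w = 0) → v = 0

/-- A connection for which the form `B` is parallel and whose torsion has vanishing traces. -/
structure IsMetricConnection (B : ∀ x : M, LinearMap.BilinForm ℝ (TangentSpace I x))
    [FiniteDimensional ℝ E] (D : CovariantDerivative I E (TangentSpace I : M → Type _)) : Prop where
  parallel : ∀ X Y : ∀ x : M, TangentSpace I x, IsSmoothField I X → IsSmoothField I Y →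
    ∀ (x : M) (v : TangentSpace I x), mvfderiv I (fun y => B y (X y) (Y y)) x v =
      B x (D X x v) (Y x) + B x (X x) (D Y x v)
  trace_torsion : ∀ (x : M) (w : TangentSpace I x),
    LinearMap.trace ℝ (TangentSpace I x) (D.torsion x w : TangentSpace I x →ₗ[ℝ] _) = 0

section Density

variable [FiniteDimensional ℝ E] [T2Space M]
  {B : ∀ x : M, LinearMap.BilinForm ℝ (TangentSpace I x)} (hB : IsNondegenerateForm B)
include hB

theorem IsNondegenerateForm.contMDiffAt_coordField (a c : E) {p x : M}
    (hx : x ∈ (extChartAt I p).source) :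
    ContMDiffAt I 𝓘(ℝ, ℝ) ∞ (fun y => B y (coordField I p a y) (coordField I p c y)) x := by
  obtain ⟨X, hX, hXa⟩ := exists_isSmoothField_coordField a hx
  obtain ⟨Y, hY, hYc⟩ := exists_isSmoothField_coordField c hx
  refine (hB.contMDiff X Y hX hY x).congr_of_eventuallyEq ?_
  filter_upwards [hXa, hYc] with y h1 h2
  rw [h1, h2]

omit [T2Space M] in
theorem IsNondegenerateForm.det_coordField_ne_zero {p x : M} (hx : x ∈ (extChartAt I p).source) :
    (Matrix.of fun i j => B x (coordField I p (Module.finBasis ℝ E i) x)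
      (coordField I p (Module.finBasis ℝ E j) x)).det ≠ 0 := by
  obtain ⟨A, hA, -⟩ := exists_chartInv_eq hx
  have h := det_formMatrix_ne_zero (β := B x) (A := A.toLinearEquiv) (hB.eq_zero x)
  simp only [coordField, hA]
  exact h

omit [T2Space M] in
theorem IsNondegenerateForm.density_pos {p x : M} (hx : x ∈ (extChartAt I p).source) :
    0 < density B p x :=
  Real.sqrt_pos.2 (abs_pos.2 (hB.det_coordField_ne_zero hx))

theorem IsNondegenerateForm.contMDiffAt_det {p x : M} (hx : x ∈ (extChartAt I p).source) :
    ContMDiffAt I 𝓘(ℝ, ℝ) ∞ (fun y => (Matrix.of fun i j =>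
      B y (coordField I p (Module.finBasis ℝ E i) y)
        (coordField I p (Module.finBasis ℝ E j) y)).det) x := by
  let b := Module.finBasis ℝ E
  let F : ContinuousMultilinearMap ℝ (fun _ : Fin (Module.finrank ℝ E) =>
      Fin (Module.finrank ℝ E) → ℝ) ℝ :=
    ⟨(Matrix.detRowAlternating (R := ℝ)).toMultilinearMap, continuous_id.matrix_det⟩
  let g : M → Fin (Module.finrank ℝ E) → Fin (Module.finrank ℝ E) → ℝ :=
    fun y i j => B y (coordField I p (b i) y) (coordField I p (b j) y)
  have hg : ContMDiffAt I 𝓘(ℝ, Fin (Module.finrank ℝ E) → Fin (Module.finrank ℝ E) → ℝ) ∞ g x :=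
    contMDiffAt_pi_space.2 fun i => contMDiffAt_pi_space.2 fun j =>
      hB.contMDiffAt_coordField (b i) (b j) hx
  exact F.contDiff.contDiffAt.contMDiffAt.comp x hg

theorem IsNondegenerateForm.contMDiffAt_density {p x : M} (hx : x ∈ (extChartAt I p).source) :
    ContMDiffAt I 𝓘(ℝ, ℝ) ∞ (density B p) x := by
  have h0 := hB.det_coordField_ne_zero hx
  have h1 : ContDiffAt ℝ ∞ (fun z : ℝ => √|z|) _ := (contDiffAt_abs h0).sqrt (abs_pos.2 h0).ne'
  exact ContMDiffAt.comp (g := fun z : ℝ => √|z|) x h1.contMDiffAt (hB.contMDiffAt_det hx)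

/-- The derivative of the density in a coordinate direction is a divergence. -/
theorem IsNondegenerateForm.mvfderiv_density
    {D : CovariantDerivative I E (TangentSpace I : M → Type _)} (hD : IsMetricConnection B D)
    {p x : M} (hx : x ∈ (extChartAt I p).source) {a : E} {Y : ∀ x : M, TangentSpace I x}
    (hY : IsSmoothField I Y) (hYa : Y =ᶠ[𝓝 x] coordField I p a) :
    mvfderiv I (density B p) x (Y x) =
      LinearMap.trace ℝ _ (D Y x : TangentSpace I x →ₗ[ℝ] TangentSpace I x) * density B p x := by
  have : CompleteSpace E := FiniteDimensional.complete ℝ E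
  have : IsManifold I 2 M := IsManifold.of_le (n := ∞) (by exact WithTop.coe_le_coe.2 le_top)
  let b := Module.finBasis ℝ E
  choose X hX hXb using fun i => exists_isSmoothField_coordField (b i) hx
  obtain ⟨A, hA, -⟩ := exists_chartInv_eq hx
  have hXx : ∀ i, X i x = A (b i) := fun i => by
    rw [(hXb i).self_of_nhds, coordField, hA]
    rfl
  let h : M → Matrix _ _ ℝ := fun y => Matrix.of fun i j =>
    B y (coordField I p (b i) y) (coordField I p (b j) y)
  let m : Matrix _ _ ℝ := Matrix.of fun i l => b.repr (A.symm (D (X i) x (Y x))) l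
  have hm : ∀ i, D (X i) x (Y x) = ∑ l, m i l • X l x := by
    intro i
    apply A.symm.injective
    simp only [map_sum, map_smul, hXx, ContinuousLinearEquiv.symm_apply_apply]
    exact (b.sum_repr _).symm
  have hhx : ∀ i j, h x i j = B x (X i x) (X j x) := fun i j => by
    rw [(hXb i).self_of_nhds, (hXb j).self_of_nhds]
    rfl
  have h1 := mvfderiv_det (h := h) (x := x) (b := m)
    (fun i j => hB.contMDiffAt_coordField (b i) (b j) hx) (Y x) (fun i j => by
      have h2 : (fun y => h y i j) =ᶠ[𝓝 x] fun y => B y (X i y) (X j y) := by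
        filter_upwards [hXb i, hXb j] with y h1 h2
        rw [h1, h2]
        rfl
      rw [mvfderiv_congr h2, hD.parallel _ _ (hX i) (hX j), hm i, hm j]
      simp only [Matrix.add_apply, Matrix.mul_apply, Matrix.transpose_apply, hhx, map_sum, map_smul,
        LinearMap.sum_apply, LinearMap.smul_apply, smul_eq_mul]
      simp only [mul_comm])
    (hB.det_coordField_ne_zero hx)
  have h3 : MDifferentiableAt I 𝓘(ℝ, ℝ) (fun y => (h y).det) x :=
    (hB.contMDiffAt_det hx).mdifferentiableAt (by simp)
  have h4 := mvfderiv_sqrt_abs h3 (hB.det_coordField_ne_zero hx) (Y x) h1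
  refine h4.trans ?_
  congr 1
  have h5 : ∀ i, D (X i) x (Y x) = D Y x (X i x) + D.torsion x (Y x) (X i x) := by
    intro i
    rw [D.torsion_apply (hY.mdifferentiableAt x) ((hX i).mdifferentiableAt x),
      Filter.EventuallyEq.mlieBracket_vectorField_eq hYa (hXb i), mlieBracket_coordField _ _ hx]
    abel
  rw [← add_zero (LinearMap.trace ℝ _ _), ← hD.trace_torsion x (Y x),
    trace_eq_sum_chart A.toLinearEquiv, trace_eq_sum_chart A.toLinearEquiv, ← Finset.sum_add_distrib,
    Matrix.trace]
  refine Finset.sum_congr rfl fun i _ => ?_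
  change b.repr (A.symm (D (X i) x (Y x))) i = b.repr (A.symm (D Y x (A (b i)))) i +
    b.repr (A.symm (D.torsion x (Y x) (A (b i)))) i
  rw [h5, hXx, map_add, map_add]
  rfl

end Density

end Coordinates

end CRGeometry

end


noncomputable section

namespace CRGeometry

section ChartFunctions

variable {E : Type*} [NormedAddCommGroup E] [NormedSpace ℝ E]
  {H : Type*} [TopologicalSpace H] {I : ModelWithCorners ℝ E H}
  {M : Type*} [TopologicalSpace M] [ChartedSpace H M]

variable (I) in
/-- A function on `M` in the chart at `p`, extended by zero. -/
def chartFun (p : M) (g : M → ℝ) : E → ℝ :=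
  indicator (extChartAt I p).target (g ∘ (extChartAt I p).symm)

theorem chartFun_extChartAt {p x : M} (hx : x ∈ (extChartAt I p).source) (g : M → ℝ) :
    chartFun I p g (extChartAt I p x) = g x := by
  rw [chartFun, indicator_of_mem ((extChartAt I p).map_source hx), Function.comp_apply,
    (extChartAt I p).left_inv hx]

variable [CompactSpace M]

theorem exists_isCompact_chartFun (p : M) {g : M → ℝ}
    (hg : tsupport g ⊆ (extChartAt I p).source) : ∃ K ⊆ (extChartAt I p).target,
      IsCompact K ∧ ∀ z ∉ K, chartFun I p g z = 0 := by
  refine ⟨extChartAt I p '' tsupport g, image_subset_iff.2 fun x hx =>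
    (extChartAt I p).map_source (hg hx),
    (isClosed_tsupport g).isCompact.image_of_continuousOn
      ((continuousOn_extChartAt p).mono hg), fun z hz => ?_⟩
  by_cases hzt : z ∈ (extChartAt I p).target
  · rw [chartFun, indicator_of_mem hzt]
    exact image_eq_zero_of_notMem_tsupport (f := g)
      fun h => hz ⟨_, h, (extChartAt I p).right_inv hzt⟩
  · exact indicator_of_notMem hzt _

theorem hasCompactSupport_chartFun (p : M) {g : M → ℝ}
    (hg : tsupport g ⊆ (extChartAt I p).source) : HasCompactSupport (chartFun I p g) := by
  obtain ⟨K, -, hK, h⟩ := exists_isCompact_chartFun p hg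
  exact HasCompactSupport.intro hK fun z hz => h z hz

theorem tsupport_chartFun_subset (p : M) {g : M → ℝ}
    (hg : tsupport g ⊆ (extChartAt I p).source) :
    tsupport (chartFun I p g) ⊆ (extChartAt I p).target := by
  obtain ⟨K, hKt, hK, h⟩ := exists_isCompact_chartFun p hg
  refine Subset.trans (closure_minimal (fun z hz => ?_) hK.isClosed) hKt
  by_contra h1
  exact hz (h z h1)

theorem contDiff_chartFun [I.Boundaryless] [IsManifold I ∞ M] (p : M) {g : M → ℝ} {k : ℕ∞}
    (hg : tsupport g ⊆ (extChartAt I p).source)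
    (hg' : ∀ x ∈ (extChartAt I p).source, ContMDiffAt I 𝓘(ℝ, ℝ) k g x) :
    ContDiff ℝ k (chartFun I p g) := by
  obtain ⟨K, hKt, hK, h⟩ := exists_isCompact_chartFun p hg
  rw [contDiff_iff_contDiffAt]
  intro z
  by_cases hz : z ∈ (extChartAt I p).target
  · have h1 := (contMDiffOn_extChartAt_symm (I := I) (n := ∞) p).contMDiffAt
      ((isOpen_extChartAt_target p).mem_nhds hz)
    have h2 := (hg' _ ((extChartAt I p).map_target hz)).comp z
      (h1.of_le (WithTop.coe_le_coe.2 (le_top : k ≤ ⊤)))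
    rw [contMDiffAt_iff_contDiffAt] at h2
    refine h2.congr_of_eventuallyEq ?_
    filter_upwards [(isOpen_extChartAt_target p).mem_nhds hz] with y hy
    exact indicator_of_mem hy _
  · refine contDiffAt_const (c := (0 : ℝ)).congr_of_eventuallyEq ?_
    filter_upwards [hK.isClosed.isOpen_compl.mem_nhds fun hzK => hz (hKt hzK)] with y hy
    exact h y hy

omit [CompactSpace M] in
theorem fderiv_chartFun [IsManifold I ∞ M] {p x : M} (hx : x ∈ (extChartAt I p).source)
    {g : M → ℝ} (hg : DifferentiableAt ℝ (chartFun I p g) (extChartAt I p x)) (a : E) :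
    fderiv ℝ (chartFun I p g) (extChartAt I p x) a = mvfderiv I g x (coordField I p a x) := by
  have h1 : g =ᶠ[𝓝 x] fun y => chartFun I p g (extChartAt I p y) := by
    filter_upwards [extChartAt_source_mem_nhds' hx] with y hy
    exact (chartFun_extChartAt hy g).symm
  obtain ⟨A, hA, hA'⟩ := exists_chartInv_eq hx
  rw [mvfderiv_congr h1, mvfderiv_comp_eq hg.hasFDerivAt
    ((contMDiffAt_extChart hx).mdifferentiableAt (by simp))]
  congr 1
  rw [coordField, hA]
  change a = mfderiv I 𝓘(ℝ, E) (extChartAt I p) x (A a)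
  rw [hA']
  exact (A.symm_apply_apply a).symm

theorem integral_fderiv_eq_zero [MeasurableSpace E] [BorelSpace E] [FiniteDimensional ℝ E]
    {ν : MeasureTheory.Measure E} [ν.IsAddHaarMeasure] {F : E → ℝ} (hF : ContDiff ℝ ∞ F)
    (hc : HasCompactSupport F) (a : E) : ∫ z, fderiv ℝ F z a ∂ν = 0 := by
  have h1 := hF.continuous_fderiv (by simp)
  have h2 : MeasureTheory.Integrable (fun z => fderiv ℝ F z a) ν :=
    (h1.clm_apply continuous_const).integrable_of_hasCompactSupport (hc.fderiv_apply ℝ a)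
  have h := integral_mul_fderiv_eq_neg_fderiv_mul_of_integrable (μ := ν) (f := fun _ => (1 : ℝ))
    (g := F) (v := a) (by simp) (by simpa using h2)
    (by simpa using hF.continuous.integrable_of_hasCompactSupport hc)
    (fun _ _ => differentiableAt_const _) (fun z _ => hF.differentiable (by simp) z)
  simpa using h

end ChartFunctions

section Divergence

variable {E : Type*} [NormedAddCommGroup E] [NormedSpace ℝ E] [FiniteDimensional ℝ E]
  {H : Type*} [TopologicalSpace H] {I : ModelWithCorners ℝ E H}
  {M : Type*} [TopologicalSpace M] [ChartedSpace H M] [IsManifold I ∞ M]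

variable (I) in
/-- The components of a vector field in the chart at `p`. -/
def chartCoeff (p : M) (X : ∀ x : M, TangentSpace I x) (k : Fin (Module.finrank ℝ E)) (x : M) : ℝ :=
  mvfderiv I (fun y => (Module.finBasis ℝ E).repr (extChartAt I p y) k) x (X x)

theorem mvfderiv_chartCoord {p x : M} (hx : x ∈ (extChartAt I p).source)
    (k : Fin (Module.finrank ℝ E)) (v : TangentSpace I x) :
    mvfderiv I (fun y => (Module.finBasis ℝ E).repr (extChartAt I p y) k) x v =
      (Module.finBasis ℝ E).repr (mfderiv I 𝓘(ℝ, E) (extChartAt I p) x v) k := by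
  let L : E →L[ℝ] ℝ := ((Module.finBasis ℝ E).coord k).toContinuousLinearMap
  exact mvfderiv_comp_eq (L.hasFDerivAt (x := extChartAt I p x))
    ((contMDiffAt_extChart hx).mdifferentiableAt (by simp)) v

theorem sum_chartCoeff {p x : M} (hx : x ∈ (extChartAt I p).source)
    (X : ∀ x : M, TangentSpace I x) :
    ∑ k, chartCoeff I p X k x • coordField I p (Module.finBasis ℝ E k) x = X x := by
  obtain ⟨A, hA, hA'⟩ := exists_chartInv_eq hx
  simp only [chartCoeff, mvfderiv_chartCoord hx, coordField, hA, hA']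
  have h := congrArg A ((Module.finBasis ℝ E).sum_repr (A.symm (X x)))
  rw [map_sum, A.apply_symm_apply] at h
  refine Eq.trans (Finset.sum_congr rfl fun k _ => ?_) h
  exact (map_smul A _ _).symm

variable [T2Space M]

theorem contMDiffAt_chartCoeff {p x : M} (hx : x ∈ (extChartAt I p).source)
    {X : ∀ x : M, TangentSpace I x} (hX : IsSmoothField I X) (k : Fin (Module.finrank ℝ E)) :
    ContMDiffAt I 𝓘(ℝ, ℝ) ∞ (chartCoeff I p X k) x := by
  let L : E →L[ℝ] ℝ := ((Module.finBasis ℝ E).coord k).toContinuousLinearMap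
  have h1 : ContMDiffOn I 𝓘(ℝ, ℝ) ∞ (fun y => L (extChartAt I p y)) (extChartAt I p).source :=
    fun y hy => (L.contDiff.contMDiff.contMDiffAt.comp y
      (contMDiffAt_extChart hy)).contMDiffWithinAt
  obtain ⟨g, hg, hgL⟩ := exists_contMDiff_eventuallyEq (extChartAt_source_mem_nhds' hx) h1
  refine (contMDiff_mvfderiv_apply hg hX x).congr_of_eventuallyEq ?_
  filter_upwards [hgL.eventually_nhds] with y hy
  rw [mvfderiv_congr hy]
  rfl

omit [FiniteDimensional ℝ E] [T2Space M] in
theorem covariantDerivative_sum_smul (D : CovariantDerivative I E (TangentSpace I : M → Type _))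
    {ι : Type*} (s : Finset ι) {g : ι → M → ℝ} {Y : ι → ∀ x : M, TangentSpace I x}
    (hg : ∀ k, ContMDiff I 𝓘(ℝ, ℝ) ∞ (g k)) (hY : ∀ k, IsSmoothField I (Y k)) (x : M) :
    IsSmoothField I (∑ k ∈ s, g k • Y k) ∧ D (∑ k ∈ s, g k • Y k) x =
      ∑ k ∈ s, (g k x • D (Y k) x + (mvfderiv I (g k) x).smulRight (Y k x)) := by
  classical
  induction s using Finset.induction_on with
  | empty =>
    refine ⟨?_, by simp [CovariantDerivative.zero]⟩
    simpa using! contMDiff_zeroSection ℝ (TangentSpace I : M → Type _)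
  | insert k s hk ih =>
    rw [Finset.sum_insert hk, Finset.sum_insert hk]
    have h1 := (hY k).smul (hg k)
    refine ⟨h1.add ih.1, ?_⟩
    rw [D.isCovariantDerivativeOn.add (h1.mdifferentiableAt x) (ih.1.mdifferentiableAt x)
      (mem_univ _), ih.2, D.isCovariantDerivativeOn.leibniz ((hY k).mdifferentiableAt x)
      ((hg k).mdifferentiable (by simp) x) (mem_univ _)]

variable {B : ∀ x : M, LinearMap.BilinForm ℝ (TangentSpace I x)} (hB : IsNondegenerateForm B)
  {D : CovariantDerivative I E (TangentSpace I : M → Type _)} (hD : IsMetricConnection B D)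
include hB hD

/-- The divergence of a vector field in coordinates. -/
theorem trace_mul_density {p x : M} (hx : x ∈ (extChartAt I p).source)
    {X : ∀ x : M, TangentSpace I x} (hX : IsSmoothField I X) :
    LinearMap.trace ℝ _ (D X x : TangentSpace I x →ₗ[ℝ] TangentSpace I x) * density B p x =
      ∑ k, mvfderiv I (fun y => chartCoeff I p X k y * density B p y) x
        (coordField I p (Module.finBasis ℝ E k) x) := by
  choose Y hY hYb using fun k => exists_isSmoothField_coordField (Module.finBasis ℝ E k) hx
  choose g hg hgX using fun k => exists_contMDiff_eventuallyEq (extChartAt_source_mem_nhds' hx)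
    fun y hy => (contMDiffAt_chartCoeff (k := k) hy hX).contMDiffWithinAt
  have h1 : X =ᶠ[𝓝 x] ∑ k, g k • Y k := by
    filter_upwards [Filter.eventually_all.2 hYb, Filter.eventually_all.2 hgX,
      extChartAt_source_mem_nhds' hx] with y h1 h2 h3
    have e : (∑ k, g k • Y k) y = ∑ k, (g k • Y k) y := Finset.sum_apply _ _ _
    refine (sum_chartCoeff h3 X).symm.trans (Eq.trans (Finset.sum_congr rfl fun k _ => ?_) e.symm)
    rw [Pi.smul_apply', h1, h2]
  have h2 := (covariantDerivative_sum_smul D Finset.univ hg hY x).2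
  rw [← D.isCovariantDerivativeOn.congr_of_eventuallyEq (hX.mdifferentiableAt x)
    ((covariantDerivative_sum_smul D Finset.univ hg hY x).1.mdifferentiableAt x) Filter.univ_mem h1]
    at h2
  have h3 : LinearMap.trace ℝ _ (D X x : TangentSpace I x →ₗ[ℝ] TangentSpace I x) =
      ∑ k, (g k x * LinearMap.trace ℝ _ (D (Y k) x : TangentSpace I x →ₗ[ℝ] TangentSpace I x)
        + mvfderiv I (g k) x (Y k x)) := by
    rw [h2, ContinuousLinearMap.toLinearMap_sum, map_sum]
    refine Finset.sum_congr rfl fun k _ => ?_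
    rw [ContinuousLinearMap.toLinearMap_add, map_add, ContinuousLinearMap.toLinearMap_smul,
      map_smul]
    congr 1
    have : Module.Finite ℝ (TangentSpace I x) := inferInstanceAs (Module.Finite ℝ E)
    exact LinearMap.trace_smulRight _ _
  rw [h3, Finset.sum_mul]
  refine Finset.sum_congr rfl fun k _ => ?_
  have h4 : (fun y => chartCoeff I p X k y * density B p y) =ᶠ[𝓝 x]
      fun y => g k y * density B p y := by
    filter_upwards [hgX k] with y hy
    rw [hy]
  rw [mvfderiv_congr h4, mvfderiv_fun_mul ((hg k).mdifferentiable (by simp) x)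
    ((hB.contMDiffAt_density hx).mdifferentiableAt (by simp)), ← (hYb k).self_of_nhds]
  have h5 := hB.mvfderiv_density hD hx (hY k) (hYb k)
  simp only [add_apply, smul_apply, smul_eq_mul, h5]
  ring

/-- The divergence theorem for a vector field with support in a chart. -/
theorem integral_trace_mul_density [CompactSpace M] [I.Boundaryless] [MeasurableSpace E]
    [BorelSpace E] {ν : MeasureTheory.Measure E} [ν.IsAddHaarMeasure]
    {p : M} {X : ∀ x : M, TangentSpace I x} (hX : IsSmoothField I X) {f : M → ℝ}
    (hf : tsupport f ⊆ (extChartAt I p).source) (hfX : ∀ x, f x = 0 → X x = 0) :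
    ∫ z, chartFun I p (fun x => LinearMap.trace ℝ _
      (D X x : TangentSpace I x →ₗ[ℝ] TangentSpace I x) * density B p x) z ∂ν = 0 := by
  let F : Fin (Module.finrank ℝ E) → M → ℝ := fun k y => chartCoeff I p X k y * density B p y
  have h1 : ∀ k, tsupport (F k) ⊆ (extChartAt I p).source := fun k => by
    refine Subset.trans (closure_mono fun x hx => ?_) hf
    contrapose! hx
    simp only [Function.mem_support, not_not] at hx ⊢
    simp only [F, chartCoeff, hfX x hx, map_zero, zero_mul]
  have h2 : ∀ k, ContDiff ℝ ∞ (chartFun I p (F k)) := fun k =>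
    contDiff_chartFun (k := ⊤) p (h1 k) fun x hx =>
      (contMDiffAt_chartCoeff hx hX k).mul (hB.contMDiffAt_density hx)
  have h3 : chartFun I p (fun x => LinearMap.trace ℝ _
      (D X x : TangentSpace I x →ₗ[ℝ] TangentSpace I x) * density B p x) =
      fun z => ∑ k, fderiv ℝ (chartFun I p (F k)) z (Module.finBasis ℝ E k) := by
    ext z
    by_cases hz : z ∈ (extChartAt I p).target
    · obtain ⟨x, hx, rfl⟩ : ∃ x ∈ (extChartAt I p).source, extChartAt I p x = z :=
        ⟨_, (extChartAt I p).map_target hz, (extChartAt I p).right_inv hz⟩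
      rw [chartFun_extChartAt hx, trace_mul_density hB hD hx hX]
      exact Finset.sum_congr rfl fun k _ =>
        (fderiv_chartFun hx ((h2 k).differentiable (by simp) _) _).symm
    · rw [chartFun, indicator_of_notMem hz]
      refine (Finset.sum_eq_zero fun k _ => ?_).symm
      rw [fderiv_of_notMem_tsupport _ fun h => hz (tsupport_chartFun_subset p (h1 k) h)]
      rfl
  rw [h3, MeasureTheory.integral_finsetSum _ fun k _ =>
    (((h2 k).continuous_fderiv (by simp)).clm_apply continuous_const).integrable_of_hasCompactSupport
      ((hasCompactSupport_chartFun p (h1 k)).fderiv_apply ℝ _)]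
  exact Finset.sum_eq_zero fun k _ =>
    integral_fderiv_eq_zero (h2 k) (hasCompactSupport_chartFun p (h1 k)) _

end Divergence

end CRGeometry

end


noncomputable section

namespace CRGeometry

section ChangeOfVariables

variable {E : Type*} [NormedAddCommGroup E] [NormedSpace ℝ E]
  {H : Type*} [TopologicalSpace H] {I : ModelWithCorners ℝ E H}
  {M : Type*} [TopologicalSpace M] [ChartedSpace H M] [IsManifold I ∞ M]

variable [FiniteDimensional ℝ E]
  {B : ∀ x : M, LinearMap.BilinForm ℝ (TangentSpace I x)} (hB : IsNondegenerateForm B)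
  (ψ : Diffeomorph I I M M ∞)

/-- The differential of a diffeomorphism in charts. -/
def chartMap (p q x : M) : E →L[ℝ] E :=
  (mfderiv I 𝓘(ℝ, E) (extChartAt I q) (ψ x)).comp ((mfderiv I I ψ x).comp (chartInv I p x))

omit [FiniteDimensional ℝ E] in
theorem hasFDerivAt_chartMap [I.Boundaryless] {p q x : M} (hx : x ∈ (extChartAt I p).source)
    (hx' : ψ x ∈ (extChartAt I q).source) :
    HasFDerivAt (fun z => extChartAt I q (ψ ((extChartAt I p).symm z))) (chartMap ψ p q x)
      (extChartAt I p x) := by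
  let g : E → E := fun z => extChartAt I q (ψ ((extChartAt I p).symm z))
  have h1 := (contMDiffOn_extChartAt_symm (I := I) (n := ∞) p).contMDiffAt
    ((isOpen_extChartAt_target p).mem_nhds ((extChartAt I p).map_source hx))
  have e := (extChartAt I p).left_inv hx
  have h2 : ContMDiffAt I I ∞ ψ ((extChartAt I p).symm (extChartAt I p x)) :=
    ψ.contMDiff.contMDiffAt
  have h3 : ContMDiffAt I 𝓘(ℝ, E) ∞ (extChartAt I q)
      (ψ ((extChartAt I p).symm (extChartAt I p x))) := contMDiffAt_extChart (by rwa [e])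
  have h4 : ContMDiffAt 𝓘(ℝ, E) 𝓘(ℝ, E) ∞ g (extChartAt I p x) :=
    ContMDiffAt.comp (extChartAt I p x) h3 (ContMDiffAt.comp (extChartAt I p x) h2 h1)
  have h5 : DifferentiableAt ℝ g (extChartAt I p x) := h4.contDiffAt.differentiableAt (by simp)
  have h6 : g ∘ extChartAt I p =ᶠ[𝓝 x] extChartAt I q ∘ ψ := by
    filter_upwards [extChartAt_source_mem_nhds' hx] with y hy
    simp only [g, Function.comp_apply, (extChartAt I p).left_inv hy]
  have h7 := h6.mfderiv_eq (I := I) (I' := 𝓘(ℝ, E))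
  rw [mfderiv_comp x h5.mdifferentiableAt
    ((contMDiffAt_extChart hx).mdifferentiableAt (by simp)),
    mfderiv_comp x ((contMDiffAt_extChart hx').mdifferentiableAt (by simp))
      (ψ.mdifferentiable (by simp) x)] at h7
  obtain ⟨A, hA, hA'⟩ := exists_chartInv_eq hx
  convert h5.hasFDerivAt using 1
  ext a
  have h8 := congrArg (fun L => L (A a)) h7
  rw [hA'] at h8
  refine Eq.trans ?_ (h8.symm.trans ?_)
  · rw [chartMap, hA]
    rfl
  · change mfderiv 𝓘(ℝ, E) 𝓘(ℝ, E) g (extChartAt I p x) (A.symm (A a)) = _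
    rw [A.symm_apply_apply, mfderiv_eq_fderiv]
    rfl

theorem abs_det_chartMap_mul {p q x : M} (hx : x ∈ (extChartAt I p).source)
    (hx' : ψ x ∈ (extChartAt I q).source) {Φ : TangentSpace I x →ₗ[ℝ] TangentSpace I x}
    (hΦ : ∀ v w, B (ψ x) (mfderiv I I ψ x v) (mfderiv I I ψ x w) = B x (Φ v) (Φ w)) :
    |(chartMap ψ p q x).det| * density B q (ψ x) = |LinearMap.det Φ| * density B p x := by
  obtain ⟨A, hA, -⟩ := exists_chartInv_eq hx
  obtain ⟨A', hA', hA''⟩ := exists_chartInv_eq hx'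
  let β : LinearMap.BilinForm ℝ (TangentSpace I x) :=
    (B (ψ x)).comp (mfderiv I I ψ x : TangentSpace I x →ₗ[ℝ] TangentSpace I (ψ x))
      (mfderiv I I ψ x : TangentSpace I x →ₗ[ℝ] TangentSpace I (ψ x))
  have h1 := formDensity_eq (β := β) (A := A.toLinearMap) (β' := B (ψ x)) (A' := A'.toLinearMap)
    (L := (chartMap ψ p q x : E →ₗ[ℝ] E)) fun v w => by
      have h2 : ∀ v, A' (chartMap ψ p q x v) = mfderiv I I ψ x (A v) := fun v => by
        rw [chartMap, hA, hA'']
        exact A'.apply_symm_apply _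
      change B (ψ x) (mfderiv I I ψ x (A v)) (mfderiv I I ψ x (A w)) =
        B (ψ x) (A' (chartMap ψ p q x v)) (A' (chartMap ψ p q x w))
      rw [h2, h2]
  have h2 := formDensity_eq (β := β) (A := A.toLinearMap) (β' := B x) (A' := A.toLinearMap)
    (L := A.symm.toLinearEquiv.conj Φ) fun v w => by
      have h2 : ∀ v, A (A.symm.toLinearEquiv.conj Φ v) = Φ (A v) :=
        fun v => A.apply_symm_apply _
      change B (ψ x) (mfderiv I I ψ x (A v)) (mfderiv I I ψ x (A w)) =
        B x (A (A.symm.toLinearEquiv.conj Φ v)) (A (A.symm.toLinearEquiv.conj Φ w))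
      rw [hΦ, h2, h2]
  have h3 : LinearMap.det (A.symm.toLinearEquiv.conj Φ) = LinearMap.det Φ :=
    LinearMap.det_conj Φ A.symm.toLinearEquiv
  rw [h1, h3] at h2
  simp only [density, hA, hA']
  exact h2

/-- Change of variables for integrals in charts. -/
theorem integral_chartFun_comp [I.Boundaryless] [MeasurableSpace E] [BorelSpace E]
    {ν : MeasureTheory.Measure E} [ν.IsAddHaarMeasure]
    {Φ : ∀ x, TangentSpace I x →ₗ[ℝ] TangentSpace I x}
    (hΦ : ∀ x v w, B (ψ x) (mfderiv I I ψ x v) (mfderiv I I ψ x w) = B x (Φ x v) (Φ x w))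
    {p q : M} {f : M → ℝ} (hq : tsupport f ⊆ (extChartAt I q).source)
    (hp : tsupport (fun x => f (ψ x)) ⊆ (extChartAt I p).source) :
    ∫ z, chartFun I p (fun x => f (ψ x) * |LinearMap.det (Φ x)| * density B p x) z ∂ν =
      ∫ z, chartFun I q (fun x => f x * density B q x) z ∂ν := by
  let φ := extChartAt I p
  let g : E → E := fun z => extChartAt I q (ψ (φ.symm z))
  let U : Set E := φ.target ∩ φ.symm ⁻¹' (ψ ⁻¹' (extChartAt I q).source)
  have hU : IsOpen U := (continuousOn_extChartAt_symm p).isOpen_inter_preimage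
    (isOpen_extChartAt_target p) ((isOpen_extChartAt_source q).preimage ψ.continuous)
  have hUx : ∀ z ∈ U, ∃ x ∈ φ.source, ψ x ∈ (extChartAt I q).source ∧ φ x = z := fun z hz =>
    ⟨φ.symm z, φ.map_target hz.1, hz.2, φ.right_inv hz.1⟩
  have hg : ∀ z ∈ U, HasFDerivWithinAt g (chartMap ψ p q (φ.symm z)) U z := fun z hz => by
    obtain ⟨x, hx, hx', rfl⟩ := hUx z hz
    rw [φ.left_inv hx]
    exact (hasFDerivAt_chartMap ψ hx hx').hasFDerivWithinAt
  have hinj : InjOn g U := fun z hz z' hz' h => by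
    have h1 := (extChartAt I q).injOn hz.2 hz'.2 h
    exact φ.symm.injOn hz.1 hz'.1 (ψ.injective h1)
  have h0 : ∀ x, f x ≠ 0 → x ∈ (extChartAt I q).source := fun x hx => hq (subset_closure hx)
  have h1 : ∀ z ∉ U, chartFun I p
      (fun x => f (ψ x) * |LinearMap.det (Φ x)| * density B p x) z = 0 := by
    intro z hz
    by_cases hzt : z ∈ φ.target
    · have h2 : f (ψ (φ.symm z)) = 0 := by
        by_contra h3
        exact hz ⟨hzt, h0 _ h3⟩
      rw [chartFun, indicator_of_mem hzt, Function.comp_apply, h2, zero_mul, zero_mul]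
    · exact indicator_of_notMem hzt _
  have h2 : ∀ z ∉ g '' U, chartFun I q (fun x => f x * density B q x) z = 0 := by
    intro z hz
    by_cases hzt : z ∈ (extChartAt I q).target
    · rw [chartFun, indicator_of_mem hzt, Function.comp_apply]
      by_contra h3
      have h4 := left_ne_zero_of_mul h3
      obtain ⟨x, hx⟩ := ψ.surjective ((extChartAt I q).symm z)
      rw [← hx] at h4
      have h5 : x ∈ φ.source := hp (subset_closure h4)
      refine hz ⟨φ x, ⟨φ.map_source h5, ?_⟩, ?_⟩
      · simp only [mem_preimage, φ.left_inv h5]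
        exact h0 _ h4
      · simp only [g, φ.left_inv h5]
        exact (congrArg (extChartAt I q) hx).trans ((extChartAt I q).right_inv hzt)
    · exact indicator_of_notMem hzt _
  rw [← MeasureTheory.setIntegral_eq_integral_of_forall_compl_eq_zero h1,
    ← MeasureTheory.setIntegral_eq_integral_of_forall_compl_eq_zero h2,
    MeasureTheory.integral_image_eq_integral_abs_det_fderiv_smul ν hU.measurableSet hg hinj]
  refine MeasureTheory.setIntegral_congr_fun hU.measurableSet fun z hz => ?_
  obtain ⟨x, hx, hx', rfl⟩ := hUx z hz
  have h3 := abs_det_chartMap_mul ψ hx hx' (hΦ x)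
  simp only [g, φ.left_inv hx]
  rw [chartFun_extChartAt hx, chartFun_extChartAt hx', smul_eq_mul]
  linear_combination -f (ψ x) * h3

end ChangeOfVariables

section Measure

open MeasureTheory

variable {E : Type*} [NormedAddCommGroup E] [NormedSpace ℝ E] [FiniteDimensional ℝ E]
  {H : Type*} [TopologicalSpace H] {I : ModelWithCorners ℝ E H} [I.Boundaryless]
  {M : Type*} [TopologicalSpace M] [ChartedSpace H M] [IsManifold I ∞ M] [T2Space M]
  [CompactSpace M]

omit [I.Boundaryless] in
variable (I M) in
theorem exists_chart_partition : ∃ (t : Finset M) (χ : t → M → ℝ),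
    (∀ i, ContMDiff I 𝓘(ℝ, ℝ) ∞ (χ i)) ∧
    (∀ i, tsupport (χ i) ⊆ (extChartAt I (i : M)).source) ∧
    (∀ i x, 0 ≤ χ i x) ∧ ∀ x, ∑ i, χ i x = 1 := by
  obtain ⟨t, ht⟩ := isCompact_univ.elim_finite_subcover
    (fun p : M => (extChartAt I p).source) (fun p => isOpen_extChartAt_source p)
    fun x _ => mem_iUnion.2 ⟨x, mem_extChartAt_source x⟩
  obtain ⟨χ, hχ⟩ := SmoothPartitionOfUnity.exists_isSubordinate I (s := univ) isClosed_univ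
    (fun i : t => (extChartAt I (i : M)).source) (fun i => isOpen_extChartAt_source _)
    fun x hx => by
      obtain ⟨i, hi⟩ := mem_iUnion.1 (ht hx)
      obtain ⟨hi, hx⟩ := mem_iUnion.1 hi
      exact mem_iUnion.2 ⟨⟨i, hi⟩, hx⟩
  refine ⟨t, fun i => χ i, fun i => (χ i).contMDiff, hχ, fun i x => χ.nonneg i x, fun x => ?_⟩
  rw [← finsum_eq_sum_of_fintype]
  exact χ.sum_eq_one (mem_univ x)

variable [MeasurableSpace E] [BorelSpace E] [MeasurableSpace M] [BorelSpace M]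
  (ν : Measure E) [ν.IsAddHaarMeasure]
  {B : ∀ x : M, LinearMap.BilinForm ℝ (TangentSpace I x)}

omit [FiniteDimensional ℝ E] [IsManifold I ∞ M] [T2Space M] [CompactSpace M]
  [ν.IsAddHaarMeasure] in
theorem aemeasurable_extChartAt_symm (p : M) {r : E → ENNReal} : AEMeasurable (extChartAt I p).symm
    ((ν.restrict (extChartAt I p).target).withDensity r) :=
  ((continuousOn_extChartAt_symm p).aemeasurable (isOpen_extChartAt_target p).measurableSet).mono_ac
    (withDensity_absolutelyContinuous _ _)

omit [MeasurableSpace E] [BorelSpace E] [MeasurableSpace M] [BorelSpace M] in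
theorem IsNondegenerateForm.continuous_chartFun (hB : IsNondegenerateForm B) {p : M} {f : M → ℝ}
    (hf : Continuous f) (hfp : tsupport f ⊆ (extChartAt I p).source) :
    Continuous (chartFun I p (fun x => f x * density B p x)) ∧
      HasCompactSupport (chartFun I p (fun x => f x * density B p x)) := by
  have h1 : tsupport (fun x => f x * density B p x) ⊆ (extChartAt I p).source :=
    (tsupport_mul_subset_left).trans hfp
  refine ⟨(contDiff_chartFun (k := 0) p h1 fun x hx => ?_).continuous,
    hasCompactSupport_chartFun p h1⟩
  exact (contMDiff_zero_iff.2 hf x).mul ((hB.contMDiffAt_density hx).of_le (by simp))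

theorem IsNondegenerateForm.exists_measure (hB : IsNondegenerateForm B) {t : Finset M}
    {χ : t → M → ℝ} (hχ : ∀ i, ContMDiff I 𝓘(ℝ, ℝ) ∞ (χ i))
    (hχs : ∀ i, tsupport (χ i) ⊆ (extChartAt I (i : M)).source) (hχ0 : ∀ i x, 0 ≤ χ i x) :
    ∃ μ : Measure M, IsFiniteMeasure μ ∧ ∀ f : M → ℝ, Continuous f →
      ∫ x, f x ∂μ = ∑ i : t, ∫ z, chartFun I (i : M) (fun x => χ i x * f x * density B i x) z ∂ν := by
  let r : t → E → ℝ := fun i => chartFun I (i : M) (fun x => χ i x * density B i x)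
  have hr : ∀ i, Continuous (r i) ∧ HasCompactSupport (r i) := fun i =>
    hB.continuous_chartFun (hχ i).continuous (hχs i)
  have hr0 : ∀ i z, 0 ≤ r i z := fun i z => indicator_nonneg (fun z hz =>
    mul_nonneg (hχ0 i _) (hB.density_pos ((extChartAt I (i : M)).map_target hz)).le) z
  let m : t → Measure M := fun i => Measure.map (extChartAt I (i : M)).symm
    ((ν.restrict (extChartAt I (i : M)).target).withDensity fun z => ENNReal.ofReal (r i z))
  have hm : ∀ i, IsFiniteMeasure (m i) := fun i => by
    have h1 : Integrable (r i) (ν.restrict (extChartAt I (i : M)).target) :=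
      ((hr i).1.integrable_of_hasCompactSupport (hr i).2).restrict
    have := isFiniteMeasure_withDensity_ofReal h1.2
    exact Measure.isFiniteMeasure_map _ _
  refine ⟨∑ i, m i, inferInstance, fun f hf => ?_⟩
  have hfi : ∀ i, Integrable f (m i) := fun i => by
    obtain ⟨C, hC⟩ := isCompact_univ.exists_bound_of_continuousOn hf.continuousOn
    exact Integrable.of_bound hf.aestronglyMeasurable C
      (Filter.Eventually.of_forall fun x => hC x (mem_univ x))
  rw [integral_finsetSum_measure fun i _ => hfi i]
  refine Finset.sum_congr rfl fun i _ => ?_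
  rw [integral_map (aemeasurable_extChartAt_symm ν _) hf.aestronglyMeasurable,
    integral_withDensity_eq_integral_toReal_smul
      ((hr i).1.measurable.ennreal_ofReal) (by simp)]
  have h0 : ∀ z ∉ (extChartAt I (i : M)).target,
      chartFun I (i : M) (fun x => χ i x * f x * density B i x) z = 0 :=
    fun z hz => indicator_of_notMem hz _
  rw [← setIntegral_eq_integral_of_forall_compl_eq_zero h0]
  refine setIntegral_congr_fun (isOpen_extChartAt_target _).measurableSet fun z hz => ?_
  rw [ENNReal.toReal_ofReal (hr0 i z)]
  simp only [r, chartFun, indicator_of_mem hz,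
    Function.comp_apply, smul_eq_mul]
  ring

omit [MeasurableSpace M] [BorelSpace M] in
theorem IsNondegenerateForm.integral_chartFun_sum (hB : IsNondegenerateForm B) {p : M}
    {ι : Type*} (s : Finset ι) {f : ι → M → ℝ} (hf : ∀ i, Continuous (f i))
    (hfp : ∀ i, tsupport (f i) ⊆ (extChartAt I p).source) :
    ∫ z, chartFun I p (fun x => (∑ i ∈ s, f i x) * density B p x) z ∂ν =
      ∑ i ∈ s, ∫ z, chartFun I p (fun x => f i x * density B p x) z ∂ν := by
  have h1 : ∀ i, Integrable (chartFun I p (fun x => f i x * density B p x)) ν := fun i =>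
    (hB.continuous_chartFun (hf i) (hfp i)).1.integrable_of_hasCompactSupport
      (hB.continuous_chartFun (hf i) (hfp i)).2
  rw [← integral_finsetSum _ fun i _ => h1 i]
  congr 1
  ext z
  by_cases hz : z ∈ (extChartAt I p).target
  · simp only [chartFun, indicator_of_mem hz, Function.comp_apply, Finset.sum_mul]
  · simp only [chartFun, indicator_of_notMem hz, Finset.sum_const_zero]

omit [MeasurableSpace E] [BorelSpace E] in
/-- A nondegenerate form on a compact manifold has a measure, which transforms by the Jacobian
determinant under diffeomorphisms and satisfies the divergence theorem. -/
theorem IsNondegenerateForm.exists_invariant_measure (hB : IsNondegenerateForm B) :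
    ∃ μ : Measure M, IsFiniteMeasure μ ∧
      (∀ f : M → ℝ, Continuous f → (∀ x, 0 ≤ f x) → ∫ x, f x ∂μ = 0 → ∀ x, f x = 0) ∧
      (∀ (ψ : Diffeomorph I I M M ∞) (Φ : ∀ x, TangentSpace I x →ₗ[ℝ] TangentSpace I x),
        (∀ x v w, B (ψ x) (mfderiv I I ψ x v) (mfderiv I I ψ x w) = B x (Φ x v) (Φ x w)) →
        Continuous (fun x => |LinearMap.det (Φ x)|) → ∀ f : M → ℝ, Continuous f →
          ∫ x, f (ψ x) * |LinearMap.det (Φ x)| ∂μ = ∫ x, f x ∂μ) ∧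
      ∀ D : CovariantDerivative I E (TangentSpace I : M → Type _), IsMetricConnection B D →
        ∀ X : ∀ x : M, TangentSpace I x, IsSmoothField I X →
        Continuous (fun x => LinearMap.trace ℝ (TangentSpace I x)
          (D X x : TangentSpace I x →ₗ[ℝ] TangentSpace I x)) →
        ∫ x, LinearMap.trace ℝ (TangentSpace I x)
          (D X x : TangentSpace I x →ₗ[ℝ] TangentSpace I x) ∂μ = 0 := by
  let _ : MeasurableSpace E := borel E
  have : BorelSpace E := ⟨rfl⟩
  have : ProperSpace E := FiniteDimensional.proper_real E
  let ν : Measure E := Measure.addHaar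
  obtain ⟨t, χ, hχ, hχs, hχ0, hχ1⟩ := exists_chart_partition I M
  obtain ⟨μ, hμ, hμf⟩ := hB.exists_measure ν hχ hχs hχ0
  have hint : ∀ f : M → ℝ, Continuous f → Integrable f μ := fun f hf => by
    obtain ⟨C, hC⟩ := isCompact_univ.exists_bound_of_continuousOn hf.continuousOn
    exact Integrable.of_bound hf.aestronglyMeasurable C
      (Filter.Eventually.of_forall fun x => hC x (mem_univ x))
  have hsub : ∀ (g : M → ℝ) (f : M → ℝ), tsupport (fun x => g x * f x) ⊆ tsupport g :=
    fun g f => tsupport_mul_subset_left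
  have hsub' : ∀ (g : M → ℝ) (f : M → ℝ), tsupport (fun x => g x * f x) ⊆ tsupport f :=
    fun g f => tsupport_mul_subset_right
  refine ⟨μ, hμ, fun f hf hf0 hfμ x => ?_, fun ψ Φ hΦ hw f hf => ?_, fun D hD X hX hXc => ?_⟩
  · rw [hμf f hf] at hfμ
    have h0 : ∀ (i : t) z, 0 ≤ chartFun I (i : M) (fun x => χ i x * f x * density B i x) z :=
      fun i z => indicator_nonneg (fun z hz => mul_nonneg (mul_nonneg (hχ0 i _) (hf0 _))
        (hB.density_pos ((extChartAt I (i : M)).map_target hz)).le) z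
    have h1 := (Finset.sum_eq_zero_iff_of_nonneg fun i _ => integral_nonneg (h0 i)).1 hfμ
    have h2 : ∀ i : t, χ i x * f x = 0 := by
      intro i
      by_cases hx : x ∈ (extChartAt I (i : M)).source
      · have h3 := hB.continuous_chartFun (p := (i : M)) ((hχ i).continuous.mul hf)
          ((hsub (χ i) f).trans (hχs i))
        have h4 := (integral_eq_zero_iff_of_nonneg (h0 i)
          (h3.1.integrable_of_hasCompactSupport h3.2)).1 (h1 i (Finset.mem_univ i))
        have h5 := congrFun (h3.1.ae_eq_iff_eq ν continuous_zero |>.1 h4) (extChartAt I (i : M) x)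
        rw [chartFun_extChartAt hx] at h5
        exact (mul_eq_zero.1 h5).resolve_right (hB.density_pos hx).ne'
      · rw [image_eq_zero_of_notMem_tsupport fun h => hx (hχs i h), zero_mul]
    rw [← one_mul (f x), ← hχ1 x, Finset.sum_mul]
    exact Finset.sum_eq_zero fun i _ => h2 i
  · have hψc := ψ.continuous
    rw [hμf _ hf, hμf (fun x => f (ψ x) * |LinearMap.det (Φ x)|) ((hf.comp hψc).mul hw)]
    have h1 : ∀ j : t, ∫ z, chartFun I (j : M) (fun x => χ j x * f x * density B j x) z ∂ν =
        ∑ i : t, ∫ z, chartFun I (j : M)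
          (fun x => (χ i (ψ.symm x) * (χ j x * f x)) * density B j x) z ∂ν := fun j => by
      rw [← hB.integral_chartFun_sum ν Finset.univ
        (f := fun i x => χ i (ψ.symm x) * (χ j x * f x)) (fun i => ((hχ i).continuous.comp ψ.symm.continuous).mul ((hχ j).continuous.mul hf))
        fun i => ((hsub' (fun x => χ i (ψ.symm x)) _).trans (hsub _ _)).trans (hχs j)]
      simp only [← Finset.sum_mul, hχ1, one_mul]
    have h2 : ∀ i : t, ∫ z, chartFun I (i : M)
        (fun x => χ i x * (f (ψ x) * |LinearMap.det (Φ x)|) * density B i x) z ∂ν =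
        ∑ j : t, ∫ z, chartFun I (i : M) (fun x =>
          (χ i x * (χ j (ψ x) * (f (ψ x) * |LinearMap.det (Φ x)|))) * density B i x) z ∂ν :=
      fun i => by
        rw [← hB.integral_chartFun_sum ν Finset.univ
          (f := fun j x => χ i x * (χ j (ψ x) * (f (ψ x) * |LinearMap.det (Φ x)|)))
          (fun j => (hχ i).continuous.mul (((hχ j).continuous.comp hψc).mul
            ((hf.comp hψc).mul hw))) fun j => (hsub _ _).trans (hχs i)]
        simp only [← Finset.mul_sum, ← Finset.sum_mul, hχ1, one_mul]
    simp only [h1, h2]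
    rw [Finset.sum_comm]
    refine Finset.sum_congr rfl fun j _ => Finset.sum_congr rfl fun i _ => ?_
    have h3 : tsupport (fun x => χ i (ψ.symm (ψ x)) * (χ j (ψ x) * f (ψ x))) ⊆
        (extChartAt I (i : M)).source := by
      simp only [ψ.symm_apply_apply]
      exact (hsub _ _).trans (hχs i)
    rw [← integral_chartFun_comp ψ (ν := ν) hΦ
      (((hsub' (fun x => χ i (ψ.symm x)) _).trans (hsub _ _)).trans (hχs j)) h3]
    simp only [ψ.symm_apply_apply, mul_assoc]
  · have h1 : ∀ (q : M) (f : M → ℝ), Continuous f → tsupport f ⊆ (extChartAt I q).source →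
        ∫ x, f x ∂μ = ∫ z, chartFun I q (fun x => f x * density B q x) z ∂ν := by
      intro q f hf hfq
      have h2 := hB.integral_chartFun_sum ν Finset.univ
        (f := fun i x => χ i x * f x) (fun i => (hχ i).continuous.mul hf) fun i => (hsub' (χ i) f).trans hfq
      simp only [← Finset.sum_mul, hχ1, one_mul] at h2
      rw [hμf f hf, h2]
      refine Finset.sum_congr rfl fun i _ => ?_
      rw [← integral_chartFun_comp (Diffeomorph.refl I M ∞) (Φ := fun _ => LinearMap.id) (ν := ν)
        (f := fun x => χ i x * f x) (p := i) (q := q) (fun x v w => ?_)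
        ((hsub' (χ i) f).trans hfq) ((hsub (χ i) f).trans (hχs i))]
      · simp
      · have h3 : mfderiv I I (Diffeomorph.refl I M ∞) x = ContinuousLinearMap.id ℝ _ := mfderiv_id
        rw [h3]
        rfl
    let F : t → M → ℝ := fun i x => LinearMap.trace ℝ (TangentSpace I x)
      (D (χ i • X) x : TangentSpace I x →ₗ[ℝ] TangentSpace I x)
    have hF : ∀ i x, F i x = χ i x * LinearMap.trace ℝ (TangentSpace I x)
        (D X x : TangentSpace I x →ₗ[ℝ] TangentSpace I x) + mvfderiv I (χ i) x (X x) := by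
      intro i x
      simp only [F]
      rw [D.isCovariantDerivativeOn.leibniz (hX.mdifferentiableAt x)
        ((hχ i).mdifferentiable (by simp) x) (mem_univ _), ContinuousLinearMap.toLinearMap_add,
        map_add, ContinuousLinearMap.toLinearMap_smul, map_smul]
      congr 1
      have : Module.Finite ℝ (TangentSpace I x) := inferInstanceAs (Module.Finite ℝ E)
      exact LinearMap.trace_smulRight _ _
    have hFc : ∀ i, Continuous (F i) := fun i => by
      have h2 : F i = fun x => _ := funext (hF i)
      rw [h2]
      exact ((hχ i).continuous.mul hXc).add (contMDiff_mvfderiv_apply (hχ i) hX).continuous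
    have hFs : ∀ i, tsupport (F i) ⊆ (extChartAt I (i : M)).source := fun i => by
      refine (closure_minimal (fun x hx => ?_) (isClosed_tsupport _)).trans (hχs i)
      by_contra h2
      have h3 : χ i =ᶠ[𝓝 x] fun _ => 0 := by
        filter_upwards [(isClosed_tsupport (χ i)).isOpen_compl.mem_nhds h2] with y hy
        exact image_eq_zero_of_notMem_tsupport hy
      refine hx ?_
      rw [hF, mvfderiv_congr h3, h3.self_of_nhds, zero_mul, zero_add]
      simp [mvfderiv, mfderiv_const]
    have h2 : ∀ x, LinearMap.trace ℝ (TangentSpace I x)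
        (D X x : TangentSpace I x →ₗ[ℝ] TangentSpace I x) = ∑ i, F i x := by
      intro x
      have e : ∑ i, χ i • X = X := by
        ext1 x
        have e1 : (∑ i, χ i • X) x = ∑ i, (χ i • X) x := Finset.sum_apply _ _ _
        have e2 : ∑ i, (χ i • X) x = (∑ i, χ i x) • X x := (Finset.sum_smul ..).symm
        exact e1.trans (e2.trans (by rw [hχ1]; exact one_smul ℝ (X x)))
      have h3 := (covariantDerivative_sum_smul D Finset.univ (Y := fun _ => X) hχ (fun _ => hX) x).2
      rw [e] at h3
      rw [h3, ContinuousLinearMap.toLinearMap_sum, map_sum]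
      refine Finset.sum_congr rfl fun i _ => ?_
      simp only [F]
      rw [D.isCovariantDerivativeOn.leibniz (hX.mdifferentiableAt x)
        ((hχ i).mdifferentiable (by simp) x) (mem_univ _)]
    simp only [h2]
    rw [integral_finsetSum _ fun i _ => hint _ (hFc i)]
    refine Finset.sum_eq_zero fun i _ => ?_
    rw [h1 i _ (hFc i) (hFs i)]
    exact integral_trace_mul_density hB hD (hX.smul (hχ i)) (hχs i) fun x hx => by
      rw [Pi.smul_apply', hx]
      exact zero_smul ℝ _

end Measure

end CRGeometry

end


noncomputable section

namespace CRGeometry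

section CR

variable {n : ℕ} {M : Type*} [TopologicalSpace M]
  [ChartedSpace (EuclideanSpace ℝ (Fin (2 * n + 1))) M] [IsManifold (𝓡 (2 * n + 1)) ∞ M]

namespace CRStructure

open AlmostCRStructure

variable {S : CRStructure n M} {θ : OneForm (𝓡 (2 * n + 1)) (M := M)}

/-- The nondegenerate form `θ ⊗ θ + dθ` of a contact form `θ`. -/
def IsPseudohermitian.contactForm (hθ : S.IsPseudohermitian θ) (x : M) :
    LinearMap.BilinForm ℝ (TangentSpace (𝓡 (2 * n + 1)) x) :=
  LinearMap.mk₂ ℝ (fun v w => θ x v * θ x w + exteriorD (𝓡 (2 * n + 1)) θ x v w)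
    (fun v v' w => by
      simp only [← exteriorDHom_apply hθ.smooth, map_add, add_apply]; ring)
    (fun c v w => by
      simp only [← exteriorDHom_apply hθ.smooth, map_smul, smul_apply, smul_eq_mul]; ring)
    (fun v w w' => by
      simp only [← exteriorDHom_apply hθ.smooth, map_add]; ring)
    (fun c v w => by
      simp only [← exteriorDHom_apply hθ.smooth, map_smul, smul_eq_mul]; ring)

theorem IsPseudohermitian.contactForm_apply (hθ : S.IsPseudohermitian θ) (x : M)
    (v w : TangentSpace (𝓡 (2 * n + 1)) x) :
    hθ.contactForm x v w = θ x v * θ x w + exteriorD (𝓡 (2 * n + 1)) θ x v w := rfl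

theorem IsPseudohermitian.isNondegenerateForm (hθ : S.IsPseudohermitian θ) :
    IsNondegenerateForm (I := 𝓡 (2 * n + 1)) hθ.contactForm where
  contMDiff X Y hX hY := ((hθ.smooth.contMDiff_apply hX).mul (hθ.smooth.contMDiff_apply hY)).add
    (hθ.smooth.contMDiff_exteriorD hX hY)
  eq_zero x v hv := by
    have h1 := hv v
    have h2 := exteriorD_swap (I := 𝓡 (2 * n + 1)) θ x v v
    rw [hθ.contactForm_apply, self_eq_neg.1 h2, add_zero, mul_self_eq_zero, hθ.ker_eq] at h1
    have h3 := hv (S.J x ⟨v, h1⟩)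
    rw [hθ.contactForm_apply, (hθ.ker_eq x _).2 (S.J x ⟨v, h1⟩).2, mul_zero, zero_add] at h3
    by_contra h0
    exact (hθ.levi_pos x ⟨v, h1⟩ fun h => h0 (congrArg Subtype.val h)).ne' h3

variable {T : ∀ x : M, TangentSpace (𝓡 (2 * n + 1)) x}

/-- The projection of tangent vectors to `H` along the Reeb field. -/
def horizontalProj (hθ : S.IsPseudohermitian θ) (hT : IsReebField θ T) (x : M) :
    TangentSpace (𝓡 (2 * n + 1)) x →ₗ[ℝ] S.H x :=
  (LinearMap.id - (θ x : TangentSpace (𝓡 (2 * n + 1)) x →ₗ[ℝ] ℝ).smulRight (T x)).codRestrict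
    (S.H x) fun v => (hθ.ker_eq x _).1 (by simp [hT.apply_eq_one])

section Projection

variable (hθ : S.IsPseudohermitian θ) (hT : IsReebField θ T)

theorem coe_horizontalProj (x : M) (v : TangentSpace (𝓡 (2 * n + 1)) x) :
    (horizontalProj hθ hT x v : TangentSpace (𝓡 (2 * n + 1)) x) = v - θ x v • T x := rfl

theorem horizontalProj_coe (x : M) (v : S.H x) : horizontalProj hθ hT x v = v := by
  apply Subtype.ext
  rw [coe_horizontalProj, (hθ.ker_eq x v).2 v.2, zero_smul, sub_zero]

theorem eq_smul_reeb_add (x : M) (v : TangentSpace (𝓡 (2 * n + 1)) x) :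
    v = θ x v • T x + (horizontalProj hθ hT x v : TangentSpace (𝓡 (2 * n + 1)) x) := by
  rw [coe_horizontalProj]
  abel

theorem exteriorD_horizontalProj (x : M) (v w : TangentSpace (𝓡 (2 * n + 1)) x) :
    exteriorD (𝓡 (2 * n + 1)) θ x (horizontalProj hθ hT x v) (horizontalProj hθ hT x w) =
      exteriorD (𝓡 (2 * n + 1)) θ x v w := by
  have h1 : ∀ v w : TangentSpace (𝓡 (2 * n + 1)) x, exteriorDHom hθ.smooth x (v - θ x v • T x) w =
      exteriorDHom hθ.smooth x v w := by
    intro v w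
    rw [map_sub, map_smul, sub_apply, smul_apply, exteriorDHom_apply hθ.smooth x (T x),
      hT.exteriorD_eq_zero, smul_zero, sub_zero]
  rw [coe_horizontalProj, coe_horizontalProj]
  simp only [← exteriorDHom_apply hθ.smooth]
  rw [h1, exteriorDHom_apply, exteriorD_swap, ← exteriorDHom_apply hθ.smooth, h1,
    exteriorDHom_apply, exteriorDHom_apply, ← exteriorD_swap]

/-- The horizontal part of a vector field. -/
def horizontalPart {X : ∀ x : M, TangentSpace (𝓡 (2 * n + 1)) x}
    (hX : IsSmoothField (𝓡 (2 * n + 1)) X) : S.HorizontalField :=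
  ⟨fun x => horizontalProj hθ hT x (X x), hX.sub (hT.smooth.smul (hθ.smooth.contMDiff_apply hX))⟩

end Projection

namespace IsTanakaWebster

variable {D : CovariantDerivative (𝓡 (2 * n + 1)) (EuclideanSpace ℝ (Fin (2 * n + 1)))
    (TangentSpace (𝓡 (2 * n + 1)) : M → Type _)}
  (hD : S.IsTanakaWebster θ T D) (hθ : S.IsPseudohermitian θ) (hT : IsReebField θ T)

include hD in
theorem apply_eq {X : ∀ x : M, TangentSpace (𝓡 (2 * n + 1)) x}
    (hX : IsSmoothField (𝓡 (2 * n + 1)) X) (x : M) (v : TangentSpace (𝓡 (2 * n + 1)) x) :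
    D X x v = mvfderiv (𝓡 (2 * n + 1)) (fun y => θ y (X y)) x v • T x +
      (hD.nabla (horizontalPart hθ hT hX) x v : TangentSpace (𝓡 (2 * n + 1)) x) := by
  have hf := hθ.smooth.contMDiff_apply hX
  have e : X = (fun y => θ y (X y)) • T + (horizontalPart hθ hT hX).field :=
    funext fun y => eq_smul_reeb_add hθ hT y (X y)
  have h1 := D.isCovariantDerivativeOn.add ((hT.smooth.smul hf).mdifferentiableAt x)
    ((horizontalPart hθ hT hX).smooth_field.mdifferentiableAt x) (mem_univ x)
  rw [← e, D.isCovariantDerivativeOn.leibniz (hT.smooth.mdifferentiableAt x)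
    (hf.mdifferentiable (by simp) x) (mem_univ x)] at h1
  have h2 := congrArg (fun L => L v) h1
  refine h2.trans ?_
  change θ x (X x) • D T x v + mvfderiv (𝓡 (2 * n + 1)) (fun y => θ y (X y)) x v • T x + _ = _
  rw [hD.parallel_reeb, smul_zero, zero_add]
  rfl

include hD hθ in
theorem mvfderiv_exteriorD (X Y : S.HorizontalField) (x : M)
    (v : TangentSpace (𝓡 (2 * n + 1)) x) :
    mvfderiv (𝓡 (2 * n + 1)) (fun y => exteriorD (𝓡 (2 * n + 1)) θ y (X.val y) (Y.val y)) x v =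
      exteriorD (𝓡 (2 * n + 1)) θ x (hD.nabla X x v) (Y.val x) +
        exteriorD (𝓡 (2 * n + 1)) θ x (X.val x) (hD.nabla Y x v) := by
  simp only [hθ.exteriorD_eq_levi, ← X.J_val]
  rw [hD.mvfderiv_levi hθ, hD.nabla_J]

theorem trace_eq_horizontalDiv (X : S.HorizontalField) (x : M) :
    LinearMap.trace ℝ (TangentSpace (𝓡 (2 * n + 1)) x) (D X.field x :
      TangentSpace (𝓡 (2 * n + 1)) x →ₗ[ℝ] TangentSpace (𝓡 (2 * n + 1)) x) =
      hD.horizontalDiv X x := by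
  have e : (D X.field x : TangentSpace (𝓡 (2 * n + 1)) x →ₗ[ℝ] TangentSpace (𝓡 (2 * n + 1)) x) =
    (S.H x).subtype ∘ₗ hD.nabla X x := rfl
  rw [e, LinearMap.trace_comp_comm', horizontalDiv]

/-- The pseudohermitian torsion as a linear map. -/
def reebTorsionHom (x : M) : S.H x →ₗ[ℝ] S.H x :=
  ((D.torsion x (T x)).toLinearMap ∘ₗ (S.H x).subtype).codRestrict (S.H x)
    fun v => (hD.torsion_reeb x v).choose

theorem trace_reebTorsionHom (x : M) : LinearMap.trace ℝ (S.H x) (hD.reebTorsionHom x) = 0 := by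
  have h1 : hD.reebTorsionHom x = -((hD.reebTorsionHom x ∘ₗ S.J x) ∘ₗ S.J x) := by
    ext v
    simp [S.J_J]
  have h2 : hD.reebTorsionHom x = (S.J x ∘ₗ hD.reebTorsionHom x) ∘ₗ S.J x := by
    ext1 v
    have h3 := hD.reebTorsion_J x (S.J x v)
    rw [S.J_J] at h3
    have h4 : hD.reebTorsionHom x (-v) = -S.J x (hD.reebTorsionHom x (S.J x v)) := h3
    rw [map_neg, neg_inj] at h4
    exact h4
  have h3 := congrArg (LinearMap.trace ℝ (S.H x)) h1
  have h4 := congrArg (LinearMap.trace ℝ (S.H x)) h2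
  rw [map_neg, LinearMap.trace_comp_comm', ← LinearMap.comp_assoc] at h3
  linarith

theorem torsion_reeb_eq (x : M) :
    (D.torsion x (T x) : TangentSpace (𝓡 (2 * n + 1)) x →ₗ[ℝ] TangentSpace (𝓡 (2 * n + 1)) x) =
      (S.H x).subtype ∘ₗ (hD.reebTorsionHom x ∘ₗ horizontalProj hθ hT x) := by
  ext1 v
  change D.torsion x (T x) v = D.torsion x (T x) (horizontalProj hθ hT x v)
  rw [coe_horizontalProj, map_sub, map_smul]
  have h : D.torsion x (T x) (T x) = 0 := D.isCovariantDerivativeOn.torsion_self (T x)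
  rw [h, smul_zero, sub_zero]

include hT in
theorem torsion_horizontal_eq (x : M) (w : S.H x) :
    (D.torsion x w : TangentSpace (𝓡 (2 * n + 1)) x →ₗ[ℝ] TangentSpace (𝓡 (2 * n + 1)) x) =
      (exteriorDHom hθ.smooth x w : TangentSpace (𝓡 (2 * n + 1)) x →ₗ[ℝ] ℝ).smulRight (T x) -
      (θ x : TangentSpace (𝓡 (2 * n + 1)) x →ₗ[ℝ] ℝ).smulRight
        (hD.reebTorsionHom x w : TangentSpace (𝓡 (2 * n + 1)) x) := by
  ext1 v
  change D.torsion x w v = exteriorD (𝓡 (2 * n + 1)) θ x w v • T x - θ x v • D.torsion x (T x) w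
  have h : D.torsion x (T x) w = -D.torsion x w (T x) :=
    D.isCovariantDerivativeOn.torsion_antisymm _ _
  nth_rw 1 [eq_smul_reeb_add hθ hT x v]
  rw [map_add, map_smul, hD.torsion_horizontal, h, ← exteriorD_horizontalProj hθ hT x w v,
    horizontalProj_coe]
  module

include hD hθ hT in
theorem isMetricConnection : IsMetricConnection hθ.contactForm D where
  parallel X Y hX hY x v := by
    have hXf := hθ.smooth.contMDiff_apply hX
    have hYf := hθ.smooth.contMDiff_apply hY
    have e : (fun y => hθ.contactForm y (X y) (Y y)) = fun y => θ y (X y) * θ y (Y y) +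
        exteriorD (𝓡 (2 * n + 1)) θ y ((horizontalPart hθ hT hX).val y)
          ((horizontalPart hθ hT hY).val y) :=
      funext fun y => by
        rw [hθ.contactForm_apply, ← exteriorD_horizontalProj hθ hT]
        rfl
    have hθD : ∀ {X : ∀ x : M, TangentSpace (𝓡 (2 * n + 1)) x}
        (hX : IsSmoothField (𝓡 (2 * n + 1)) X),
        θ x (D X x v) = mvfderiv (𝓡 (2 * n + 1)) (fun y => θ y (X y)) x v := fun hX => by
      rw [hD.apply_eq hθ hT hX, map_add, map_smul, hT.apply_eq_one,
        (hθ.ker_eq x _).2 (hD.nabla _ x v).2]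
      simp
    have hpD : ∀ {X : ∀ x : M, TangentSpace (𝓡 (2 * n + 1)) x}
        (hX : IsSmoothField (𝓡 (2 * n + 1)) X),
        horizontalProj hθ hT x (D X x v) = hD.nabla (horizontalPart hθ hT hX) x v := fun hX => by
      apply Subtype.ext
      rw [coe_horizontalProj, hθD hX]
      nth_rw 1 [hD.apply_eq hθ hT hX]
      abel
    have hs : ContMDiff (𝓡 (2 * n + 1)) 𝓘(ℝ, ℝ) ∞ (fun y => exteriorD (𝓡 (2 * n + 1)) θ y
        ((horizontalPart hθ hT hX).val y) ((horizontalPart hθ hT hY).val y)) :=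
      hθ.smooth.contMDiff_exteriorD (horizontalPart hθ hT hX).smooth
        (horizontalPart hθ hT hY).smooth
    have hm : ContMDiff (𝓡 (2 * n + 1)) 𝓘(ℝ, ℝ) ∞ (fun y => θ y (X y) * θ y (Y y)) := hXf.mul hYf
    rw [e, mvfderiv_fun_add (hm.mdifferentiable (by simp) x)
      (hs.mdifferentiable (by simp) x), mvfderiv_fun_mul (hXf.mdifferentiable (by simp) x)
      (hYf.mdifferentiable (by simp) x), add_apply, hD.mvfderiv_exteriorD hθ,
      hθ.contactForm_apply, hθ.contactForm_apply, ← exteriorD_horizontalProj hθ hT x (D X x v),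
      ← exteriorD_horizontalProj hθ hT x (X x), hpD hX, hpD hY, hθD hX, hθD hY]
    simp only [add_apply, smul_apply, smul_eq_mul]
    change _ + _ + (exteriorD _ θ x _ (horizontalProj hθ hT x (Y x)) +
      exteriorD _ θ x (horizontalProj hθ hT x (X x)) _) = _
    ring
  trace_torsion x w := by
    rw [eq_smul_reeb_add hθ hT x w, map_add, map_smul, ContinuousLinearMap.toLinearMap_add, map_add,
      ContinuousLinearMap.toLinearMap_smul, map_smul, hD.torsion_reeb_eq hθ hT,
      LinearMap.trace_comp_comm', LinearMap.comp_assoc]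
    have h1 : horizontalProj hθ hT x ∘ₗ (S.H x).subtype = LinearMap.id :=
      LinearMap.ext fun v => horizontalProj_coe hθ hT x v
    rw [h1, LinearMap.comp_id, hD.trace_reebTorsionHom, smul_zero, zero_add,
      hD.torsion_horizontal_eq hθ hT, map_sub, LinearMap.trace_smulRight,
      LinearMap.trace_smulRight]
    change exteriorD (𝓡 (2 * n + 1)) θ x _ (T x) - θ x (hD.reebTorsionHom x _) = 0
    rw [exteriorD_swap, hT.exteriorD_eq_zero, (hθ.ker_eq x _).2 (hD.reebTorsionHom x _).2]
    simp

end IsTanakaWebster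

namespace ConformalPair

variable {θ' : OneForm (𝓡 (2 * n + 1)) (M := M)}
  {T' : ∀ x : M, TangentSpace (𝓡 (2 * n + 1)) x}
  {D D' : CovariantDerivative (𝓡 (2 * n + 1)) (EuclideanSpace ℝ (Fin (2 * n + 1)))
    (TangentSpace (𝓡 (2 * n + 1)) : M → Type _)} {u : M → ℝ}
  (h : S.ConformalPair θ θ' T T' D D' u)

/-- The endomorphism that relates the contact forms of a conformal pair. -/
def contactMap (_ : S.ConformalPair θ θ' T T' D D' u) (x : M) :
    TangentSpace (𝓡 (2 * n + 1)) x →ₗ[ℝ] TangentSpace (𝓡 (2 * n + 1)) x :=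
  √(u x) • LinearMap.transvection (θ' x : TangentSpace (𝓡 (2 * n + 1)) x →ₗ[ℝ] ℝ)
    ((√(u x))⁻¹ • (T x - √(u x) • T' x))

theorem contactMap_apply (x : M) (v : TangentSpace (𝓡 (2 * n + 1)) x) : h.contactMap x v =
    θ' x v • T x + √(u x) • (horizontalProj h.pseudohermitian' h.reeb' x v :
      TangentSpace (𝓡 (2 * n + 1)) x) := by
  have h0 : √(u x) ≠ 0 := (Real.sqrt_pos.2 (h.pos x)).ne'
  change √(u x) • (v + θ' x v • ((√(u x))⁻¹ • (T x - √(u x) • T' x))) = _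
  rw [coe_horizontalProj, smul_add, smul_comm (θ' x v), smul_inv_smul₀ h0]
  module

theorem det_contactMap (x : M) : LinearMap.det (h.contactMap x) = u x ^ (n + 1) := by
  have h0 : 0 < √(u x) := Real.sqrt_pos.2 (h.pos x)
  have h1 : Module.finrank ℝ (TangentSpace (𝓡 (2 * n + 1)) x) = 2 * n + 1 :=
    finrank_euclideanSpace_fin
  have h2 : θ' x (T x) = u x := by rw [h.apply_eq, h.reeb.apply_eq_one, mul_one]
  rw [contactMap, LinearMap.det_smul, LinearMap.transvection.det, h1]
  change _ * (1 + θ' x _) = _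
  rw [map_smul, map_sub, map_smul, h2, h.reeb'.apply_eq_one, smul_eq_mul, smul_eq_mul, mul_one]
  have h3 : u x = √(u x) ^ 2 := (Real.sq_sqrt (h.pos x).le).symm
  generalize √(u x) = s at *
  rw [h3]
  field_simp
  ring

theorem contactForm_eq (x : M) (v w : TangentSpace (𝓡 (2 * n + 1)) x) :
    h.pseudohermitian'.contactForm x v w =
      h.pseudohermitian.contactForm x (h.contactMap x v) (h.contactMap x w) := by
  have h1 : ∀ v, θ x (h.contactMap x v) = θ' x v := fun v => by
    rw [contactMap_apply, map_add, map_smul, map_smul, h.reeb.apply_eq_one,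
      (h.pseudohermitian.ker_eq x _).2 (horizontalProj h.pseudohermitian' h.reeb' x v).2]
    simp
  have h2 : ∀ v, horizontalProj h.pseudohermitian h.reeb x (h.contactMap x v) =
      √(u x) • horizontalProj h.pseudohermitian' h.reeb' x v := fun v => by
    apply Subtype.ext
    rw [coe_horizontalProj, h1, contactMap_apply, Submodule.coe_smul]
    abel
  rw [IsPseudohermitian.contactForm_apply, IsPseudohermitian.contactForm_apply, h1, h1,
    ← exteriorD_horizontalProj h.pseudohermitian h.reeb,
    ← exteriorD_horizontalProj h.pseudohermitian' h.reeb', h2, h2, h.exteriorD_eq]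
  simp only [← exteriorDHom_apply h.pseudohermitian.smooth, Submodule.coe_smul, map_smul,
    smul_apply, smul_eq_mul]
  rw [← mul_assoc √(u x), Real.mul_self_sqrt (h.pos x).le]

end ConformalPair

end CRStructure

end CR

end CRGeometry

end


noncomputable section

namespace CRGeometry

section Rigidity

open MeasureTheory

theorem eq_of_pow_le_bernoulli {n : ℕ} (hn : 1 ≤ n) {a s : ℝ} (ha : 0 < a) (hs : 0 < s)
    (h : a ^ (n + 1) - s ^ (n + 1) - (n + 1) * s ^ n * (a - s) ≤ 0) : a = s := by
  by_contra hne
  have h1 : a / s - 1 ≠ 0 := fun h0 => hne (by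
    rw [sub_eq_zero, div_eq_one_iff_eq hs.ne'] at h0
    exact h0)
  have h2 := one_add_mul_self_lt_rpow_one_add (s := a / s - 1) (p := (n + 1 : ℕ))
    (by linarith [div_pos ha hs]) h1 (by exact_mod_cast Nat.lt_succ_of_le hn)
  rw [Real.rpow_natCast, add_sub_cancel, div_pow] at h2
  have h3 := mul_lt_mul_of_pos_right h2 (pow_pos hs (n + 1))
  rw [div_mul_cancel₀ _ (pow_pos hs _).ne'] at h3
  have h4 : (1 + ((n + 1 : ℕ) : ℝ) * (a / s - 1)) * s ^ (n + 1) =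
      s ^ (n + 1) + (n + 1) * s ^ n * (a - s) := by
    push_cast
    field_simp
    ring
  linarith

theorem pow_sub_bernoulli_nonneg (n : ℕ) {a s : ℝ} (ha : 0 < a) (hs : 0 < s) :
    0 ≤ a ^ (n + 1) - s ^ (n + 1) - (n + 1) * s ^ n * (a - s) := by
  have h2 := one_add_mul_le_pow (a := a / s - 1) (by linarith [div_pos ha hs]) (n + 1)
  rw [add_sub_cancel, div_pow] at h2
  have h3 := mul_le_mul_of_nonneg_right h2 (pow_pos hs (n + 1)).le
  rw [div_mul_cancel₀ _ (pow_pos hs _).ne'] at h3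
  have h4 : (1 + ((n + 1 : ℕ) : ℝ) * (a / s - 1)) * s ^ (n + 1) =
      s ^ (n + 1) + (n + 1) * s ^ n * (a - s) := by
    push_cast
    field_simp
    ring
  linarith

variable {M : Type*} [TopologicalSpace M] [CompactSpace M] [MeasurableSpace M] [BorelSpace M]
  {μ : Measure M} [IsFiniteMeasure μ]

theorem integrable_of_continuous {f : M → ℝ} (hf : Continuous f) : Integrable f μ := by
  obtain ⟨C, hC⟩ := isCompact_univ.exists_bound_of_continuousOn hf.continuousOn
  exact Integrable.of_bound hf.aestronglyMeasurable C
    (Filter.Eventually.of_forall fun x => hC x (mem_univ x))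

variable {u R : ℝ → M → ℝ} {t : ℝ}

omit [CompactSpace M] [MeasurableSpace M] [BorelSpace M] in
theorem continuous_of_continuousOn_prod {I : Set ℝ}
    (hu : ContinuousOn (fun p : ℝ × M => u p.1 p.2) (I ×ˢ univ)) {s : ℝ} (hs : s ∈ I) :
    Continuous (u s) :=
  continuousOn_univ.1 (hu.comp (f := fun x => (s, x)) (by fun_prop) fun x _ => ⟨hs, mem_univ x⟩)

theorem continuousOn_integral_pow (hu : ContinuousOn (fun p : ℝ × M => u p.1 p.2)
    (Icc 0 t ×ˢ univ)) : ContinuousOn (fun s => ∫ x, u s x ∂μ) (Icc 0 t) := by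
  obtain ⟨C, hC⟩ := (isCompact_Icc.prod isCompact_univ).exists_bound_of_continuousOn hu
  refine continuousOn_of_dominated (bound := fun _ => C)
    (fun s hs => (continuous_of_continuousOn_prod hu hs).aestronglyMeasurable)
    (fun s hs => Filter.Eventually.of_forall fun x => hC (s, x) ⟨hs, mem_univ x⟩)
    (integrable_const C) (Filter.Eventually.of_forall fun x => ?_)
  exact hu.comp (f := fun s => (s, x)) (by fun_prop) fun s hs => ⟨hs, mem_univ x⟩

theorem hasDerivAt_integral_pow (k : ℕ)
    (hu : ContinuousOn (fun p : ℝ × M => u p.1 p.2) (Icc 0 t ×ˢ univ))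
    (hR : ∀ s ∈ Ioo 0 t, Continuous (R s)) {C : ℝ} (hRC : ∀ s ∈ Ioo 0 t, ∀ x, |R s x| ≤ C)
    (hd : ∀ s ∈ Ioo 0 t, ∀ x, HasDerivAt (fun r => u r x) (-(R s x * u s x)) s)
    {s : ℝ} (hs : s ∈ Ioo 0 t) :
    HasDerivAt (fun r => ∫ x, u r x ^ k ∂μ) (-(k * ∫ x, R s x * u s x ^ k ∂μ)) s := by
  obtain ⟨C', hC'⟩ := (isCompact_Icc.prod isCompact_univ).exists_bound_of_continuousOn hu
  have hIo : Ioo 0 t ⊆ Icc 0 t := Ioo_subset_Icc_self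
  have hF : ∀ r ∈ Ioo 0 t, Continuous fun x => u r x ^ k := fun r hr =>
    (continuous_of_continuousOn_prod hu (hIo hr)).pow k
  have h1 := hasDerivAt_integral_of_dominated_loc_of_deriv_le (μ := μ) (s := Ioo 0 t) (x₀ := s)
    (F := fun r x => u r x ^ k) (F' := fun r x => -(k * (R r x * u r x ^ k)))
    (bound := fun _ => k * (C * C' ^ k)) (isOpen_Ioo.mem_nhds hs)
    (Filter.eventually_of_mem (isOpen_Ioo.mem_nhds hs) fun r hr => (hF r hr).aestronglyMeasurable)
    (integrable_of_continuous (hF s hs))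
    (continuous_const.mul ((hR s hs).mul (hF s hs))).neg.aestronglyMeasurable
    (Filter.Eventually.of_forall fun x r hr => by
      have h2 := hRC r hr x
      have h3 : |u r x| ≤ C' := hC' (r, x) ⟨hIo hr, mem_univ x⟩
      rw [Real.norm_eq_abs, abs_neg, abs_mul, abs_mul, Nat.abs_cast, abs_pow]
      gcongr
      exact (abs_nonneg _).trans h2)
    (integrable_const _)
    (Filter.Eventually.of_forall fun x r hr => by
      refine ((hd r hr x).pow k).congr_deriv ?_
      rcases k with _ | k
      · simp
      · simp only [Nat.add_sub_cancel, pow_succ]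
        ring)
  refine h1.2.congr_deriv ?_
  rw [integral_neg, integral_const_mul]

/-- A self-similar solution of `∂u/∂t = -Ru` with conserved quantities of Yamabe type does not
depend on the space variable. -/
theorem eq_of_selfSimilar {n : ℕ} (hn : 1 ≤ n) {σ : ℝ → ℝ} {ρ : M → ℝ} {ψ : ℝ → M → M}
    (hfaithful : ∀ f : M → ℝ, Continuous f → (∀ x, 0 ≤ f x) → ∫ x, f x ∂μ = 0 → ∀ x, f x = 0)
    (ht : 0 ≤ t) (hu : ContinuousOn (fun p : ℝ × M => u p.1 p.2) (Icc 0 t ×ˢ univ))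
    (hu0 : ∀ s ∈ Icc 0 t, ∀ x, 0 < u s x) (hu1 : ∀ x, u 0 x = 1)
    (hσ : ContinuousOn σ (Icc 0 t)) (hσ' : ∀ s ∈ Ioo 0 t, DifferentiableAt ℝ σ s)
    (hσ0 : ∀ s ∈ Icc 0 t, 0 < σ s) (hσ1 : σ 0 = 1)
    (hρ : Continuous ρ) (hψ : ∀ s ∈ Icc 0 t, Continuous (ψ s))
    (hd : ∀ s ∈ Ioo 0 t, ∀ x, HasDerivAt (fun r => u r x) (-(R s x * u s x)) s)
    (hR : ∀ s ∈ Icc 0 t, ∀ x, σ s * R s x = ρ (ψ s x))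
    (hvol : ∀ s ∈ Icc 0 t, ∀ f : M → ℝ, Continuous f →
      ∫ x, f (ψ s x) * (u s x / σ s) ^ (n + 1) ∂μ = ∫ x, f x ∂μ)
    (hdiv : ∀ s ∈ Ioo 0 t, ∫ x, R s x * u s x ∂μ ≤ ∫ x, ρ x ∂μ) (x : M) : u t x = σ t := by
  have hIo : Ioo 0 t ⊆ Icc 0 t := Ioo_subset_Icc_self
  have huc : ∀ s ∈ Icc 0 t, Continuous (u s) := fun s hs => continuous_of_continuousOn_prod hu hs
  have hRe : ∀ s ∈ Icc 0 t, R s = fun x => ρ (ψ s x) / σ s := fun s hs => funext fun x => by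
    rw [eq_div_iff (hσ0 s hs).ne', ← hR s hs x, mul_comm]
  have hRc : ∀ s ∈ Icc 0 t, Continuous (R s) := fun s hs => by
    rw [hRe s hs]
    exact (hρ.comp (hψ s hs)).div_const _
  obtain ⟨Cρ, hCρ⟩ := isCompact_univ.exists_bound_of_continuousOn hρ.continuousOn
  obtain ⟨m, hm, hmσ⟩ : ∃ m > 0, ∀ s ∈ Icc 0 t, m ≤ σ s := by
    obtain ⟨s, hs, hmin⟩ := isCompact_Icc.exists_isMinOn ⟨0, left_mem_Icc.2 ht⟩ hσ
    exact ⟨σ s, hσ0 s hs, hmin⟩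
  have hRC : ∀ s ∈ Ioo 0 t, ∀ x, |R s x| ≤ Cρ / m := fun s hs x => by
    have h1 : |ρ (ψ s x)| ≤ Cρ := hCρ _ (mem_univ _)
    rw [hRe s (hIo hs), abs_div, abs_of_pos (hσ0 s (hIo hs))]
    have h2 := hmσ s (hIo hs)
    have h3 := (abs_nonneg _).trans h1
    gcongr
  let V := ∫ _ : M, (1 : ℝ) ∂μ
  let e := ∫ x, ρ x ∂μ
  have hA : ∀ s ∈ Icc 0 t, ∫ x, u s x ^ (n + 1) ∂μ = σ s ^ (n + 1) * V := fun s hs => by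
    have h1 := hvol s hs (fun _ => 1) continuous_const
    have h0 := hσ0 s hs
    simp only [one_mul, div_pow, integral_div] at h1
    rw [div_eq_iff (by positivity)] at h1
    rw [h1, mul_comm]
  have hA' : ∀ s ∈ Icc 0 t, ∫ x, R s x * u s x ^ (n + 1) ∂μ = σ s ^ n * e := fun s hs => by
    have h1 := hvol s hs ρ hρ
    have h0 := hσ0 s hs
    rw [hRe s hs]
    simp only [div_pow] at h1
    have h2 : ∀ x, ρ (ψ s x) / σ s * u s x ^ (n + 1) =
        σ s ^ n * (ρ (ψ s x) * (u s x ^ (n + 1) / σ s ^ (n + 1))) := fun x => by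
      field_simp
      ring
    simp only [h2]
    rw [integral_const_mul, h1]
  have hσd : ∀ s ∈ Ioo 0 t, deriv σ s * V = -e := fun s hs => by
    have h1 := hasDerivAt_integral_pow (μ := μ) (n + 1) hu (fun s hs => hRc s (hIo hs)) hRC hd hs
    have h2 : HasDerivAt (fun r => σ r ^ (n + 1) * V)
        (((n + 1 : ℕ) : ℝ) * σ s ^ n * deriv σ s * V) s :=
      ((hσ' s hs).hasDerivAt.pow (n + 1)).mul_const V
    have h3 : (fun r => σ r ^ (n + 1) * V) =ᶠ[𝓝 s] fun r => ∫ x, u r x ^ (n + 1) ∂μ := by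
      filter_upwards [isOpen_Ioo.mem_nhds hs] with r hr
      exact (hA r (hIo hr)).symm
    have h4 := (h2.congr_of_eventuallyEq h3.symm).unique h1
    rw [hA' s (hIo hs)] at h4
    have h5 : 0 < ((n + 1 : ℕ) : ℝ) * σ s ^ n := by
      have := hσ0 s (hIo hs)
      positivity
    apply mul_left_cancel₀ h5.ne'
    linarith
  let W : ℝ → ℝ := fun s => (∫ x, u s x ∂μ) - σ s * V
  have hWd : ∀ s ∈ Ioo 0 t, HasDerivAt W (e - ∫ x, R s x * u s x ∂μ) s := fun s hs => by
    have h1 := hasDerivAt_integral_pow (μ := μ) 1 hu (fun s hs => hRc s (hIo hs)) hRC hd hs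
    simp only [pow_one, Nat.cast_one, one_mul] at h1
    refine (h1.sub ((hσ' s hs).hasDerivAt.mul_const V)).congr_deriv ?_
    rw [hσd s hs]
    ring
  have hW : MonotoneOn W (Icc 0 t) := by
    refine monotoneOn_of_deriv_nonneg (convex_Icc 0 t)
      ((continuousOn_integral_pow hu).sub (hσ.mul continuousOn_const)) ?_ ?_
    · rw [interior_Icc]
      exact fun s hs => (hWd s hs).differentiableAt.differentiableWithinAt
    · rw [interior_Icc]
      intro s hs
      rw [(hWd s hs).deriv, sub_nonneg]
      exact hdiv s hs
  have hWt : 0 ≤ W t := by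
    have h1 := hW (left_mem_Icc.2 ht) (right_mem_Icc.2 ht) ht
    have h2 : W 0 = 0 := by simp only [W, hu1, hσ1, one_mul, V, sub_self]
    rwa [h2] at h1
  have htt := right_mem_Icc.2 ht
  have hg0 : ∀ x, 0 ≤ u t x ^ (n + 1) - σ t ^ (n + 1) - (n + 1) * σ t ^ n * (u t x - σ t) :=
    fun x => pow_sub_bernoulli_nonneg n (hu0 t htt x) (hσ0 t htt)
  have hgc : Continuous fun x =>
      u t x ^ (n + 1) - σ t ^ (n + 1) - (n + 1) * σ t ^ n * (u t x - σ t) := by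
    have := huc t htt
    fun_prop
  have hgi : ∫ x, (u t x ^ (n + 1) - σ t ^ (n + 1) - (n + 1) * σ t ^ n * (u t x - σ t)) ∂μ =
      -((n + 1) * σ t ^ n * W t) := by
    have i1 : Integrable (fun x => u t x ^ (n + 1)) μ :=
      integrable_of_continuous ((huc t htt).pow (n + 1))
    have i2 : Integrable (fun x => u t x) μ := integrable_of_continuous (huc t htt)
    have i3 : Integrable (fun x => u t x ^ (n + 1) - σ t ^ (n + 1)) μ :=
      i1.sub (integrable_const _)
    have i4 : Integrable (fun x => (n + 1) * σ t ^ n * (u t x - σ t)) μ :=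
      (i2.sub (integrable_const _)).const_mul _
    have hV : ∀ c : ℝ, ∫ _ : M, c ∂μ = c * V := fun c => by simp [V, mul_comm]
    rw [integral_sub i3 i4, integral_sub i1 (integrable_const _), integral_const_mul,
      integral_sub i2 (integrable_const _), hV, hV, hA t htt]
    ring
  have hz := hfaithful _ hgc hg0 (le_antisymm (by
    rw [hgi, neg_nonpos]
    have := hσ0 t htt
    positivity) (integral_nonneg hg0)) x
  exact eq_of_pow_le_bernoulli hn (hu0 t htt x) (hσ0 t htt) hz.le

end Rigidity

end CRGeometry

end


noncomputable section

namespace CRGeometry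

section Family

variable {E : Type*} [NormedAddCommGroup E] [NormedSpace ℝ E]
  {H : Type*} [TopologicalSpace H] {I : ModelWithCorners ℝ E H}
  {M : Type*} [TopologicalSpace M] [ChartedSpace H M] {s : Set ℝ}

theorem IsSmoothOneFormFamily.contMDiffOn_apply [IsManifold I 1 M]
    {θ : ℝ → ∀ x : M, TangentSpace I x →L[ℝ] ℝ} (hθ : IsSmoothOneFormFamily I s θ)
    {X : ∀ x : M, TangentSpace I x} (hX : IsSmoothField I X) :
    ContMDiffOn (𝓘(ℝ, ℝ).prod I) 𝓘(ℝ, ℝ) ∞ (fun p : ℝ × M => θ p.1 p.2 (X p.2))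
      (s ×ˢ univ) := by
  intro p hp
  have h2 := ContMDiffWithinAt.clm_bundle_apply (F₁ := E) (F₂ := ℝ) (n := ∞)
    (E₁ := (TangentSpace I : M → Type _)) (E₂ := Trivial M ℝ) (b := fun q : ℝ × M => q.2)
    (ϕ := fun q => (θ q.1 q.2 : TangentSpace I q.2 →L[ℝ] Trivial M ℝ q.2))
    (v := fun q => X q.2) (hθ p hp)
    ((hX p.2).comp_contMDiffWithinAt p (contMDiffWithinAt_snd))
  rw [contMDiffWithinAt_totalSpace] at h2
  exact h2.2

/-- The time derivative of a smooth function of time and space is continuous in space. -/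
theorem continuous_of_hasDerivWithinAt [I.Boundaryless] [IsManifold I ∞ M] {f : ℝ × M → ℝ}
    (hf : ContMDiffOn (𝓘(ℝ, ℝ).prod I) 𝓘(ℝ, ℝ) ∞ f (s ×ˢ univ)) (hs : UniqueDiffOn ℝ s)
    {t : ℝ} (ht : t ∈ s) {g : M → ℝ}
    (hg : ∀ x, HasDerivWithinAt (fun r => f (r, x)) (g x) s t) : Continuous g := by
  rw [continuous_iff_continuousAt]
  intro x₀
  let φ := extChartAt I x₀
  have hφ : IsOpen φ.target := isOpen_extChartAt_target x₀
  have hu : UniqueDiffOn ℝ (s ×ˢ φ.target) := hs.prod hφ.uniqueDiffOn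
  let F : ℝ × E → ℝ := fun q => f (q.1, φ.symm q.2)
  have hF : ContDiffOn ℝ ∞ F (s ×ˢ φ.target) := by
    have h1 : ContMDiffOn (𝓘(ℝ, ℝ).prod 𝓘(ℝ, E)) (𝓘(ℝ, ℝ).prod I) ∞
        (fun q : ℝ × E => (q.1, φ.symm q.2)) (s ×ˢ φ.target) :=
      contMDiffOn_fst.prodMk ((contMDiffOn_extChartAt_symm x₀).comp contMDiffOn_snd
        fun q hq => hq.2)
    have h2 := hf.comp h1 (fun q hq => ⟨hq.1, mem_univ _⟩)
    rw [← modelWithCornersSelf_prod, chartedSpaceSelf_prod] at h2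
    exact h2.contDiffOn
  have hF' : ContinuousOn (fun q => fderivWithin ℝ F (s ×ˢ φ.target) q (1, 0)) (s ×ˢ φ.target) :=
    (hF.continuousOn_fderivWithin hu (by simp)).clm_apply continuousOn_const
  have key : ∀ z ∈ φ.target, fderivWithin ℝ F (s ×ˢ φ.target) (t, z) (1, 0) = g (φ.symm z) := by
    intro z hz
    have h1 := (hF.differentiableOn (by simp) (t, z) ⟨ht, hz⟩).hasFDerivWithinAt
    have h2 : HasDerivWithinAt (fun r : ℝ => (r, z)) ((1 : ℝ), (0 : E)) s t :=
      (hasDerivWithinAt_id t s).prodMk (hasDerivWithinAt_const t s z)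
    have h3 := h1.comp_hasDerivWithinAt t h2
      (fun r hr => (⟨hr, hz⟩ : (r, z) ∈ s ×ˢ φ.target))
    exact (hs t ht).eq_deriv _ h3 (hg (φ.symm z))
  have hg' : ContinuousAt (fun z => g (φ.symm z)) (φ x₀) := by
    have h1 : ContinuousOn (fun z => fderivWithin ℝ F (s ×ˢ φ.target) (t, z) (1, 0)) φ.target :=
      hF'.comp (f := fun z => (t, z)) (by fun_prop) fun z hz => ⟨ht, hz⟩
    exact (h1.congr fun z hz => (key z hz).symm).continuousAt
      (hφ.mem_nhds (mem_extChartAt_target x₀))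
  have h3 : ContinuousAt (fun x => g (φ.symm (φ x))) x₀ :=
    ContinuousAt.comp (f := φ) (g := fun z => g (φ.symm z)) hg' (continuousAt_extChartAt x₀)
  refine h3.congr ?_
  filter_upwards [extChartAt_source_mem_nhds (I := I) x₀] with x hx
  rw [φ.left_inv hx]

end Family

section CR

variable {n : ℕ} {M : Type*} [TopologicalSpace M]
  [ChartedSpace (EuclideanSpace ℝ (Fin (2 * n + 1))) M] [IsManifold (𝓡 (2 * n + 1)) ∞ M]

namespace CRStructure

open AlmostCRStructure MeasureTheory

variable {S : CRStructure n M} {θ θ' : OneForm (𝓡 (2 * n + 1)) (M := M)}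
  {T T' : ∀ x : M, TangentSpace (𝓡 (2 * n + 1)) x}
  {D D' : CovariantDerivative (𝓡 (2 * n + 1)) (EuclideanSpace ℝ (Fin (2 * n + 1)))
    (TangentSpace (𝓡 (2 * n + 1)) : M → Type _)}

theorem IsPseudohermitian.ne_zero (hθ : S.IsPseudohermitian θ) (x : M) : θ x ≠ 0 := by
  intro h0
  have h1 : S.H x = ⊤ := by
    ext v
    simp [← hθ.ker_eq x v, h0]
  have h2 := S.finrank_H x
  rw [h1, finrank_top] at h2
  have h3 : Module.finrank ℝ (TangentSpace (𝓡 (2 * n + 1)) x) = 2 * n + 1 :=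
    finrank_euclideanSpace_fin
  omega

theorem IsPseudohermitian.eq_smul (hθ : S.IsPseudohermitian θ) (hθ' : S.IsPseudohermitian θ')
    (hT : IsReebField θ T) (x : M) : θ' x = θ' x (T x) • θ x := by
  ext v
  rw [smul_apply, smul_eq_mul]
  conv_lhs => rw [eq_smul_reeb_add hθ hT x v]
  rw [map_add, (hθ'.ker_eq x _).2 (horizontalProj hθ hT x v).2, map_smul, smul_eq_mul, add_zero,
    mul_comm]

theorem IsPseudohermitian.apply_reeb_ne_zero (hθ : S.IsPseudohermitian θ)
    (hθ' : S.IsPseudohermitian θ') (hT : IsReebField θ T) (x : M) : θ' x (T x) ≠ 0 := by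
  rw [Ne, hθ'.ker_eq, ← hθ.ker_eq, hT.apply_eq_one]
  exact one_ne_zero

/-- A finite measure on a compact pseudohermitian manifold that satisfies the divergence theorem
and transforms under CR diffeomorphisms by the conformal factor. -/
theorem IsTanakaWebster.exists_measure [T2Space M] [CompactSpace M] [MeasurableSpace M]
    [BorelSpace M] (hD : S.IsTanakaWebster θ T D) (hθ : S.IsPseudohermitian θ)
    (hT : IsReebField θ T) : ∃ μ : Measure M, IsFiniteMeasure μ ∧
      (∀ f : M → ℝ, Continuous f → (∀ x, 0 ≤ f x) → ∫ x, f x ∂μ = 0 → ∀ x, f x = 0) ∧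
      (∀ (ψ : Diffeomorph (𝓡 (2 * n + 1)) (𝓡 (2 * n + 1)) M M ∞) (v : M → ℝ),
        S.IsCRDiffeomorphism ψ → S.IsPseudohermitian (pullback ψ θ) → (∀ x, 0 < v x) →
        (∀ x, pullback ψ θ x = v x • θ x) → ∀ f : M → ℝ, Continuous f →
          ∫ x, f (ψ x) * v x ^ (n + 1) ∂μ = ∫ x, f x ∂μ) ∧
      ∀ X : S.HorizontalField, Continuous (hD.horizontalDiv X) →
        ∫ x, hD.horizontalDiv X x ∂μ = 0 := by
  obtain ⟨μ, h1, h2, h3, h4⟩ := hθ.isNondegenerateForm.exists_invariant_measure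
  refine ⟨μ, h1, h2, fun ψ v hψ hθ' hv hvθ f hf => ?_, fun X hX => ?_⟩
  · have p : S.ConformalPair θ (pullback ψ θ) T _ D _ v :=
      ⟨hθ, hθ', hT, IsCRDiffeomorphism.isReebField hθ hθ' rfl hT, hD,
        hψ.isTanakaWebster hθ hθ' rfl hD, hv, hvθ⟩
    have hdet : ∀ x, |LinearMap.det (p.contactMap x)| = v x ^ (n + 1) := fun x => by
      rw [p.det_contactMap, abs_of_pos (pow_pos (hv x) _)]
    have h5 := h3 ψ p.contactMap (fun x w w' => by
      rw [← p.contactForm_eq, IsPseudohermitian.contactForm_apply,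
        IsPseudohermitian.contactForm_apply,
        ← exteriorD_pullback ψ hθ.smooth hθ'.smooth (fun _ _ => rfl)]
      rfl) (by
        simp only [hdet]
        exact p.contMDiff.continuous.pow (n + 1)) f hf
    simpa only [hdet] using h5
  · have h5 := h4 D (hD.isMetricConnection hθ hT) X.field X.smooth_field
    simp only [hD.trace_eq_horizontalDiv] at h5
    exact h5 hX

theorem ConformalPair.integral_mul_websterScalar_le [T2Space M] [CompactSpace M]
    [MeasurableSpace M] [BorelSpace M] {u : M → ℝ} (p : S.ConformalPair θ θ' T T' D D' u)
    {μ : Measure M} [IsFiniteMeasure μ]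
    (hμ : ∀ X : S.HorizontalField, Continuous (p.webster.horizontalDiv X) →
        ∫ x, p.webster.horizontalDiv X x ∂μ = 0)
    (hR : Continuous (S.websterScalar θ)) (hR' : Continuous (S.websterScalar θ')) :
    ∫ x, S.websterScalar θ' x * u x ∂μ ≤ ∫ x, S.websterScalar θ x ∂μ := by
  have hg : Continuous fun x => p.pseudohermitian.levi x (p.grad.val x) (p.grad.val x) :=
    (p.pseudohermitian.contMDiff_levi p.grad p.grad).continuous
  have hu : Continuous u := p.contMDiff.continuous
  have h1 : ∀ x, (n + 1 : ℝ) * p.webster.horizontalDiv p.grad x = S.websterScalar θ x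
      - n * (n + 1) / 2 * p.pseudohermitian.levi x (p.grad.val x) (p.grad.val x)
      - S.websterScalar θ' x * u x := fun x => by
    rw [p.webster.websterScalar_eq p.pseudohermitian p.reeb,
      p.webster'.websterScalar_eq p.pseudohermitian' p.reeb', mul_comm _ (u x), p.mul_scalar_eq]
    ring
  have hn : (n + 1 : ℝ) ≠ 0 := by positivity
  have hd : Continuous (p.webster.horizontalDiv p.grad) := by
    have e : p.webster.horizontalDiv p.grad = fun x => (n + 1 : ℝ)⁻¹ * (S.websterScalar θ x
      - n * (n + 1) / 2 * p.pseudohermitian.levi x (p.grad.val x) (p.grad.val x)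
      - S.websterScalar θ' x * u x) := funext fun x => by
      rw [← h1, inv_mul_cancel_left₀ hn]
    rw [e]
    fun_prop
  have h2 := hμ p.grad hd
  have h3 : ∫ x, (S.websterScalar θ' x * u x + (n + 1 : ℝ) * p.webster.horizontalDiv p.grad x) ∂μ
      ≤ ∫ x, S.websterScalar θ x ∂μ := by
    refine integral_mono (integrable_of_continuous (by fun_prop)) (integrable_of_continuous hR)
      fun x => ?_
    have h4 : 0 ≤ p.pseudohermitian.levi x (p.grad.val x) (p.grad.val x) := by
      by_cases h0 : p.grad.val x = 0
      · simp [h0]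
      · exact (p.pseudohermitian.levi_self_pos x h0).le
    have h5 : 0 ≤ (n * (n + 1) / 2 : ℝ) *
      p.pseudohermitian.levi x (p.grad.val x) (p.grad.val x) := by positivity
    simp only [h1]
    linarith
  rwa [integral_add (integrable_of_continuous (by fun_prop))
    (integrable_of_continuous (by fun_prop)), integral_const_mul, h2, mul_zero, add_zero] at h3

theorem websterScalar_eq_zero (h : ¬∃ T D, IsReebField θ T ∧ S.IsTanakaWebster θ T D) (x : M) :
    S.websterScalar θ x = 0 :=
  dif_neg fun ⟨_, T, D, hT, hD, _⟩ => h ⟨T, D, hT, hD⟩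

end CRStructure

end CR

end CRGeometry

end


noncomputable section

namespace CRGeometry

section TimeInterval

variable {T : EReal} {t : ℝ}

theorem Icc_subset_timeInterval (ht : t ∈ timeInterval T) : Icc 0 t ⊆ timeInterval T :=
  fun _ hs => ⟨hs.1, (EReal.coe_le_coe_iff.2 hs.2).trans_lt ht.2⟩

theorem timeInterval_mem_nhds (ht : t ∈ timeInterval T) {s : ℝ} (hs : s ∈ Ioo 0 t) :
    timeInterval T ∈ 𝓝 s :=
  Filter.mem_of_superset (Icc_mem_nhds hs.1 hs.2) (Icc_subset_timeInterval ht)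

theorem zero_mem_timeInterval (hT : 0 < T) : 0 ∈ timeInterval T := ⟨le_rfl, hT⟩

theorem uniqueDiffOn_timeInterval (hT : 0 < T) : UniqueDiffOn ℝ (timeInterval T) := by
  have h1 : (timeInterval T).OrdConnected :=
    ⟨fun a ha b hb c hc => ⟨ha.1.trans hc.1, (EReal.coe_le_coe_iff.2 hc.2).trans_lt hb.2⟩⟩
  obtain ⟨b, hb, hbT⟩ := EReal.lt_iff_exists_real_btwn.1 hT
  have hb0 : 0 < b := by exact_mod_cast hb
  exact uniqueDiffOn_convex h1.convex ⟨b / 2, mem_interior_iff_mem_nhds.2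
    (timeInterval_mem_nhds ⟨hb0.le, hbT⟩ ⟨half_pos hb0, half_lt_self hb0⟩)⟩

theorem pos_of_continuousOn_timeInterval {f : ℝ → ℝ} (hf : ContinuousOn f (timeInterval T))
    (h0 : f 0 = 1) (hne : ∀ t ∈ timeInterval T, f t ≠ 0) (ht : t ∈ timeInterval T) : 0 < f t := by
  by_contra hlt
  have h1 : (0 : ℝ) ∈ Icc (f t) (f 0) := ⟨not_lt.1 hlt, h0 ▸ zero_le_one⟩
  obtain ⟨s, hs, hs0⟩ := intermediate_value_Icc' ht.1 (hf.mono (Icc_subset_timeInterval ht)) h1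
  exact hne s (Icc_subset_timeInterval ht hs) hs0

end TimeInterval

section CR

variable {n : ℕ} {M : Type*} [TopologicalSpace M]
  [ChartedSpace (EuclideanSpace ℝ (Fin (2 * n + 1))) M] [IsManifold (𝓡 (2 * n + 1)) ∞ M]

namespace CRStructure

open AlmostCRStructure MeasureTheory

variable {S : CRStructure n M} {T : EReal} {θ : ℝ → OneForm (𝓡 (2 * n + 1)) (M := M)}
  {V : ∀ x : M, TangentSpace (𝓡 (2 * n + 1)) x}

namespace IsCRYamabeFlow

variable (hf : S.IsCRYamabeFlow T θ) (hV : IsReebField (θ 0) V)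

include hf hV

theorem pos (hT : 0 < T) {t : ℝ} (ht : t ∈ timeInterval T) (x : M) : 0 < θ t x (V x) :=
  pos_of_continuousOn_timeInterval (f := fun s => θ s x (V x))
    (fun s hs => (hf.evolution s hs x (V x)).continuousWithinAt) (hV.apply_eq_one x)
    (fun s hs => (hf.pseudohermitian 0 (zero_mem_timeInterval hT)).apply_reeb_ne_zero
      (hf.pseudohermitian s hs) hV x) ht

theorem continuous_websterScalar_zero (hT : 0 < T) : Continuous (S.websterScalar (θ 0)) := by
  have h0 := zero_mem_timeInterval hT
  have h1 := continuous_of_hasDerivWithinAt (hf.smooth.contMDiffOn_apply hV.smooth)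
    (uniqueDiffOn_timeInterval hT) h0 (g := fun x => -S.websterScalar (θ 0) x) fun x => by
      simpa only [hV.apply_eq_one, mul_one] using hf.evolution 0 h0 x (V x)
  simpa only [Pi.neg_def, neg_neg] using h1.neg

theorem continuousOn_apply_reeb {t : ℝ} (ht : t ∈ timeInterval T) :
    ContinuousOn (fun p : ℝ × M => θ p.1 p.2 (V p.2)) (Icc 0 t ×ˢ univ) :=
  (hf.smooth.contMDiffOn_apply hV.smooth).continuousOn.mono
    (prod_mono (Icc_subset_timeInterval ht) Subset.rfl)

end IsCRYamabeFlow

/-- The existence of a Tanaka-Webster connection is invariant under CR diffeomorphisms and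
constant rescalings. -/
theorem exists_isTanakaWebster_of_isCRDiffeomorphism [T2Space M]
    {η η' : OneForm (𝓡 (2 * n + 1)) (M := M)}
    {ψ : Diffeomorph (𝓡 (2 * n + 1)) (𝓡 (2 * n + 1)) M M ∞} (hψ : S.IsCRDiffeomorphism ψ)
    (hη : S.IsPseudohermitian η) (hη' : S.IsPseudohermitian η') {c : ℝ} (hc : 0 < c)
    (h : ∀ x, η' x = c • pullback ψ η x)
    (hex : ∃ V D, IsReebField η' V ∧ S.IsTanakaWebster η' V D) :
    ∃ V D, IsReebField η V ∧ S.IsTanakaWebster η V D := by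
  obtain ⟨V, D, hV, hD⟩ := hex
  obtain ⟨V', D', hV', hD', -⟩ := hψ.symm.exists_isTanakaWebster hη' hη (inv_pos.2 hc)
    (fun x => by
      ext v
      have h1 : mfderiv (𝓡 (2 * n + 1)) (𝓡 (2 * n + 1)) ψ (ψ.symm x)
          (mfderiv (𝓡 (2 * n + 1)) (𝓡 (2 * n + 1)) ψ.symm x v) = v := by
        have h2 := mfderiv_comp_apply (I := 𝓡 (2 * n + 1)) (I' := 𝓡 (2 * n + 1))
          (I'' := 𝓡 (2 * n + 1)) x (ψ.mdifferentiable (by simp) (ψ.symm x))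
          (ψ.symm.mdifferentiable (by simp) x) v
        have e : (ψ ∘ ψ.symm : M → M) = id := funext ψ.apply_symm_apply
        rw [← h2, e, mfderiv_id]
        rfl
      change η x v = c⁻¹ * η' (ψ.symm x) _
      rw [h]
      change _ = c⁻¹ * (c * η (ψ (ψ.symm x)) (mfderiv (𝓡 (2 * n + 1)) (𝓡 (2 * n + 1)) ψ (ψ.symm x)
          (mfderiv (𝓡 (2 * n + 1)) (𝓡 (2 * n + 1)) ψ.symm x v)))
      rw [inv_mul_cancel_left₀ hc.ne', h1, ψ.apply_symm_apply]) hV hD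
  exact ⟨V', D', hV', hD'⟩

/-- The conformal factor of a CR Yamabe soliton depends on time only. -/
theorem IsCRYamabeFlow.apply_reeb_eq_of_selfSimilar [T2Space M] [CompactSpace M] (hn : 1 ≤ n)
    (hT : 0 < T) (hf : S.IsCRYamabeFlow T θ) (hV : IsReebField (θ 0) V)
    {D : CovariantDerivative (𝓡 (2 * n + 1)) (EuclideanSpace ℝ (Fin (2 * n + 1)))
      (TangentSpace (𝓡 (2 * n + 1)) : M → Type _)} (hD : S.IsTanakaWebster (θ 0) V D)
    {σ : ℝ → ℝ} {ψ : ℝ → Diffeomorph (𝓡 (2 * n + 1)) (𝓡 (2 * n + 1)) M M ∞}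
    (hσ : ContDiffOn ℝ ∞ σ (timeInterval T)) (hσ1 : σ 0 = 1)
    (hσ0 : ∀ t ∈ timeInterval T, 0 < σ t)
    (hψ : ∀ t ∈ timeInterval T, S.IsCRDiffeomorphism (ψ t))
    (hs : ∀ t ∈ timeInterval T, ∀ x, θ t x = σ t • pullback (ψ t) (θ 0) x)
    {t : ℝ} (ht : t ∈ timeInterval T) (x : M) : θ t x (V x) = σ t := by
  let _ : MeasurableSpace M := borel M
  have : BorelSpace M := ⟨rfl⟩
  have h0 := hf.pseudohermitian 0 (zero_mem_timeInterval hT)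
  obtain ⟨μ, _, hμ, hμψ, hμD⟩ := hD.exists_measure h0 hV
  have hI := Icc_subset_timeInterval ht
  have hIo : Ioo 0 t ⊆ timeInterval T := Ioo_subset_Icc_self.trans hI
  have hρ := hf.continuous_websterScalar_zero hV hT
  have hW : ∀ s ∈ timeInterval T, ∃ V' D', IsReebField (θ s) V' ∧ S.IsTanakaWebster (θ s) V' D' ∧
      ∀ x, σ s * S.websterScalar (θ s) x = S.websterScalar (θ 0) (ψ s x) := fun s hs' =>
    (hψ s hs').exists_isTanakaWebster h0 (hf.pseudohermitian s hs') (hσ0 s hs') (hs s hs') hV hD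
  have hR : ∀ s ∈ timeInterval T, ∀ x,
      σ s * S.websterScalar (θ s) x = S.websterScalar (θ 0) (ψ s x) := fun s hs' =>
    (hW s hs').choose_spec.choose_spec.2.2
  have hRc : ∀ s ∈ timeInterval T, Continuous (S.websterScalar (θ s)) := fun s hs' => by
    have e : S.websterScalar (θ s) = fun x => (σ s)⁻¹ * S.websterScalar (θ 0) (ψ s x) :=
      funext fun x => by rw [← hR s hs', inv_mul_cancel_left₀ (hσ0 s hs').ne']
    rw [e]
    exact continuous_const.mul (hρ.comp (ψ s).continuous)
  refine eq_of_selfSimilar (μ := μ) (u := fun s x => θ s x (V x))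
    (R := fun s => S.websterScalar (θ s)) (ρ := S.websterScalar (θ 0)) (ψ := fun s => ψ s) hn hμ
    ht.1 (hf.continuousOn_apply_reeb hV ht) (fun s hs' => hf.pos hV hT (hI hs'))
    hV.apply_eq_one (hσ.continuousOn.mono hI)
    (fun s hs' => (hσ.differentiableOn (by simp)).differentiableAt (timeInterval_mem_nhds ht hs'))
    (fun s hs' => hσ0 s (hI hs')) hσ1 hρ (fun s _ => (ψ s).continuous)
    (fun s hs' x => (hf.evolution s (hIo hs') x (V x)).hasDerivAt (timeInterval_mem_nhds ht hs'))
    (fun s hs' => hR s (hI hs')) (fun s hs' => ?_) (fun s hs' => ?_) x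
  · have hc := hσ0 s (hI hs')
    have e : ∀ x, pullback (ψ s) (θ 0) x = (σ s)⁻¹ • θ s x := fun x => by
      rw [hs s (hI hs'), inv_smul_smul₀ hc.ne']
    refine hμψ (ψ s) _ (hψ s (hI hs'))
      ((hf.pseudohermitian s (hI hs')).const_smul (inv_pos.2 hc) e)
      (fun x => div_pos (hf.pos hV hT (hI hs') x) hc) fun x => ?_
    rw [e]
    conv_lhs => rw [h0.eq_smul (hf.pseudohermitian s (hI hs')) hV x]
    rw [smul_smul, div_eq_inv_mul]
  · obtain ⟨V', D', hV', hD', -⟩ := hW s (hIo hs')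
    have p : S.ConformalPair (θ 0) (θ s) V V' D D' (fun x => θ s x (V x)) :=
      ⟨h0, hf.pseudohermitian s (hIo hs'), hV, hV', hD, hD', hf.pos hV hT (hIo hs'),
        h0.eq_smul (hf.pseudohermitian s (hIo hs')) hV⟩
    exact p.integral_mul_websterScalar_le hμD hρ (hRc s (hIo hs'))

end CRStructure

end CR

end CRGeometry

end

theorem theorem1p2 {n : ℕ} (hn : 1 ≤ n) {M : Type*} [TopologicalSpace M]
    [ChartedSpace (EuclideanSpace ℝ (Fin (2 * n + 1))) M] [IsManifold (𝓡 (2 * n + 1)) ∞ M]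
    [T2Space M] [CompactSpace M] (S : CRGeometry.CRStructure n M)
    (T : EReal) (hT : 0 < T) (θ : ℝ → CRGeometry.OneForm (𝓡 (2 * n + 1)) (M := M))
    (hθ : S.IsCRYamabeSoliton T θ) :
    ∀ t ∈ CRGeometry.timeInterval T, ∃ c : ℝ, ∀ x : M, S.websterScalar (θ t) x = c := by
  intro t ht
  rcases isEmpty_or_nonempty M with hM | ⟨⟨x₀⟩⟩
  · exact ⟨0, fun x => hM.elim x⟩
  obtain ⟨hf, σ, ψ, hσ, hσ1, hψ, -, hs⟩ := hθ
  have h0 := hf.pseudohermitian 0 (CRGeometry.zero_mem_timeInterval hT)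
  have hσ0 : ∀ s ∈ CRGeometry.timeInterval T, 0 < σ s := fun s hs' =>
    CRGeometry.pos_of_continuousOn_timeInterval hσ.continuousOn hσ1 (fun r hr h => by
      refine (hf.pseudohermitian r hr).ne_zero x₀ ?_
      rw [hs r hr, h, zero_smul]) hs'
  by_cases hex : ∃ V D, CRGeometry.IsReebField (θ 0) V ∧ S.IsTanakaWebster (θ 0) V D
  · obtain ⟨V, D, hV, hD⟩ := hex
    have hu : ∀ s ∈ CRGeometry.timeInterval T, ∀ x, θ s x (V x) = σ s := fun s hs' =>
      hf.apply_reeb_eq_of_selfSimilar hn hT hV hD hσ hσ1 hσ0 hψ hs hs'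
    have hd : ∀ x, HasDerivWithinAt σ (-(S.websterScalar (θ t) x * σ t))
        (CRGeometry.timeInterval T) t := fun x => by
      have h1 := hf.evolution t ht x (V x)
      rw [hu t ht] at h1
      exact h1.congr (fun s hs' => (hu s hs' x).symm) (hu t ht x).symm
    refine ⟨S.websterScalar (θ t) x₀, fun x => ?_⟩
    have h2 := (CRGeometry.uniqueDiffOn_timeInterval hT t ht).eq_deriv _ (hd x) (hd x₀)
    exact mul_right_cancel₀ (hσ0 t ht).ne' (neg_inj.1 h2)
  · exact ⟨0, fun x => CRGeometry.CRStructure.websterScalar_eq_zero (fun h => hex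
      (CRGeometry.CRStructure.exists_isTanakaWebster_of_isCRDiffeomorphism (hψ t ht) h0
        (hf.pseudohermitian t ht) (hσ0 t ht) (hs t ht) h)) x⟩
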